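/- Fix $\sigma_h^2,\sigma_{\mathcal E}^2,\sigma_Z^2,Q,\bar P>0$ and $\alpha\in[0,1]$; $C\mathcal N(m,v)$ is the circularly symmetric complex Gaussian law of mean $m$ and variance $v$. **Channel.** $Y=H(X+S)+Z$, with $Z\sim C\mathcal N(0,\sigma_Z^2)$, state $S\sim C\mathcal N(0,Q)$ known non-causally at the transmitter, fading $H\sim C\mathcal N(0,\sigma_h^2)$. The receiver (not the transmitter) knows an estimate $\hat H=H+\mathcal E$, with $\mathcal E\sim C\mathcal N(0,\sigma_{\mathcal E}^2)$ independent of $H$. The composite channel $\widetilde W(\cdot|x,s,\hat h)$ is the average of $W(\cdot|x,s,h)=C\mathcal N(h(x+s),\sigma_Z^2)$ over the conditional law of $H$ given $\hat H=\hat h$. **Capacity.** For an input law $P(u,x|s)$ not depending on $\hat H$, with $E|X|^2\le\bar P$ and $U - (X,S) - Y$ Markov, the mean rate is $E_{\hat H}[I(U;Y|\hat H=\hat h)-I(U;S)]$ (in bits, over $\widetilde W$). The single-letter capacity is the supremum of these mean rates. The operational mean capacity $\bar C$ is the limit as $\varepsilon\downarrow0$ of $\sup_\Phi E_{\hat H}[C_\varepsilon(\Phi,\hat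 H)]$. Here $\Phi=(\varphi_n)$ runs over sequences of encoders $x^n=\varphi_n(m,s^n)$ that do not depend on $\hat H$ and satisfy $E\|\varphi_n(m,S^n)\|^2\le n\bar P$ for every message $m$. $C_\varepsilon(\Phi,\hat h)$ is the largest $R$ such that for every $\eta>0$ and all large $n$ there are $M\ge 2^{n(R-\eta)}$ and a decoder, which may depend on $\hat h$, whose error probability is at most $\varepsilon$ for each of the first $M$ messages. The error probability is averaged over the states and over fading coefficients that are i.i.d. from the conditional law of $H$ given $\hat H=\hat h$. **Scheme.** $X\sim C\mathcal N(0,\bar P)$ independent of $S$, and $U=X+\alpha S$. With $\delta=\sigma_h^2/(\sigma_h^2+\sigma_{\mathcal E}^2)$ put $\mathbb P=\delta^2|\hat H|^2\bar P$, $\mathbb Q=\delta^2|\hat H|^2Q$, $\mathbb N=\sigma_Z^2+\delta\sigma_{\mathcal E}^2(\bar P+Q)$, and $$\bar C_{Rx}(\alpha)=E_{\hat H}\log_2\frac{\mathbb P(\mathbb P+\mathbb Q+\mathbb N)}{\mathbb P\mathbb Q(1-\alpha)^2+\mathbb N(\mathbb P+\alpha^2\mathbb Q)} .$$ **Claim.**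 The integrand of $\bar C_{Rx}(\alpha)$ is integrable, and the scheme satisfies the power constraint. Let $I_G(U;Y)$ be the mutual information of the scheme over the Gaussian channel $C\mathcal N(\delta\hat h(x+s),\mathbb N)$, in which the noise of the composite channel is replaced by independent Gaussian noise of the same power. Then for almost every value $\hat h$ of $\hat H$ $$I_G(U;Y)=\log_2\frac{(\mathbb P+\mathbb Q+\mathbb N)(\mathbb P+\alpha^2\mathbb Q)}{\mathbb P\mathbb Q(1-\alpha)^2+\mathbb N(\mathbb P+\alpha^2\mathbb Q)},\qquad I(U;S)=\log_2\frac{\mathbb P+\alpha^2\mathbb Q}{\mathbb P},$$ and over the composite channel $I(U;Y|\hat H=\hat h)\ge I_G(U;Y)$. Consequently $E_{\hat H}[I_G(U;Y)-I(U;S)]=\bar C_{Rx}(\alpha)$. The rate $\bar C_{Rx}(\alpha)$ is achievable: it is at most the mean rate of the scheme over the composite channel, at most the single-letter capacity, and at most the operational mean capacity $\bar C$. -/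

import Mathlib

open MeasureTheory ProbabilityTheory
open scoped ENNReal NNReal

noncomputable section

namespace FadingCosta

/-! ### Complex Gaussian laws, mutual information -/

/-- The circularly symmetric complex Gaussian law `CN(m, v)`: independent real and imaginary parts,
each of variance `v / 2` (`v` is the total variance `E|ζ - m|²`). -/
def cgauss (m : ℂ) (v : ℝ) : Measure ℂ :=
  ((gaussianReal 0 (v / 2).toNNReal).prod (gaussianReal 0 (v / 2).toNNReal)).map
    (fun p : ℝ × ℝ => m + ((p.1 : ℂ) + (p.2 : ℂ) * Complex.I))

instance (m : ℂ) (v : ℝ) : IsProbabilityMeasure (cgauss m v) := by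
  unfold cgauss
  exact Measure.isProbabilityMeasure_map (by fun_prop)

/-- Mutual information, in bits, of the two coordinates of a joint law: the Kullback-Leibler
divergence between the joint law and the product of its marginals. -/
def mutualInfo {A B : Type*} [MeasurableSpace A] [MeasurableSpace B] (J : Measure (A × B)) : ℝ≥0∞ :=
  InformationTheory.klDiv J (J.fst.prod J.snd) / ENNReal.ofReal (Real.log 2)

/-! ### The channel -/

/-- Parameters: variance `σh2` of the fading `H`, variance `σE2` of the estimation error,
variance `σZ2` of the additive noise `Z`, power `Q` of the state `S`, input power `Pbar`. -/
structure Params where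
  σh2 : ℝ
  σE2 : ℝ
  σZ2 : ℝ
  Q : ℝ
  Pbar : ℝ

variable (p : Params)

/-- The law of the state `S`. -/
def stateLaw : Measure ℂ := cgauss 0 p.Q

instance : IsProbabilityMeasure (stateLaw p) := by unfold stateLaw; infer_instance

/-- The channel `W(· | x, s, h)`, the law of `h (x + s) + Z` with `Z ∼ CN(0, σZ2)`;
its argument is `((x, s), h)`. -/
def channel : Kernel ((ℂ × ℂ) × ℂ) ℂ :=
  (Kernel.id ×ₖ Kernel.const _ (cgauss 0 p.σZ2)).map
    (fun q : ((ℂ × ℂ) × ℂ) × ℂ => q.1.2 * (q.1.1.1 + q.1.1.2) + q.2)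

instance : IsMarkovKernel (channel p) := by
  unfold channel
  exact Kernel.IsMarkovKernel.map _ (by fun_prop)

/-- The joint law of `(Ĥ, H)`, where `Ĥ = H + E` with `H ∼ CN(0, σh2)` and `E ∼ CN(0, σE2)`
independent. -/
def estimateJoint : Measure (ℂ × ℂ) :=
  ((cgauss 0 p.σh2).prod (cgauss 0 p.σE2)).map (fun q : ℂ × ℂ => (q.1 + q.2, q.1))

instance : IsProbabilityMeasure (estimateJoint p) := by
  unfold estimateJoint
  exact Measure.isProbabilityMeasure_map (by fun_prop)

/-- The law of the estimate `Ĥ`. -/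
def estimateLaw : Measure ℂ := (estimateJoint p).fst

instance : IsProbabilityMeasure (estimateLaw p) := by unfold estimateLaw; infer_instance

/-- The conditional law of `H` given `Ĥ`. -/
def posterior : Kernel ℂ ℂ := (estimateJoint p).condKernel

instance : IsMarkovKernel (posterior p) := by unfold posterior; infer_instance

/-- The composite channel `W̃(· | x, s, ĥ)`: the average of `W(· | x, s, h)` over `h` drawn from the
conditional law of `H` given `Ĥ = ĥ`. -/
def composite (hhat : ℂ) : Kernel (ℂ × ℂ) ℂ :=
  (channel p) ∘ₖ (Kernel.id ×ₖ Kernel.const (ℂ × ℂ) (posterior p hhat))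

instance (hhat : ℂ) : IsMarkovKernel (composite p hhat) := by unfold composite; infer_instance

/-! ### Single-letter quantities -/

/-- The joint law of `(S, (U, X))` for an input distribution `P(u, x | s)`, given as a kernel. -/
def inputLaw (K : Kernel ℂ (ℂ × ℂ)) : Measure (ℂ × (ℂ × ℂ)) := (stateLaw p) ⊗ₘ K

/-- `I(U; S)`. -/
def infoUS (K : Kernel ℂ (ℂ × ℂ)) : ℝ≥0∞ :=
  mutualInfo ((inputLaw p K).map (fun q => (q.2.1, q.1)))

/-- `I(U; Y)` when `Y` is the output of the channel `V(· | x, s)`, so that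
`U - (X, S) - Y` is a Markov chain. -/
def infoUY (K : Kernel ℂ (ℂ × ℂ)) (V : Kernel (ℂ × ℂ) ℂ) : ℝ≥0∞ :=
  mutualInfo
    (((inputLaw p K) ⊗ₘ (V.comap (fun q : ℂ × (ℂ × ℂ) => (q.2.2, q.1)) (by fun_prop))).map
      (fun q => (q.1.2.1, q.2)))

/-- Input distributions `P(u, x | s)` that do not depend on the estimate and satisfy the power
constraint `E|X|² ≤ Pbar`. The auxiliary alphabet is `ℂ`, into which every standard Borel space
embeds. -/
def Admissible (K : Kernel ℂ (ℂ × ℂ)) : Prop :=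
  IsMarkovKernel K ∧ ∫⁻ q, ‖q.2.2‖ₑ ^ 2 ∂(inputLaw p K) ≤ ENNReal.ofReal p.Pbar

/-- The mean rate `E_Ĥ[I(U; Y | Ĥ = ĥ) - I(U; S)]` of an input distribution over the composite
channel; the second term does not depend on `ĥ`. (`⊥` if `I(U; S)` is infinite.) -/
def meanRate (K : Kernel ℂ (ℂ × ℂ)) : EReal :=
  ((∫⁻ hhat, infoUY p K (composite p hhat) ∂(estimateLaw p) : ℝ≥0∞) : EReal)
    - ((infoUS p K : ℝ≥0∞) : EReal)

/-- The single-letter capacity expression `sup_{P(u,x|s)} E_Ĥ[I(U; Y | Ĥ) - I(U; S)]`. -/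
def singleLetterCapacity : EReal :=
  ⨆ (K : Kernel ℂ (ℂ × ℂ)) (_ : Admissible p K), meanRate p K

/-! ### Operational capacity -/

/-- A sequence of encoders. For block length `n` the codeword `enc n m s` depends on the message
`m` and the whole state sequence `s`, but not on the channel estimate; for each message the average
energy per symbol is at most `Pbar`. -/
structure Encoders where
  enc : (n : ℕ) → ℕ → (Fin n → ℂ) → (Fin n → ℂ)
  measurable_enc : ∀ n m, Measurable (enc n m)
  power_le : ∀ n m, ∫⁻ s, ∑ i, ‖enc n m s i‖ₑ ^ 2 ∂(Measure.pi fun _ : Fin n => stateLaw p)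
    ≤ n * ENNReal.ofReal p.Pbar

/-- The error probability of message `m` at the estimate `ĥ`, averaged over the state sequence and
over the fading coefficients `θ₁, …, θₙ`, which are i.i.d. from the conditional law of `H` given
`Ĥ = ĥ`. Given these, the output is distributed as `∏ᵢ W(· | xᵢ, sᵢ, θᵢ)`. -/
def errorProb {n : ℕ} (f : (Fin n → ℂ) → (Fin n → ℂ)) (dec : (Fin n → ℂ) → ℕ) (m : ℕ)
    (hhat : ℂ) : ℝ≥0∞ :=
  ∫⁻ s, ∫⁻ θ, (Measure.pi fun i => channel p ((f s i, s i), θ i)) {y | dec y ≠ m}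
    ∂(Measure.pi fun _ : Fin n => posterior p hhat) ∂(Measure.pi fun _ : Fin n => stateLaw p)

/-- The rate `R` is `ε`-achievable at the estimate `ĥ` with the encoders `Φ`: for every `η > 0` and
all large `n` there are a number `M` of messages with `n⁻¹ log₂ M ≥ R - η` and a decoder, chosen
knowing `ĥ`, for which the maximal error probability over the messages `0, …, M - 1` is at
most `ε`. -/
def EpsAchievable (Φ : Encoders p) (ε : ℝ) (hhat : ℂ) (R : ℝ≥0) : Prop :=
  ∀ η : ℝ, 0 < η → ∀ᶠ n : ℕ in Filter.atTop,
    ∃ (M : ℕ) (dec : (Fin n → ℂ) → ℕ), (2 : ℝ) ^ ((n : ℝ) * ((R : ℝ) - η)) ≤ (M : ℝ) ∧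
      Measurable dec ∧ ∀ m < M, errorProb p (Φ.enc n m) dec m hhat ≤ ENNReal.ofReal ε

/-- The largest `ε`-achievable rate at the estimate `ĥ` with the encoders `Φ`. -/
def epsCapacity (Φ : Encoders p) (ε : ℝ) (hhat : ℂ) : ℝ≥0∞ :=
  ⨆ (R : ℝ≥0) (_ : EpsAchievable p Φ ε hhat R), (R : ℝ≥0∞)

/-- The mean capacity over all channel estimates: the limit as `ε ↓ 0` (an infimum, by
monotonicity) of the best mean over `Ĥ` of the `ε`-capacity, over encoders ignorant of `Ĥ`. -/
def meanCapacity : ℝ≥0∞ :=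
  ⨅ (ε : ℝ) (_ : 0 < ε ∧ ε < 1), ⨆ Φ : Encoders p,
    ∫⁻ hhat, epsCapacity p Φ ε hhat ∂(estimateLaw p)

/-! ### Dirty-paper coding with Gaussian inputs -/

/-- The input distribution of dirty-paper coding: `X ∼ CN(0, Pbar)` independent of `S`,
and `U = X + α S`. -/
def dpcInput (α : ℝ) : Kernel ℂ (ℂ × ℂ) :=
  (Kernel.id ×ₖ Kernel.const _ (cgauss 0 p.Pbar)).map
    (fun q : ℂ × ℂ => (q.2 + (α : ℂ) * q.1, q.2))

instance (α : ℝ) : IsMarkovKernel (dpcInput p α) := by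
  unfold dpcInput
  exact Kernel.IsMarkovKernel.map _ (by fun_prop)

/-- `δ = σh2 / (σh2 + σE2)`. -/
def dlt : ℝ := p.σh2 / (p.σh2 + p.σE2)

/-- The scaled input power `δ² |ĥ|² Pbar`. -/
def PP (hhat : ℂ) : ℝ := (dlt p) ^ 2 * ‖hhat‖ ^ 2 * p.Pbar

/-- The scaled state power `δ² |ĥ|² Q`. -/
def QQ (hhat : ℂ) : ℝ := (dlt p) ^ 2 * ‖hhat‖ ^ 2 * p.Q

/-- The effective noise power `σZ2 + δ σE2 (Pbar + Q)`. -/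
def NN : ℝ := p.σZ2 + dlt p * p.σE2 * (p.Pbar + p.Q)

/-- The Gaussian channel `CN(δ ĥ (x + s), NN)`, in which the noise of the composite channel is
replaced by independent Gaussian noise of the same power. -/
def gaussComposite (hhat : ℂ) : Kernel (ℂ × ℂ) ℂ :=
  (Kernel.id ×ₖ Kernel.const _ (cgauss 0 (NN p))).map
    (fun q : (ℂ × ℂ) × ℂ => ((dlt p : ℝ) : ℂ) * hhat * (q.1.1 + q.1.2) + q.2)

instance (hhat : ℂ) : IsMarkovKernel (gaussComposite p hhat) := by
  unfold gaussComposite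
  exact Kernel.IsMarkovKernel.map _ (by fun_prop)

/-- The integrand of the rate formula. -/
def rateIntegrand (α : ℝ) (hhat : ℂ) : ℝ :=
  Real.logb 2 (PP p hhat * (PP p hhat + QQ p hhat + NN p) /
    (PP p hhat * QQ p hhat * (1 - α) ^ 2 + NN p * (PP p hhat + α ^ 2 * QQ p hhat)))

end FadingCosta

end

noncomputable section

namespace FadingCosta

/-! ### Densities of complex Gaussian laws -/

/-! Bayes' rule for complex Gaussians (`cgaussPDF_bayes`) shows that, given `Ĥ = ĥ`, the fading is
`CN(δ ĥ, δ σE2)` (`posterior_ae_eq`). The composite channel is therefore `Y = δ ĥ (X + S) + W (X +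
S) + Z` with `W ∼ CN(0, δ σE2)`; the effective noise `W (X + S) + Z` depends on `(X, S)`, but it is
uncorrelated with `X` and `S` and has power `NN`.

Single-letter part. In the Gaussian model both mutual informations belong to jointly Gaussian pairs,
and each is the logarithm of a variance over the residual variance of a linear regression
(`mutualInfo_gaussian`). Over the composite channel the law of `U` and the second moments of `(U,
Y)` are the same as in the Gaussian model. Let `f` be the Gaussian log-likelihood ratio. For every
fixed `y`, `exp f` integrates to one against the law of `U`, so its mean under the product of the
marginals is one whatever the law of `Y`; the mean of `f` under the joint law depends on second
moments only. The variational inequality `KL ≥ E f - log E exp f` then gives `le_mutualInfo`: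
Gaussian noise is the worst case.

Operational part. The code is Gelfand-Pinsker binning. A message owns a bin of slightly more than
`exp (n I(U;S))` Gaussian words; the encoder finds a word `u` typical with the state `s` and sends
`u - α s`; the decoder looks for a bin with a word that passes a distance test and an energy test.
Covering is a change of measure (`pi_cgauss_shift_le`), packing is a Chernoff bound
(`pi_cgauss_packing_le`). Only empirical energies enter, and the weak law controls them
(`rare_atypical`), so the Gaussian rate is attained although `Y` is not Gaussian.

The encoder does not know `ĥ`. A compact set of gains is covered by finitely many cells, each with
its own rate, and one codebook must serve them all: in cell `k` only the first `M k` messages are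
decoded. `exists_expurgated_code` makes the maximal error small for all these nested message sets at
once. Inside a cell the tests are loosened so that events at its centre control the errors at every
gain of the cell (`mem_testSet_of_typical`, `mem_testSet_conf`).

Codes are designed for an input power `P < Pbar`, so that every transmitted word obeys the power
constraint surely (`exists_encoders`). Letting `P` tend to `Pbar`, the rate loss to zero and the
compact set to `ℂ`, Fatou's lemma bounds the mean capacity below by the mean of the positive part of
the rate, which dominates the mean rate. -/

/-- The density of `CN(m, v)`. -/
def cgaussPDF (m : ℂ) (v : ℝ) (z : ℂ) : ℝ := (Real.pi * v)⁻¹ * Real.exp (-‖z - m‖ ^ 2 / v)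

lemma cgaussPDF_pos (m : ℂ) {v : ℝ} (hv : 0 < v) (z : ℂ) : 0 < cgaussPDF m v z := by
  unfold cgaussPDF; positivity

@[fun_prop]
lemma measurable_cgaussPDF_comp {β : Type*} [MeasurableSpace β] {f g : β → ℂ} (v : ℝ)
    (hf : Measurable f) (hg : Measurable g) : Measurable (fun b => cgaussPDF (f b) v (g b)) := by
  unfold cgaussPDF; fun_prop

lemma lintegral_cgauss (m : ℂ) (v : ℝ) {F : ℂ → ℝ≥0∞} (hF : Measurable F) :
    ∫⁻ z, F z ∂(cgauss m v) = ∫⁻ z, F (m + z) ∂(cgauss 0 v) := by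
  unfold cgauss
  rw [lintegral_map hF (by fun_prop), lintegral_map (by fun_prop) (by fun_prop)]
  simp

lemma cgauss_eq_map (m : ℂ) (v : ℝ) : cgauss m v = (cgauss 0 v).map (fun z => m + z) := by
  refine Measure.ext_of_lintegral _ fun F hF => ?_
  rw [lintegral_cgauss m v hF, lintegral_map hF (by fun_prop)]

lemma cgauss_zero_eq_withDensity {v : ℝ} (hv : 0 < v) :
    cgauss 0 v = volume.withDensity (fun z => ENNReal.ofReal (cgaussPDF 0 v z)) := by
  have hv2 : (v / 2).toNNReal ≠ 0 := by simpa using hv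
  refine Measure.ext_of_lintegral _ fun F hF => ?_
  unfold cgauss
  rw [gaussianReal_of_var_ne_zero _ hv2, prod_withDensity (by fun_prop) (by fun_prop),
    lintegral_map hF (by fun_prop), lintegral_withDensity_eq_lintegral_mul _ (by fun_prop)
      (by fun_prop), lintegral_withDensity_eq_lintegral_mul _ (by fun_prop) hF,
    ← Complex.volume_preserving_equiv_real_prod.symm.lintegral_comp_emb
      Complex.measurableEquivRealProd.symm.measurableEmbedding]
  refine lintegral_congr fun q => ?_
  have h1 : (0 : ℂ) + ((q.1 : ℂ) + (q.2 : ℂ) * Complex.I) = ⟨q.1, q.2⟩ := by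
    apply Complex.ext <;> simp
  simp only [Pi.mul_apply, Complex.measurableEquivRealProd_symm_apply, h1]
  congr 1
  simp only [gaussianPDF, ← ENNReal.ofReal_mul (gaussianPDFReal_nonneg _ _ _)]
  congr 1
  have hn : ‖(⟨q.1, q.2⟩ : ℂ)‖ ^ 2 = q.1 ^ 2 + q.2 ^ 2 := by
    rw [Complex.sq_norm, Complex.normSq_apply]; ring
  simp only [gaussianPDFReal, cgaussPDF, sub_zero, hn, Real.coe_toNNReal _ (by positivity : 0 ≤ v / 2)]
  rw [mul_mul_mul_comm, ← Real.exp_add, ← mul_inv, Real.mul_self_sqrt (by positivity)]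
  congr 2
  · field_simp
  · field_simp; ring

lemma lintegral_cgauss_eq (m : ℂ) {v : ℝ} (hv : 0 < v) {F : ℂ → ℝ≥0∞} (hF : Measurable F) :
    ∫⁻ z, F z ∂(cgauss m v) = ∫⁻ z, ENNReal.ofReal (cgaussPDF m v z) * F z := by
  rw [lintegral_cgauss m v hF, cgauss_zero_eq_withDensity hv,
    lintegral_withDensity_eq_lintegral_mul _ (by fun_prop) (by fun_prop),
    ← lintegral_add_left_eq_self (fun z => ENNReal.ofReal (cgaussPDF m v z) * F z) m]
  simp [cgaussPDF]

lemma lintegral_cgaussPDF (m : ℂ) {v : ℝ} (hv : 0 < v) :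
    ∫⁻ z, ENNReal.ofReal (cgaussPDF m v z) = 1 := by
  have := lintegral_cgauss_eq m hv (F := fun _ => 1) measurable_const
  simpa using this.symm

/-- Bayes' rule for complex Gaussian densities. -/
lemma cgaussPDF_bayes {a w : ℝ} (ha : 0 < a) (hw : 0 < w) (c u y : ℂ) :
    cgaussPDF 0 a u * cgaussPDF (c * u) w y =
      cgaussPDF 0 (‖c‖ ^ 2 * a + w) y *
        cgaussPDF (starRingEnd ℂ c * (a / (‖c‖ ^ 2 * a + w) : ℝ) * y) (a * w / (‖c‖ ^ 2 * a + w)) u := by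
  set b := ‖c‖ ^ 2 * a + w with hb
  have hb0 : 0 < b := by positivity
  unfold cgaussPDF
  rw [mul_mul_mul_comm, ← Real.exp_add, mul_mul_mul_comm (Real.pi * b)⁻¹, ← Real.exp_add]
  congr 1
  · field_simp
  · congr 1
    simp only [Complex.sq_norm, Complex.normSq_apply, Complex.sub_re, Complex.sub_im,
      Complex.mul_re, Complex.mul_im, Complex.conj_re, Complex.conj_im, Complex.ofReal_re,
      Complex.ofReal_im, Complex.zero_re, Complex.zero_im] at hb ⊢
    -- Eliminating `w` in favour of `b` turns the equality of the exponents, a completed square,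
    -- into a polynomial identity.
    have hw' : w = b - (c.re * c.re + c.im * c.im) * a := by rw [hb]; ring
    field_simp
    rw [hw']
    ring

/-- The density identity `cgaussPDF_bayes` combined with Tonelli: a Gaussian pair is disintegrated
along its second coordinate instead of its first. This serves for the posterior of the fading and
for exchanging the roles of `S` and `U`. -/
lemma cgauss_bayes {a w : ℝ} (ha : 0 < a) (hw : 0 < w) (c : ℂ) {F : ℂ × ℂ → ℝ≥0∞}
    (hF : Measurable F) :
    ∫⁻ u, ∫⁻ z, F (u, c * u + z) ∂(cgauss 0 w) ∂(cgauss 0 a) =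
      ∫⁻ y, ∫⁻ z, F (starRingEnd ℂ c * (a / (‖c‖ ^ 2 * a + w) : ℝ) * y + z, y)
        ∂(cgauss 0 (a * w / (‖c‖ ^ 2 * a + w))) ∂(cgauss 0 (‖c‖ ^ 2 * a + w)) := by
  have hb0 : 0 < ‖c‖ ^ 2 * a + w := by positivity
  have hv0 : 0 < a * w / (‖c‖ ^ 2 * a + w) := by positivity
  have h1 : ∀ u, ∫⁻ z, F (u, c * u + z) ∂(cgauss 0 w)
      = ∫⁻ y, ENNReal.ofReal (cgaussPDF (c * u) w y) * F (u, y) := fun u => by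
    rw [← lintegral_cgauss_eq _ hw (F := fun y => F (u, y)) (by fun_prop),
      lintegral_cgauss _ _ (F := fun y => F (u, y)) (by fun_prop)]
  have h2 : ∀ y, ∫⁻ z, F (starRingEnd ℂ c * (a / (‖c‖ ^ 2 * a + w) : ℝ) * y + z, y)
        ∂(cgauss 0 (a * w / (‖c‖ ^ 2 * a + w)))
      = ∫⁻ u, ENNReal.ofReal (cgaussPDF (starRingEnd ℂ c * (a / (‖c‖ ^ 2 * a + w) : ℝ) * y)
          (a * w / (‖c‖ ^ 2 * a + w)) u) * F (u, y) := fun y => by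
    rw [← lintegral_cgauss_eq _ hv0 (F := fun u => F (u, y)) (by fun_prop),
      lintegral_cgauss _ _ (F := fun u => F (u, y)) (by fun_prop)]
  simp only [h1, h2]
  rw [lintegral_cgauss_eq _ ha (Measurable.lintegral_prod_right' (f := fun q : ℂ × ℂ =>
      ENNReal.ofReal (cgaussPDF (c * q.1) w q.2) * F (q.1, q.2)) (by fun_prop)),
    lintegral_cgauss_eq _ hb0 (Measurable.lintegral_prod_right' (f := fun q : ℂ × ℂ =>
      ENNReal.ofReal (cgaussPDF (starRingEnd ℂ c * (a / (‖c‖ ^ 2 * a + w) : ℝ) * q.1)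
          (a * w / (‖c‖ ^ 2 * a + w)) q.2) * F (q.2, q.1)) (by fun_prop))]
  simp_rw [← lintegral_const_mul' _ _ ENNReal.ofReal_ne_top, ← mul_assoc,
    ← ENNReal.ofReal_mul (cgaussPDF_pos _ ha _).le, ← ENNReal.ofReal_mul (cgaussPDF_pos _ hb0 _).le,
    cgaussPDF_bayes ha hw]
  rw [lintegral_lintegral_swap]
  exact Measurable.aemeasurable (by fun_prop)

/-- A sum of independent complex Gaussian variables is Gaussian. -/
lemma lintegral_cgauss_add {a w : ℝ} (ha : 0 < a) (hw : 0 < w) (c : ℂ) {F : ℂ → ℝ≥0∞}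
    (hF : Measurable F) :
    ∫⁻ u, ∫⁻ z, F (c * u + z) ∂(cgauss 0 w) ∂(cgauss 0 a) =
      ∫⁻ y, F y ∂(cgauss 0 (‖c‖ ^ 2 * a + w)) := by
  have := cgauss_bayes ha hw c (F := fun q => F q.2) (by fun_prop)
  simpa using this

/-- After Bayes' rule the conditional density integrates to one. This normalises the likelihood
ratio and also evaluates the Chernoff bound in the packing estimate. -/
lemma lintegral_cgaussPDF_mul {a w : ℝ} (ha : 0 < a) (hw : 0 < w) (c y : ℂ) :
    ∫⁻ u, ENNReal.ofReal (cgaussPDF (c * u) w y) ∂(cgauss 0 a) =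
      ENNReal.ofReal (cgaussPDF 0 (‖c‖ ^ 2 * a + w) y) := by
  have hb0 : 0 < ‖c‖ ^ 2 * a + w := by positivity
  have hv0 : 0 < a * w / (‖c‖ ^ 2 * a + w) := by positivity
  rw [lintegral_cgauss_eq _ ha (by fun_prop)]
  simp_rw [← ENNReal.ofReal_mul (cgaussPDF_pos _ ha _).le, cgaussPDF_bayes ha hw,
    ENNReal.ofReal_mul (cgaussPDF_pos _ hb0 _).le]
  rw [lintegral_const_mul' _ _ ENNReal.ofReal_ne_top, lintegral_cgaussPDF _ hv0, mul_one]

lemma lintegral_enorm_sq_cgauss (m : ℂ) {v : ℝ} (hv : 0 ≤ v) :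
    ∫⁻ z, ‖m + z‖ₑ ^ 2 ∂(cgauss 0 v) = ‖m‖ₑ ^ 2 + ENNReal.ofReal v := by
  -- The claim splits into real and imaginary parts, each a shifted real Gaussian of variance `v /
  -- 2`.
  have key : ∀ t : ℝ, ∫⁻ x, ENNReal.ofReal ((t + x) ^ 2) ∂(gaussianReal 0 (v / 2).toNNReal) =
      ENNReal.ofReal (t ^ 2 + v / 2) := by
    intro t
    have hm : MemLp (fun x : ℝ => x) 2 (gaussianReal 0 (v / 2).toNNReal) := by
      simpa [Function.id_def] using memLp_id_gaussianReal (μ := 0) (v := (v / 2).toNNReal) 2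
    have hi1 : Integrable (fun x : ℝ => x) (gaussianReal 0 (v / 2).toNNReal) :=
      hm.integrable (by norm_num)
    have hi2 := hm.integrable_sq
    have e : ∀ x : ℝ, (t + x) ^ 2 = t ^ 2 + 2 * t * x + x ^ 2 := fun x => by ring
    have h2 : ∫ x, x ^ 2 ∂(gaussianReal 0 (v / 2).toNNReal) = v / 2 := by
      have h := variance_id_gaussianReal (μ := 0) (v := (v / 2).toNNReal)
      rw [variance_eq_sub (by simpa [Function.id_def] using hm)] at h
      simp only [Pi.pow_apply, id, integral_id_gaussianReal,
        Real.coe_toNNReal _ (by positivity : 0 ≤ v / 2)] at h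
      linarith
    have hi3 : Integrable (fun x : ℝ => 2 * t * x) (gaussianReal 0 (v / 2).toNNReal) :=
      hi1.const_mul _
    have hi4 : Integrable (fun x : ℝ => t ^ 2 + 2 * t * x) (gaussianReal 0 (v / 2).toNNReal) :=
      (integrable_const _).add hi3
    rw [← ofReal_integral_eq_lintegral_ofReal]
    · simp_rw [e]
      rw [integral_add hi4 hi2, integral_add (integrable_const _) hi3,
        integral_const_mul, h2, integral_id_gaussianReal]
      simp
    · simp_rw [e]; exact hi4.add hi2
    · exact Filter.Eventually.of_forall fun x => sq_nonneg _
  unfold cgauss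
  rw [lintegral_map (by fun_prop) (by fun_prop), lintegral_prod _ (by fun_prop)]
  have hn : ∀ z : ℂ, ‖z‖ₑ ^ 2 = ENNReal.ofReal (z.re ^ 2) + ENNReal.ofReal (z.im ^ 2) := by
    intro z
    rw [← ofReal_norm, ← ENNReal.ofReal_pow (norm_nonneg _),
      ← ENNReal.ofReal_add (sq_nonneg _) (sq_nonneg _), Complex.sq_norm, Complex.normSq_apply]
    ring_nf
  have hre : ∀ x y : ℝ, (m + (0 + ((x : ℂ) + (y : ℂ) * Complex.I))).re = m.re + x := by simp
  have him : ∀ x y : ℝ, (m + (0 + ((x : ℂ) + (y : ℂ) * Complex.I))).im = m.im + y := by simp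
  simp only [hn, hre, him]
  simp_rw [lintegral_add_left measurable_const, key]
  simp only [lintegral_const, measure_univ, mul_one]
  rw [lintegral_add_right _ measurable_const, key]
  simp only [lintegral_const, measure_univ, mul_one]
  rw [← ENNReal.ofReal_add (by positivity) (by positivity),
    ← ENNReal.ofReal_add (by positivity) (by positivity), ← ENNReal.ofReal_add (by positivity) hv]
  congr 1; ring

/-! ### Mutual information of Gaussian pairs -/

/-- The logarithm of the ratio of the densities of `CN(c u, w)` and `CN(0, |c|² a + w)`. -/
def gaussLLR (a w : ℝ) (c : ℂ) (q : ℂ × ℂ) : ℝ :=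
  Real.log ((‖c‖ ^ 2 * a + w) / w) + ‖q.2‖ ^ 2 / (‖c‖ ^ 2 * a + w) - ‖q.2 - c * q.1‖ ^ 2 / w

@[fun_prop]
lemma measurable_gaussLLR (a w : ℝ) (c : ℂ) : Measurable (gaussLLR a w c) := by
  unfold gaussLLR; fun_prop

lemma cgaussPDF_mul_exp_gaussLLR {a w : ℝ} (ha : 0 < a) (hw : 0 < w) (c : ℂ) (q : ℂ × ℂ) :
    cgaussPDF 0 (‖c‖ ^ 2 * a + w) q.2 * Real.exp (gaussLLR a w c q) =
      cgaussPDF (c * q.1) w q.2 := by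
  have hb0 : 0 < ‖c‖ ^ 2 * a + w := by positivity
  unfold cgaussPDF gaussLLR
  rw [Real.exp_sub, Real.exp_add, Real.exp_log (by positivity), neg_div, neg_div, Real.exp_neg,
    Real.exp_neg, sub_zero]
  field_simp

/-- The statement is pointwise in `y`, so only the law of the first coordinate has to be Gaussian;
the second marginal may be arbitrary in `le_mutualInfo`. -/
lemma lintegral_exp_gaussLLR {a w : ℝ} (ha : 0 < a) (hw : 0 < w) (c y : ℂ) :
    ∫⁻ u, ENNReal.ofReal (Real.exp (gaussLLR a w c (u, y))) ∂(cgauss 0 a) = 1 := by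
  have hb0 : 0 < ‖c‖ ^ 2 * a + w := by positivity
  have hp := cgaussPDF_pos 0 hb0 y
  have h := lintegral_cgaussPDF_mul ha hw c y
  simp_rw [fun u => (cgaussPDF_mul_exp_gaussLLR ha hw c (u, y)).symm, ENNReal.ofReal_mul hp.le] at h
  rw [lintegral_const_mul' _ _ ENNReal.ofReal_ne_top] at h
  have h0 : ENNReal.ofReal (cgaussPDF 0 (‖c‖ ^ 2 * a + w) y) ≠ 0 := by simpa using hp
  exact (ENNReal.mul_right_inj h0 ENNReal.ofReal_ne_top).1 (h.trans (mul_one _).symm)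

lemma integrable_sq_norm_of_lintegral {E : Type*} [MeasurableSpace E] {J : Measure E}
    {g : E → ℂ} (hg : Measurable g) {t : ℝ}
    (h : ∫⁻ q, ‖g q‖ₑ ^ 2 ∂J = ENNReal.ofReal t) : Integrable (fun q => ‖g q‖ ^ 2) J := by
  refine ⟨Measurable.aestronglyMeasurable (by fun_prop), ?_⟩
  rw [hasFiniteIntegral_iff_ofReal (Filter.Eventually.of_forall fun q => by positivity)]
  simp_rw [ENNReal.ofReal_pow (norm_nonneg _), ofReal_norm, h]
  exact ENNReal.ofReal_lt_top

lemma integral_sq_norm_of_lintegral {E : Type*} [MeasurableSpace E] {J : Measure E}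
    {g : E → ℂ} (hg : Measurable g) {t : ℝ} (ht : 0 ≤ t)
    (h : ∫⁻ q, ‖g q‖ₑ ^ 2 ∂J = ENNReal.ofReal t) : ∫ q, ‖g q‖ ^ 2 ∂J = t := by
  rw [integral_eq_lintegral_of_nonneg_ae
    (Filter.Eventually.of_forall fun q => by positivity)
    (Measurable.aestronglyMeasurable (by fun_prop))]
  simp_rw [ENNReal.ofReal_pow (norm_nonneg _), ofReal_norm, h]
  exact ENNReal.toReal_ofReal ht

section Bounds

variable {a w : ℝ} {c : ℂ} {J : Measure (ℂ × ℂ)} [IsProbabilityMeasure J]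

lemma lintegral_exp_gaussLLR_prod (ha : 0 < a) (hw : 0 < w) (hfst : J.fst = cgauss 0 a) :
    ∫⁻ q, ENNReal.ofReal (Real.exp (gaussLLR a w c q)) ∂(J.fst.prod J.snd) = 1 := by
  rw [lintegral_prod_symm _ (Measurable.aemeasurable (by fun_prop)), hfst]
  simp [lintegral_exp_gaussLLR ha hw]

lemma integrable_exp_gaussLLR_prod (ha : 0 < a) (hw : 0 < w) (hfst : J.fst = cgauss 0 a) :
    Integrable (fun q => Real.exp (gaussLLR a w c q)) (J.fst.prod J.snd) := by
  refine ⟨Measurable.aestronglyMeasurable (by fun_prop), ?_⟩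
  rw [hasFiniteIntegral_iff_ofReal (Filter.Eventually.of_forall fun q => (Real.exp_pos _).le),
    lintegral_exp_gaussLLR_prod ha hw hfst]
  exact ENNReal.one_lt_top

lemma integral_exp_gaussLLR_prod (ha : 0 < a) (hw : 0 < w) (hfst : J.fst = cgauss 0 a) :
    ∫ q, Real.exp (gaussLLR a w c q) ∂(J.fst.prod J.snd) = 1 := by
  rw [integral_eq_lintegral_of_nonneg_ae
    (Filter.Eventually.of_forall fun q => (Real.exp_pos _).le)
    (Measurable.aestronglyMeasurable (by fun_prop)), lintegral_exp_gaussLLR_prod ha hw hfst]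
  simp

variable (hw : 0 < w)
    (h1 : ∫⁻ q, ‖q.2 - c * q.1‖ₑ ^ 2 ∂J = ENNReal.ofReal w)
    (h2 : ∫⁻ q, ‖q.2‖ₑ ^ 2 ∂J = ENNReal.ofReal (‖c‖ ^ 2 * a + w))
include h1 h2

lemma integrable_gaussLLR : Integrable (gaussLLR a w c) J :=
  ((integrable_const _).add
    ((integrable_sq_norm_of_lintegral (g := fun q : ℂ × ℂ => q.2) (by fun_prop) h2).div_const _)).sub
    ((integrable_sq_norm_of_lintegral (g := fun q : ℂ × ℂ => q.2 - c * q.1) (by fun_prop) h1).div_const _)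

-- The two quadratic terms both have mean one and cancel, which leaves the constant. Nothing about
-- the joint law beyond its second moments is needed.
include hw in
lemma integral_gaussLLR (ha : 0 < a) :
    ∫ q, gaussLLR a w c q ∂J = Real.log ((‖c‖ ^ 2 * a + w) / w) := by
  have hb0 : 0 < ‖c‖ ^ 2 * a + w := by positivity
  have i1 := (integrable_sq_norm_of_lintegral (g := fun q : ℂ × ℂ => q.2 - c * q.1) (by fun_prop)
    h1).div_const w
  have i2 := (integrable_sq_norm_of_lintegral (g := fun q : ℂ × ℂ => q.2) (by fun_prop) h2).div_const
    (‖c‖ ^ 2 * a + w)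
  have i3 : Integrable (fun q : ℂ × ℂ => Real.log ((‖c‖ ^ 2 * a + w) / w) +
      ‖q.2‖ ^ 2 / (‖c‖ ^ 2 * a + w)) J := (integrable_const _).add i2
  unfold gaussLLR
  rw [integral_sub i3 i1, integral_add (integrable_const _) i2,
    integral_div, integral_div, integral_sq_norm_of_lintegral (g := fun q : ℂ × ℂ => q.2 - c * q.1) (by fun_prop) hw.le h1,
    integral_sq_norm_of_lintegral (g := fun q : ℂ × ℂ => q.2) (by fun_prop) hb0.le h2]
  simp [hw.ne', hb0.ne']

omit [IsProbabilityMeasure J] h1 h2 in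
lemma ofReal_logb_two (x : ℝ) :
    ENNReal.ofReal (Real.logb 2 x) = ENNReal.ofReal (Real.log x) / ENNReal.ofReal (Real.log 2) := by
  rw [Real.logb, ENNReal.ofReal_div_of_pos (Real.log_pos one_lt_two)]

include hw in
/-- Among the pairs with a Gaussian first marginal and given second moments, the Gaussian pair has
the least mutual information. -/
lemma le_mutualInfo (ha : 0 < a) (hfst : J.fst = cgauss 0 a) :
    ENNReal.ofReal (Real.logb 2 ((‖c‖ ^ 2 * a + w) / w)) ≤ mutualInfo J := by
  rw [ofReal_logb_two, mutualInfo]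
  refine ENNReal.div_le_div_right ?_ _
  by_cases htop : InformationTheory.klDiv J (J.fst.prod J.snd) = ∞
  · simp [htop]
  obtain ⟨hac, hint⟩ := InformationTheory.klDiv_ne_top_iff.1 htop
  have hf := integrable_gaussLLR h1 h2
  have he := integrable_exp_gaussLLR_prod (c := c) (J := J) ha hw hfst
  -- The divergence of `J` from the tilted product is nonnegative. Expanding its log-likelihood
  -- ratio yields the variational lower bound on the divergence from the product itself.
  have hac' : J ≪ (J.fst.prod J.snd).tilted (gaussLLR a w c) :=
    hac.trans (absolutelyContinuous_tilted he)
  have : IsProbabilityMeasure ((J.fst.prod J.snd).tilted (gaussLLR a w c)) :=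
    isProbabilityMeasure_tilted he
  have h3 := InformationTheory.integral_llr_add_sub_measure_univ_nonneg hac'
    (integrable_llr_tilted_right hac hf hint he)
  rw [integral_llr_tilted_right hac hf he hint, integral_exp_gaussLLR_prod ha hw hfst,
    integral_gaussLLR hw h1 h2 ha] at h3
  simp only [Real.log_one, probReal_univ] at h3
  refine ENNReal.ofReal_le_of_le_toReal ?_
  rw [InformationTheory.toReal_klDiv_of_measure_eq hac (by simp)]
  linarith

end Bounds

/-- The joint law is exactly the product of its marginals tilted by `gaussLLR`, so that function is
the log-likelihood ratio and the variational bound is attained. -/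
lemma mutualInfo_gaussian {a w : ℝ} (ha : 0 < a) (hw : 0 < w) (c : ℂ) {J : Measure (ℂ × ℂ)}
    (hJ : ∀ F : ℂ × ℂ → ℝ≥0∞, Measurable F →
      ∫⁻ q, F q ∂J = ∫⁻ u, ∫⁻ z, F (u, c * u + z) ∂(cgauss 0 w) ∂(cgauss 0 a)) :
    mutualInfo J = ENNReal.ofReal (Real.logb 2 ((‖c‖ ^ 2 * a + w) / w)) := by
  have hb0 : 0 < ‖c‖ ^ 2 * a + w := by positivity
  have hprob : IsProbabilityMeasure J := ⟨by simpa using hJ (fun _ => 1) measurable_const⟩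
  have hfst : J.fst = cgauss 0 a := Measure.ext_of_lintegral _ fun F hF => by
    rw [Measure.fst, lintegral_map hF measurable_fst, hJ _ (by fun_prop)]
    simp
  have hsnd : J.snd = cgauss 0 (‖c‖ ^ 2 * a + w) := Measure.ext_of_lintegral _ fun F hF => by
    rw [Measure.snd, lintegral_map hF measurable_snd, hJ _ (by fun_prop),
      lintegral_cgauss_add ha hw c hF]
  have h1 : ∫⁻ q, ‖q.2 - c * q.1‖ₑ ^ 2 ∂J = ENNReal.ofReal w := by
    rw [hJ _ (by fun_prop)]
    have := lintegral_enorm_sq_cgauss 0 hw.le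
    simp only [zero_add] at this
    simp [this]
  have h2 : ∫⁻ q, ‖q.2‖ₑ ^ 2 ∂J = ENNReal.ofReal (‖c‖ ^ 2 * a + w) := by
    rw [hJ _ (by fun_prop), lintegral_cgauss_add ha hw c (F := fun y => ‖y‖ₑ ^ 2) (by fun_prop)]
    have := lintegral_enorm_sq_cgauss 0 hb0.le
    simpa using this
  have he := integrable_exp_gaussLLR_prod (c := c) (J := J) ha hw hfst
  have hJt : J = (J.fst.prod J.snd).tilted (gaussLLR a w c) := by
    refine Measure.ext_of_lintegral _ fun F hF => ?_
    rw [Measure.tilted, integral_exp_gaussLLR_prod ha hw hfst, hJ F hF,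
      lintegral_withDensity_eq_lintegral_mul _ (by fun_prop) hF, hfst, hsnd,
      lintegral_prod _ (Measurable.aemeasurable (by fun_prop))]
    refine lintegral_congr fun u => ?_
    rw [← lintegral_cgauss (c * u) w (F := fun y => F (u, y)) (by fun_prop),
      lintegral_cgauss_eq _ hw (by fun_prop), lintegral_cgauss_eq _ hb0 (by fun_prop)]
    refine lintegral_congr fun y => ?_
    rw [← cgaussPDF_mul_exp_gaussLLR ha hw c (u, y), ENNReal.ofReal_mul (cgaussPDF_pos _ hb0 _).le]
    simp [mul_assoc]
  have hac : J ≪ J.fst.prod J.snd := by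
    conv_lhs => rw [hJt]
    exact tilted_absolutelyContinuous _ _
  have hllr : llr J (J.fst.prod J.snd) =ᵐ[J] gaussLLR a w c := by
    have h3 := llr_tilted_left (μ := J.fst.prod J.snd) (ν := J.fst.prod J.snd)
      (f := gaussLLR a w c) Measure.AbsolutelyContinuous.rfl he (by fun_prop)
    rw [← hJt] at h3
    filter_upwards [hac.ae_le h3, hac.ae_le (llr_self (J.fst.prod J.snd))] with q hq hq'
    rw [hq, hq', integral_exp_gaussLLR_prod ha hw hfst]
    simp
  rw [ofReal_logb_two, mutualInfo, InformationTheory.klDiv_of_ac_of_integrable hac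
    ((integrable_congr hllr).2 (integrable_gaussLLR h1 h2)), integral_congr_ae hllr,
    integral_gaussLLR hw h1 h2 ha]
  simp

/-! ### The laws of the single-letter model -/

lemma lintegral_id_prod_const_map {A B C : Type*} [MeasurableSpace A] [MeasurableSpace B]
    [MeasurableSpace C] (μ : Measure B) [IsProbabilityMeasure μ] {f : A × B → C}
    (hf : Measurable f) {F : C → ℝ≥0∞} (hF : Measurable F) (x : A) :
    ∫⁻ y, F y ∂(((Kernel.id ×ₖ Kernel.const _ μ).map f) x) = ∫⁻ z, F (f (x, z)) ∂μ := by
  rw [Kernel.map_apply _ hf, lintegral_map hF hf, Kernel.prod_apply, Kernel.id_apply,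
    Kernel.const_apply, lintegral_prod (fun q => F (f q)) (hF.comp hf).aemeasurable,
    lintegral_dirac' _ (Measurable.lintegral_prod_right' (f := fun q => F (f q)) (hF.comp hf))]

lemma lintegral_enorm_sq_cgauss_mul (m c : ℂ) {v : ℝ} (hv : 0 ≤ v) :
    ∫⁻ z, ‖m + c * z‖ₑ ^ 2 ∂(cgauss 0 v) = ‖m‖ₑ ^ 2 + ‖c‖ₑ ^ 2 * ENNReal.ofReal v := by
  rcases eq_or_ne c 0 with rfl | hc
  · simp
  have h : ∀ z, ‖m + c * z‖ₑ ^ 2 = ‖c‖ₑ ^ 2 * ‖m / c + z‖ₑ ^ 2 := fun z => by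
    rw [← mul_pow, ← enorm_mul, mul_add, mul_div_cancel₀ _ hc]
  simp_rw [h]
  rw [lintegral_const_mul' _ _ (by simp), lintegral_enorm_sq_cgauss _ hv, mul_add, ← mul_pow,
    ← enorm_mul, mul_div_cancel₀ _ hc]

section Channel

variable (p : Params)

instance (K : Kernel ℂ (ℂ × ℂ)) [IsMarkovKernel K] : IsProbabilityMeasure (inputLaw p K) := by
  unfold inputLaw; infer_instance

lemma lintegral_channel (x s h : ℂ) {F : ℂ → ℝ≥0∞} (hF : Measurable F) :
    ∫⁻ y, F y ∂(channel p ((x, s), h)) = ∫⁻ z, F (h * (x + s) + z) ∂(cgauss 0 p.σZ2) := by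
  rw [channel, lintegral_id_prod_const_map _ (by fun_prop) hF]

lemma channel_eq_map (x s h : ℂ) :
    channel p ((x, s), h) = (cgauss 0 p.σZ2).map (fun z => h * (x + s) + z) := by
  refine Measure.ext_of_lintegral _ fun F hF => ?_
  rw [lintegral_channel p x s h hF, lintegral_map hF (by fun_prop)]

lemma lintegral_composite (hhat x s : ℂ) {F : ℂ → ℝ≥0∞} (hF : Measurable F) :
    ∫⁻ y, F y ∂(composite p hhat (x, s)) =
      ∫⁻ h, ∫⁻ z, F (h * (x + s) + z) ∂(cgauss 0 p.σZ2) ∂(posterior p hhat) := by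
  rw [composite, Kernel.lintegral_comp _ _ _ hF, Kernel.prod_apply, Kernel.id_apply,
    Kernel.const_apply, lintegral_prod _ (Measurable.aemeasurable hF.lintegral_kernel),
    lintegral_dirac' _ (Measurable.lintegral_prod_right' hF.lintegral_kernel)]
  simp_rw [lintegral_channel p x s _ hF]

lemma lintegral_gaussComposite (hhat x s : ℂ) {F : ℂ → ℝ≥0∞} (hF : Measurable F) :
    ∫⁻ y, F y ∂(gaussComposite p hhat (x, s)) =
      ∫⁻ z, F ((dlt p : ℝ) * hhat * (x + s) + z) ∂(cgauss 0 (NN p)) := by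
  rw [gaussComposite, lintegral_id_prod_const_map _ (by fun_prop) hF]

lemma lintegral_inputLaw (α : ℝ) {F : ℂ × (ℂ × ℂ) → ℝ≥0∞} (hF : Measurable F) :
    ∫⁻ q, F q ∂(inputLaw p (dpcInput p α)) =
      ∫⁻ s, ∫⁻ x, F (s, (x + α * s, x)) ∂(cgauss 0 p.Pbar) ∂(cgauss 0 p.Q) := by
  rw [inputLaw, Measure.lintegral_compProd hF, stateLaw]
  refine lintegral_congr fun s => ?_
  rw [dpcInput, lintegral_id_prod_const_map _ (by fun_prop) (F := fun q => F (s, q)) (by fun_prop)]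

/-- The joint law of `(U, Y)` for dirty-paper coding over the channel `V`. -/
def jointUY (α : ℝ) (V : Kernel (ℂ × ℂ) ℂ) : Measure (ℂ × ℂ) :=
  ((inputLaw p (dpcInput p α)) ⊗ₘ (V.comap (fun q : ℂ × (ℂ × ℂ) => (q.2.2, q.1))
    (by fun_prop))).map (fun q => (q.1.2.1, q.2))

instance (α : ℝ) (V : Kernel (ℂ × ℂ) ℂ) [IsMarkovKernel V] :
    IsProbabilityMeasure (jointUY p α V) := by
  unfold jointUY
  exact Measure.isProbabilityMeasure_map (by fun_prop)

lemma lintegral_jointUY (α : ℝ) (V : Kernel (ℂ × ℂ) ℂ) [IsMarkovKernel V] {F : ℂ × ℂ → ℝ≥0∞}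
    (hF : Measurable F) :
    ∫⁻ q, F q ∂(jointUY p α V) =
      ∫⁻ s, ∫⁻ x, ∫⁻ y, F (x + α * s, y) ∂(V (x, s)) ∂(cgauss 0 p.Pbar) ∂(cgauss 0 p.Q) := by
  have hG : Measurable fun q : (ℂ × ℂ × ℂ) × ℂ => F (q.1.2.1, q.2) := by fun_prop
  rw [jointUY, lintegral_map hF (by fun_prop), Measure.lintegral_compProd hG,
    lintegral_inputLaw p α hG.lintegral_kernel_prod_right']
  rfl

/-! ### The posterior law of the fading -/

variable {p}

lemma dlt_pos (hσh : 0 < p.σh2) (hσE : 0 < p.σE2) : 0 < dlt p := by unfold dlt; positivity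

lemma NN_pos (hσh : 0 < p.σh2) (hσE : 0 < p.σE2) (hσZ : 0 < p.σZ2) (hQ : 0 < p.Q)
    (hP : 0 < p.Pbar) : 0 < NN p := by
  have := dlt_pos hσh hσE
  unfold NN; positivity

lemma lintegral_estimateJoint (hσh : 0 < p.σh2) (hσE : 0 < p.σE2) {F : ℂ × ℂ → ℝ≥0∞}
    (hF : Measurable F) :
    ∫⁻ q, F q ∂(estimateJoint p) = ∫⁻ y, ∫⁻ z, F (y, (dlt p : ℝ) * y + z)
      ∂(cgauss 0 (dlt p * p.σE2)) ∂(cgauss 0 (p.σh2 + p.σE2)) := by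
  rw [estimateJoint, lintegral_map hF (by fun_prop),
    lintegral_prod _ (Measurable.aemeasurable (by fun_prop))]
  have := cgauss_bayes hσh hσE 1 (F := fun q => F (q.2, q.1)) (by fun_prop)
  simp only [one_mul, norm_one, one_pow, map_one] at this
  rw [this]
  simp only [dlt, div_mul_eq_mul_div]

lemma estimateLaw_eq (hσh : 0 < p.σh2) (hσE : 0 < p.σE2) :
    estimateLaw p = cgauss 0 (p.σh2 + p.σE2) := by
  refine Measure.ext_of_lintegral _ fun F hF => ?_
  rw [estimateLaw, Measure.fst, lintegral_map hF measurable_fst,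
    lintegral_estimateJoint hσh hσE (by fun_prop)]
  simp

/-- Disintegrations are almost everywhere unique, and Bayes' rule with gain one exhibits a
disintegration by the Gaussian kernel `κ`. -/
lemma posterior_ae_eq (hσh : 0 < p.σh2) (hσE : 0 < p.σE2) :
    ∀ᵐ hhat ∂(estimateLaw p), posterior p hhat = cgauss ((dlt p : ℝ) * hhat) (dlt p * p.σE2) := by
  set κ : Kernel ℂ ℂ := (Kernel.id ×ₖ Kernel.const _ (cgauss 0 (dlt p * p.σE2))).map
    (fun q : ℂ × ℂ => ((dlt p : ℝ) : ℂ) * q.1 + q.2) with hκ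
  have : IsMarkovKernel κ := Kernel.IsMarkovKernel.map _ (by fun_prop)
  have hκa : ∀ y, κ y = cgauss ((dlt p : ℝ) * y) (dlt p * p.σE2) := fun y => by
    refine Measure.ext_of_lintegral _ fun F hF => ?_
    rw [hκ, lintegral_id_prod_const_map _ (by fun_prop) hF, lintegral_cgauss _ _ hF]
  have h := eq_condKernel_of_measure_eq_compProd (ρ := estimateJoint p) κ ?_
  · filter_upwards [h] with y hy
    rw [posterior, ← hy, hκa]
  · refine Measure.ext_of_lintegral _ fun F hF => ?_
    rw [Measure.lintegral_compProd hF, lintegral_estimateJoint hσh hσE hF]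
    change _ = ∫⁻ y, _ ∂(estimateLaw p)
    rw [estimateLaw_eq hσh hσE]
    refine lintegral_congr fun y => ?_
    rw [hκ, lintegral_id_prod_const_map _ (by fun_prop) (F := fun z => F (y, z)) (by fun_prop)]

lemma ae_ne_zero_estimateLaw (hσh : 0 < p.σh2) (hσE : 0 < p.σE2) :
    ∀ᵐ hhat ∂(estimateLaw p), hhat ≠ 0 := by
  rw [estimateLaw_eq hσh hσE, cgauss_zero_eq_withDensity (by positivity)]
  exact (withDensity_absolutelyContinuous _ _).ae_le (Measure.ae_ne volume 0)

/-! ### Mutual informations of dirty-paper coding -/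

variable (p) in
/-- The variance of `U = X + α S`. -/
def varU (α : ℝ) : ℝ := p.Pbar + α ^ 2 * p.Q

variable (p) in
/-- The coefficient of the linear regression of `Y` on `U` when the channel gain is `h`. -/
def regCoeff (α : ℝ) (h : ℂ) : ℂ := h * ((p.Pbar + α * p.Q) / varU p α : ℝ)

variable (p) in
/-- The residual variance of the linear regression of `Y` on `U`. -/
def resVar (α : ℝ) (h : ℂ) : ℝ :=
  ‖h‖ ^ 2 * (1 - α) ^ 2 * (p.Pbar * p.Q / varU p α) + NN p

variable (p) in
/-- The variance of `Y`. -/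
def varY (h : ℂ) : ℝ := ‖h‖ ^ 2 * (p.Pbar + p.Q) + NN p

section Rates

variable (hσh : 0 < p.σh2) (hσE : 0 < p.σE2) (hσZ : 0 < p.σZ2) (hQ : 0 < p.Q) (hP : 0 < p.Pbar)
include hP hQ

lemma varU_pos (α : ℝ) : 0 < varU p α := by unfold varU; positivity

/-- The variance of `Y` splits orthogonally into the part explained by `U` and the residual. -/
lemma sq_norm_regCoeff_mul_add (α : ℝ) (h : ℂ) :
    ‖regCoeff p α h‖ ^ 2 * varU p α + resVar p α h = varY p h := by
  have := varU_pos hQ hP α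
  unfold regCoeff resVar varY
  rw [norm_mul, mul_pow, Complex.norm_real, Real.norm_eq_abs, sq_abs]
  field_simp
  unfold varU
  ring

/-- By Bayes' rule `S` equals `(α Q / varU) U` plus independent noise of variance `Q Pbar / varU`,
so the pair `(U, S)` has the form required by `mutualInfo_gaussian`. -/
lemma infoUS_dpcInput (α : ℝ) :
    infoUS p (dpcInput p α) = ENNReal.ofReal (Real.logb 2 (varU p α / p.Pbar)) := by
  have hU := varU_pos hQ hP α
  have hv : 0 < p.Q * p.Pbar / varU p α := by positivity
  have hUe : ‖(α : ℂ)‖ ^ 2 * p.Q + p.Pbar = varU p α := by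
    rw [Complex.norm_real, Real.norm_eq_abs, sq_abs, varU]; ring
  rw [infoUS, mutualInfo_gaussian (a := varU p α) (w := p.Q * p.Pbar / varU p α) hU hv
    ((α : ℂ) * (p.Q / varU p α : ℝ))]
  · congr 2
    rw [norm_mul, mul_pow, Complex.norm_real, Complex.norm_real, Real.norm_eq_abs,
      Real.norm_eq_abs, sq_abs, sq_abs]
    field_simp
    unfold varU
    ring
  · intro F hF
    rw [lintegral_map hF (by fun_prop), lintegral_inputLaw p α (by fun_prop)]
    have := cgauss_bayes hQ hP α (F := fun q => F (q.2, q.1)) (by fun_prop)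
    rw [hUe] at this
    simp only [Complex.conj_ofReal] at this
    rw [← this]
    simp only [add_comm]

include hσh hσE hσZ in
lemma resVar_pos (α : ℝ) (h : ℂ) : 0 < resVar p α h := by
  have := varU_pos hQ hP α
  have := NN_pos hσh hσE hσZ hQ hP
  unfold resVar; positivity

-- With `X = U - α S`, the output is `h (U + (1 - α) S) + Z`. Replacing `S` by its regression on `U`
-- plus an independent error gives `regCoeff * U` plus Gaussian noise of variance `resVar`.
include hσh hσE hσZ in
lemma infoUY_gaussComposite (α : ℝ) (hhat : ℂ) :
    infoUY p (dpcInput p α) (gaussComposite p hhat) = ENNReal.ofReal (Real.logb 2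
      (varY p ((dlt p : ℝ) * hhat) / resVar p α ((dlt p : ℝ) * hhat))) := by
  set h : ℂ := (dlt p : ℝ) * hhat with hh
  have hU := varU_pos hQ hP α
  have hN := NN_pos hσh hσE hσZ hQ hP
  have hUe : ‖(α : ℂ)‖ ^ 2 * p.Q + p.Pbar = varU p α := by
    rw [Complex.norm_real, Real.norm_eq_abs, sq_abs, varU]; ring
  have hv : 0 < p.Q * p.Pbar / varU p α := by positivity
  rw [← sq_norm_regCoeff_mul_add hQ hP α h]
  refine mutualInfo_gaussian hU (resVar_pos hσh hσE hσZ hQ hP α h) _ fun F hF => ?_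
  change ∫⁻ q, F q ∂(jointUY p α (gaussComposite p hhat)) = _
  rw [lintegral_jointUY p α _ hF]
  simp_rw [fun x s => lintegral_gaussComposite p hhat x s (F := fun y => F (x + α * s, y))
    (by fun_prop)]
  -- The pair `(S, U)` is drawn in the opposite order: first `U`, then `S` given `U`.
  have hb := cgauss_bayes hQ hP α (F := fun q : ℂ × ℂ => ∫⁻ z, F (q.2, h * (q.2 - α * q.1 + q.1) + z)
    ∂(cgauss 0 (NN p))) (Measurable.lintegral_prod_right' (f := fun r : (ℂ × ℂ) × ℂ =>
      F (r.1.2, h * (r.1.2 - α * r.1.1 + r.1.1) + r.2)) (by fun_prop))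
  rw [hUe] at hb
  simp only [Complex.conj_ofReal] at hb
  have hl : ∀ s x : ℂ, ∫⁻ z, F (x + α * s, h * (x + s) + z) ∂(cgauss 0 (NN p)) =
      ∫⁻ z, F (α * s + x, h * (α * s + x - α * s + s) + z) ∂(cgauss 0 (NN p)) := by
    intro s x
    rw [add_comm x (α * s), add_sub_cancel_left]
  rw [← hh]
  simp_rw [hl]
  rw [hb]
  refine lintegral_congr fun u => ?_
  have hs := lintegral_cgauss_add hv hN (h * (1 - α)) (F := fun y => F (u, regCoeff p α h * u + y))
    (by fun_prop)
  have hr : ‖h * (1 - α : ℂ)‖ ^ 2 * (p.Q * p.Pbar / varU p α) + NN p = resVar p α h := by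
    rw [norm_mul, mul_pow, ← Complex.ofReal_one, ← Complex.ofReal_sub, Complex.norm_real,
      Real.norm_eq_abs, sq_abs, resVar, mul_comm p.Q]
  rw [hr] at hs
  rw [← hs]
  have hU' : (varU p α : ℂ) ≠ 0 := by exact_mod_cast hU.ne'
  refine lintegral_congr fun v => lintegral_congr fun z => ?_
  rw [← add_assoc (regCoeff p α h * u)]
  congr 3
  unfold regCoeff
  push_cast
  field_simp
  unfold varU
  push_cast
  ring

lemma jointUY_fst (α : ℝ) (V : Kernel (ℂ × ℂ) ℂ) [IsMarkovKernel V] :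
    (jointUY p α V).fst = cgauss 0 (varU p α) := by
  refine Measure.ext_of_lintegral _ fun F hF => ?_
  have hUe : ‖(α : ℂ)‖ ^ 2 * p.Q + p.Pbar = varU p α := by
    rw [Complex.norm_real, Real.norm_eq_abs, sq_abs, varU]; ring
  rw [Measure.fst, lintegral_map hF measurable_fst, lintegral_jointUY p α V (by fun_prop), ← hUe,
    ← lintegral_cgauss_add hQ hP α hF]
  simp [add_comm]

include hσh hσE hσZ

/-- Second moments over the composite channel of linear combinations of `Y`, `X` and `S`. -/
lemma lintegral_sq_composite (h g k : ℂ) :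
    ∫⁻ s, ∫⁻ x, ∫⁻ θ, ∫⁻ z, ‖θ * (x + s) + z + g * x + k * s‖ₑ ^ 2
      ∂(cgauss 0 p.σZ2) ∂(cgauss h (dlt p * p.σE2)) ∂(cgauss 0 p.Pbar) ∂(cgauss 0 p.Q) =
    ENNReal.ofReal (‖h + g‖ ^ 2 * p.Pbar + ‖h + k‖ ^ 2 * p.Q + NN p) := by
  have hd := dlt_pos hσh hσE
  have hv : 0 < dlt p * p.σE2 := by positivity
  have h1 : ∀ s x θ : ℂ, ∫⁻ z, ‖θ * (x + s) + z + g * x + k * s‖ₑ ^ 2 ∂(cgauss 0 p.σZ2) =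
      ‖θ * (x + s) + g * x + k * s‖ₑ ^ 2 + ENNReal.ofReal p.σZ2 := fun s x θ => by
    rw [← lintegral_enorm_sq_cgauss _ hσZ.le]
    refine lintegral_congr fun z => ?_
    rw [show θ * (x + s) + z + g * x + k * s = θ * (x + s) + g * x + k * s + z by ring]
  -- Given `x` and `s`, the spread of `θ` around its mean contributes `|x + s|²` times `δ σE2`; this
  -- is the source of the term `δ σE2 (Pbar + Q)` in `NN`.
  have h2 : ∀ s x : ℂ, ∫⁻ θ, ‖θ * (x + s) + g * x + k * s‖ₑ ^ 2 ∂(cgauss h (dlt p * p.σE2)) =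
      ‖(h + k) * s + (h + g) * x‖ₑ ^ 2 + ‖s + 1 * x‖ₑ ^ 2 * ENNReal.ofReal (dlt p * p.σE2) :=
      fun s x => by
    rw [lintegral_cgauss _ _ (by fun_prop), show s + 1 * x = x + s by ring,
      ← lintegral_enorm_sq_cgauss_mul _ _ hv.le]
    refine lintegral_congr fun θ => ?_
    rw [show (h + θ) * (x + s) + g * x + k * s = (h + k) * s + (h + g) * x + (x + s) * θ by ring]
  have h3 : ∀ s : ℂ, ∫⁻ x, (‖(h + k) * s + (h + g) * x‖ₑ ^ 2 +
      ‖s + 1 * x‖ₑ ^ 2 * ENNReal.ofReal (dlt p * p.σE2) + ENNReal.ofReal p.σZ2)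
        ∂(cgauss 0 p.Pbar) = ‖0 + (h + k) * s‖ₑ ^ 2 + ‖h + g‖ₑ ^ 2 * ENNReal.ofReal p.Pbar +
      (‖0 + 1 * s‖ₑ ^ 2 + ENNReal.ofReal p.Pbar) * ENNReal.ofReal (dlt p * p.σE2) +
      ENNReal.ofReal p.σZ2 := fun s => by
    rw [lintegral_add_right _ (by fun_prop), lintegral_add_right _ (by fun_prop),
      lintegral_mul_const _ (by fun_prop), lintegral_enorm_sq_cgauss_mul _ _ hP.le,
      lintegral_enorm_sq_cgauss_mul _ _ hP.le]
    simp
  have h4 : ∀ s x : ℂ, ∫⁻ θ, ∫⁻ z, ‖θ * (x + s) + z + g * x + k * s‖ₑ ^ 2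
      ∂(cgauss 0 p.σZ2) ∂(cgauss h (dlt p * p.σE2)) = ‖(h + k) * s + (h + g) * x‖ₑ ^ 2 +
      ‖s + 1 * x‖ₑ ^ 2 * ENNReal.ofReal (dlt p * p.σE2) + ENNReal.ofReal p.σZ2 := fun s x => by
    rw [lintegral_congr (h1 s x), lintegral_add_right _ measurable_const, h2]
    simp
  rw [lintegral_congr fun s => (lintegral_congr (h4 s)).trans (h3 s)]
  rw [lintegral_add_right _ (by fun_prop), lintegral_add_right _ (by fun_prop),
    lintegral_add_right _ (by fun_prop), lintegral_mul_const (ENNReal.ofReal (dlt p * p.σE2))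
      (f := fun s : ℂ => ‖0 + 1 * s‖ₑ ^ 2 + ENNReal.ofReal p.Pbar) (by fun_prop),
    lintegral_add_right (μ := cgauss 0 p.Q) (fun s : ℂ => ‖0 + 1 * s‖ₑ ^ 2) measurable_const,
    lintegral_enorm_sq_cgauss_mul _ _ hQ.le, lintegral_enorm_sq_cgauss_mul _ _ hQ.le]
  have hsq : ∀ z : ℂ, ‖z‖ₑ ^ 2 = ENNReal.ofReal (‖z‖ ^ 2) := fun z => by
    rw [ENNReal.ofReal_pow (norm_nonneg _), ofReal_norm]
  simp only [lintegral_const, measure_univ, mul_one, hsq, norm_zero, norm_one, one_pow,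
    ENNReal.ofReal_one, one_mul, zero_pow two_ne_zero, ENNReal.ofReal_zero, zero_add]
  rw [← ENNReal.ofReal_mul (by positivity), ← ENNReal.ofReal_mul (by positivity),
    ← ENNReal.ofReal_add hQ.le hP.le, ← ENNReal.ofReal_mul (by positivity),
    ← ENNReal.ofReal_add (by positivity) (by positivity),
    ← ENNReal.ofReal_add (by positivity) (by positivity),
    ← ENNReal.ofReal_add (by positivity) hσZ.le, NN]
  congr 1
  ring

/-- The multiplicative noise is centred given `(X, S)`, so cross terms vanish and the second moments
agree with those of the Gaussian channel. -/
lemma lintegral_sq_jointUY_composite (α : ℝ) (c : ℂ) {hhat : ℂ}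
    (hpost : posterior p hhat = cgauss ((dlt p : ℝ) * hhat) (dlt p * p.σE2)) :
    ∫⁻ q, ‖q.2 - c * q.1‖ₑ ^ 2 ∂(jointUY p α (composite p hhat)) =
      ENNReal.ofReal (‖(dlt p : ℝ) * hhat - c‖ ^ 2 * p.Pbar +
        ‖(dlt p : ℝ) * hhat - c * α‖ ^ 2 * p.Q + NN p) := by
  rw [lintegral_jointUY p α _ (by fun_prop)]
  simp_rw [fun x s => lintegral_composite p hhat x s (F := fun y => ‖y - c * (x + α * s)‖ₑ ^ 2)
    (by fun_prop)]
  rw [hpost, sub_eq_add_neg, sub_eq_add_neg (_ * _) (c * α),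
    ← lintegral_sq_composite hσh hσE hσZ hQ hP]
  refine lintegral_congr fun s => lintegral_congr fun x => lintegral_congr fun θ =>
    lintegral_congr fun z => ?_
  ring_nf

omit hσh hσE hσZ in
lemma residual_sq (α : ℝ) (h : ℂ) :
    ‖h - regCoeff p α h‖ ^ 2 * p.Pbar + ‖h - regCoeff p α h * α‖ ^ 2 * p.Q + NN p =
      resVar p α h := by
  have hU := varU_pos hQ hP α
  have h1 : h - regCoeff p α h = h * (1 - (p.Pbar + α * p.Q) / varU p α : ℝ) := by
    rw [regCoeff]; push_cast; ring
  have h2 : h - regCoeff p α h * α = h * (1 - (p.Pbar + α * p.Q) / varU p α * α : ℝ) := by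
    rw [regCoeff]; push_cast; ring
  rw [h1, h2, norm_mul, norm_mul, mul_pow, mul_pow, Complex.norm_real, Complex.norm_real,
    Real.norm_eq_abs, Real.norm_eq_abs, sq_abs, sq_abs, resVar]
  field_simp
  unfold varU
  ring

/-- The marginal of `U`, the regression residual and the power of `Y` are those of the Gaussian
model, which is all that `le_mutualInfo` uses. -/
lemma infoUY_composite_ge (α : ℝ) {hhat : ℂ}
    (hpost : posterior p hhat = cgauss ((dlt p : ℝ) * hhat) (dlt p * p.σE2)) :
    infoUY p (dpcInput p α) (gaussComposite p hhat) ≤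
      infoUY p (dpcInput p α) (composite p hhat) := by
  rw [infoUY_gaussComposite hσh hσE hσZ hQ hP, ← sq_norm_regCoeff_mul_add hQ hP α]
  refine le_mutualInfo (J := jointUY p α (composite p hhat))
    (resVar_pos hσh hσE hσZ hQ hP α _) ?_ ?_ (varU_pos hQ hP α) (jointUY_fst hQ hP α _)
  · rw [lintegral_sq_jointUY_composite hσh hσE hσZ hQ hP α _ hpost,
      residual_sq hQ hP]
  · have := lintegral_sq_jointUY_composite hσh hσE hσZ hQ hP α 0 hpost
    simp only [zero_mul, sub_zero] at this
    rw [this, sq_norm_regCoeff_mul_add hQ hP α, varY, mul_add]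

end Rates

/-! ### The rate formula -/

/-- The rate of dirty-paper coding at the channel gain `h`, in nats. -/
def natRate (p : Params) (α : ℝ) (h : ℂ) : ℝ :=
  Real.log (varY p h / resVar p α h) - Real.log (varU p α / p.Pbar)

section Formula

variable (hσh : 0 < p.σh2) (hσE : 0 < p.σE2) (hσZ : 0 < p.σZ2) (hQ : 0 < p.Q) (hP : 0 < p.Pbar)
include hσh hσE hσZ hQ hP

omit hσh hσE hσZ in
lemma infoUS_arg_eq (α : ℝ) {hhat : ℂ} (h0 : (dlt p : ℝ) * hhat ≠ 0) :
    (PP p hhat + α ^ 2 * QQ p hhat) / PP p hhat = varU p α / p.Pbar := by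
  have hn : 0 < ‖(dlt p : ℝ) * hhat‖ := norm_pos_iff.2 h0
  rw [norm_mul, Complex.norm_real, Real.norm_eq_abs] at hn
  have hn2 : 0 < dlt p ^ 2 * ‖hhat‖ ^ 2 := by
    rw [← sq_abs (dlt p), ← mul_pow]; positivity
  rw [PP, QQ, varU]
  generalize dlt p ^ 2 * ‖hhat‖ ^ 2 = t at *
  field_simp

lemma infoUY_arg_eq (α : ℝ) {hhat : ℂ} (h0 : (dlt p : ℝ) * hhat ≠ 0) :
    (PP p hhat + QQ p hhat + NN p) * (PP p hhat + α ^ 2 * QQ p hhat) /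
      (PP p hhat * QQ p hhat * (1 - α) ^ 2 + NN p * (PP p hhat + α ^ 2 * QQ p hhat)) =
      varY p ((dlt p : ℝ) * hhat) / resVar p α ((dlt p : ℝ) * hhat) := by
  have hU := varU_pos hQ hP α
  have hN := NN_pos hσh hσE hσZ hQ hP
  have hn : 0 < ‖(dlt p : ℝ) * hhat‖ := norm_pos_iff.2 h0
  have hn2 : ‖(dlt p : ℝ) * hhat‖ ^ 2 = dlt p ^ 2 * ‖hhat‖ ^ 2 := by
    rw [norm_mul, Complex.norm_real, Real.norm_eq_abs, mul_pow, sq_abs]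
  rw [PP, QQ, varY, resVar, hn2]
  have hn3 : 0 < dlt p ^ 2 * ‖hhat‖ ^ 2 := hn2 ▸ by positivity
  generalize dlt p ^ 2 * ‖hhat‖ ^ 2 = t at *
  have e : t * p.Pbar + α ^ 2 * (t * p.Q) = t * varU p α := by unfold varU; ring
  rw [e]
  have hP' := hP
  have hQ' := hQ
  generalize p.Pbar = P at *
  generalize p.Q = Q at *
  generalize varU p α = U at *
  generalize NN p = N at *
  have h5 : 0 < t * (1 - α) ^ 2 * (P * Q / U) + N := by positivity
  have h6 : 0 < t * P * (t * Q) * (1 - α) ^ 2 + N * (t * U) := by positivity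
  rw [div_eq_div_iff h6.ne' h5.ne']
  field_simp

lemma varY_div_resVar_ge_one (α : ℝ) (h : ℂ) : 1 ≤ varY p h / resVar p α h := by
  rw [one_le_div (resVar_pos hσh hσE hσZ hQ hP α h), ← sq_norm_regCoeff_mul_add hQ hP α]
  have := varU_pos hQ hP α
  nlinarith [mul_nonneg (sq_nonneg ‖regCoeff p α h‖) this.le]

omit hσh hσE hσZ in
lemma varU_div_ge_one (α : ℝ) : 1 ≤ varU p α / p.Pbar := by
  rw [one_le_div hP, varU]; nlinarith [mul_nonneg (sq_nonneg α) hQ.le]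

lemma rateIntegrand_eq (α : ℝ) {hhat : ℂ} (h0 : (dlt p : ℝ) * hhat ≠ 0) :
    rateIntegrand p α hhat =
      Real.logb 2 (varY p ((dlt p : ℝ) * hhat) / resVar p α ((dlt p : ℝ) * hhat)) -
        Real.logb 2 (varU p α / p.Pbar) := by
  have h1 := varY_div_resVar_ge_one hσh hσE hσZ hQ hP α ((dlt p : ℝ) * hhat)
  have h2 := varU_div_ge_one hQ hP α
  rw [← Real.logb_div (by positivity) (by positivity), ← infoUY_arg_eq hσh hσE hσZ hQ hP α h0,
    ← infoUS_arg_eq hQ hP α h0, rateIntegrand]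
  have hU := varU_pos hQ hP α
  have hn : 0 < ‖(dlt p : ℝ) * hhat‖ := norm_pos_iff.2 h0
  rw [norm_mul, Complex.norm_real, Real.norm_eq_abs] at hn
  have hn2 : 0 < dlt p ^ 2 * ‖hhat‖ ^ 2 := by
    rw [← sq_abs (dlt p), ← mul_pow]; positivity
  have hPP : 0 < PP p hhat := by unfold PP; positivity
  have hQQ : 0 < QQ p hhat := by unfold QQ; positivity
  have : 0 < PP p hhat + α ^ 2 * QQ p hhat := by positivity
  congr 1
  field_simp

lemma rateIntegrand_eq_natRate (α : ℝ) {hhat : ℂ} (h0 : (dlt p : ℝ) * hhat ≠ 0) :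
    rateIntegrand p α hhat = natRate p α ((dlt p : ℝ) * hhat) / Real.log 2 := by
  rw [rateIntegrand_eq hσh hσE hσZ hQ hP α h0, natRate, Real.logb, Real.logb, sub_div]

end Formula

end Channel

/-! ### Mean rates -/

lemma integrable_sq_norm_cgauss {v : ℝ} (hv : 0 ≤ v) :
    Integrable (fun z : ℂ => ‖z‖ ^ 2) (cgauss 0 v) := by
  refine ⟨Measurable.aestronglyMeasurable (by fun_prop), ?_⟩
  rw [hasFiniteIntegral_iff_ofReal (Filter.Eventually.of_forall fun q => by positivity)]
  simp_rw [ENNReal.ofReal_pow (norm_nonneg _), ofReal_norm]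
  have := lintegral_enorm_sq_cgauss 0 hv
  simp only [zero_add] at this
  simp [this]

section MeanRate

variable {p : Params} (hσh : 0 < p.σh2) (hσE : 0 < p.σE2) (hσZ : 0 < p.σZ2) (hQ : 0 < p.Q)
  (hP : 0 < p.Pbar)
include hσh hσE

/-- The rate formulas reduce to `varY`, `resVar` and `varU` by cancelling the common factor `δ²
|ĥ|²`, which requires a nonzero gain. -/
lemma ae_gain_ne_zero : ∀ᵐ hhat ∂(estimateLaw p), (dlt p : ℝ) * hhat ≠ (0 : ℂ) := by
  filter_upwards [ae_ne_zero_estimateLaw hσh hσE] with hhat h0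
  exact mul_ne_zero (by exact_mod_cast (dlt_pos hσh hσE).ne') h0

include hσZ hQ hP

/-- The argument of the logarithm lies between one and `varY / NN`, which is quadratic in `ĥ`. Since
`log x ≤ x`, the second moment of the estimate is enough. -/
lemma integrable_logb_varY_div (α : ℝ) :
    Integrable (fun hhat => Real.logb 2
      (varY p ((dlt p : ℝ) * hhat) / resVar p α ((dlt p : ℝ) * hhat))) (estimateLaw p) := by
  have hN := NN_pos hσh hσE hσZ hQ hP
  have hU := varU_pos hQ hP α
  have hl := Real.log_pos one_lt_two
  have hi : Integrable (fun hhat : ℂ => varY p ((dlt p : ℝ) * hhat) / NN p / Real.log 2)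
      (estimateLaw p) := by
    rw [estimateLaw_eq hσh hσE]
    have h1 := integrable_sq_norm_cgauss (v := p.σh2 + p.σE2) (by positivity)
    refine ((Integrable.add ?_ (integrable_const _)).div_const _).div_const _
    simp_rw [norm_mul, mul_pow]
    exact (h1.const_mul _).mul_const _
  refine hi.mono' (Measurable.aestronglyMeasurable ?_) (Filter.Eventually.of_forall fun hhat => ?_)
  · unfold varY resVar Real.logb
    fun_prop
  · have h1 := varY_div_resVar_ge_one hσh hσE hσZ hQ hP α ((dlt p : ℝ) * hhat)
    rw [Real.norm_of_nonneg (Real.logb_nonneg one_lt_two h1), Real.logb]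
    refine div_le_div_of_nonneg_right ?_ hl.le
    refine (Real.log_le_self (by positivity)).trans ?_
    have hv : 0 ≤ varY p ((dlt p : ℝ) * hhat) := by unfold varY; positivity
    refine div_le_div_of_nonneg_left hv hN ?_
    unfold resVar
    have : 0 ≤ ‖(dlt p : ℝ) * hhat‖ ^ 2 * (1 - α) ^ 2 * (p.Pbar * p.Q / varU p α) := by positivity
    linarith

lemma rateIntegrand_ae_eq (α : ℝ) : rateIntegrand p α =ᵐ[estimateLaw p] fun hhat =>
      Real.logb 2 (varY p ((dlt p : ℝ) * hhat) / resVar p α ((dlt p : ℝ) * hhat)) -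
        Real.logb 2 (varU p α / p.Pbar) := by
  filter_upwards [ae_gain_ne_zero hσh hσE] with hhat h0
  exact rateIntegrand_eq hσh hσE hσZ hQ hP α h0

lemma integrable_rateIntegrand (α : ℝ) : Integrable (rateIntegrand p α) (estimateLaw p) :=
  (integrable_congr (rateIntegrand_ae_eq hσh hσE hσZ hQ hP α)).2
    ((integrable_logb_varY_div hσh hσE hσZ hQ hP α).sub (integrable_const _))

lemma integral_infoUY_sub_infoUS (α : ℝ) :
    ∫ hhat, ((infoUY p (dpcInput p α) (gaussComposite p hhat)).toReal -
      (infoUS p (dpcInput p α)).toReal) ∂(estimateLaw p) =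
      ∫ hhat, rateIntegrand p α hhat ∂(estimateLaw p) := by
  rw [integral_congr_ae (rateIntegrand_ae_eq hσh hσE hσZ hQ hP α)]
  refine integral_congr_ae (Filter.Eventually.of_forall fun hhat => ?_)
  simp only
  rw [infoUY_gaussComposite hσh hσE hσZ hQ hP, infoUS_dpcInput hQ hP,
    ENNReal.toReal_ofReal (Real.logb_nonneg one_lt_two
      (varY_div_resVar_ge_one hσh hσE hσZ hQ hP α _)),
    ENNReal.toReal_ofReal (Real.logb_nonneg one_lt_two (varU_div_ge_one hQ hP α))]

omit hσh hσE hσZ hQ in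
lemma admissible_dpcInput (α : ℝ) : Admissible p (dpcInput p α) := by
  refine ⟨inferInstance, ?_⟩
  rw [lintegral_inputLaw p α (by fun_prop)]
  have := lintegral_enorm_sq_cgauss 0 hP.le
  simp only [zero_add] at this
  simp [this]

lemma integral_rateIntegrand_le_meanRate (α : ℝ) :
    ((∫ hhat, rateIntegrand p α hhat ∂(estimateLaw p) : ℝ) : EReal) ≤
      meanRate p (dpcInput p α) := by
  have hI := integrable_logb_varY_div hσh hσE hσZ hQ hP α
  have hc := Real.logb_nonneg one_lt_two (varU_div_ge_one hQ hP α)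
  rw [integral_congr_ae (rateIntegrand_ae_eq hσh hσE hσZ hQ hP α),
    integral_sub hI (integrable_const _), integral_const, probReal_univ, one_smul, meanRate,
    infoUS_dpcInput hQ hP, EReal.coe_sub, EReal.coe_ennreal_ofReal, max_eq_left hc]
  refine EReal.sub_le_sub ?_ le_rfl
  have h0 : 0 ≤ ∫ hhat, Real.logb 2
      (varY p ((dlt p : ℝ) * hhat) / resVar p α ((dlt p : ℝ) * hhat)) ∂(estimateLaw p) :=
    integral_nonneg fun hhat => Real.logb_nonneg one_lt_two
      (varY_div_resVar_ge_one hσh hσE hσZ hQ hP α _)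
  rw [← max_eq_left h0, ← EReal.coe_ennreal_ofReal, EReal.coe_ennreal_le_coe_ennreal_iff,
    ofReal_integral_eq_lintegral_ofReal hI (Filter.Eventually.of_forall fun hhat =>
      Real.logb_nonneg one_lt_two (varY_div_resVar_ge_one hσh hσE hσZ hQ hP α _))]
  refine lintegral_mono_ae ?_
  filter_upwards [posterior_ae_eq hσh hσE] with hhat hpost
  rw [← infoUY_gaussComposite hσh hσE hσZ hQ hP]
  exact infoUY_composite_ge hσh hσE hσZ hQ hP α hpost

lemma integral_rateIntegrand_le_singleLetterCapacity (α : ℝ) :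
    ((∫ hhat, rateIntegrand p α hhat ∂(estimateLaw p) : ℝ) : EReal) ≤ singleLetterCapacity p :=
  (integral_rateIntegrand_le_meanRate hσh hσE hσZ hQ hP α).trans
    (le_iSup₂_of_le (dpcInput p α) (admissible_dpcInput hP α) le_rfl)

end MeanRate

/-! ### Random codes with nested message sets -/

section Expurgation

variable {Ω : Type*} [MeasurableSpace Ω] (μ : Measure Ω) [IsProbabilityMeasure μ]

lemma lintegral_infinitePi_pair {G : Ω → Ω → ℝ≥0∞} (hG : Measurable fun q : Ω × Ω => G q.1 q.2)
    {i j : ℕ} (hij : i ≠ j) :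
    ∫⁻ c, G (c i) (c j) ∂(Measure.infinitePi fun _ : ℕ => μ) = ∫⁻ ω, ∫⁻ ω', G ω ω' ∂μ ∂μ := by
  have h := Measure.infinitePi_map_eval_prod (P := fun _ : ℕ => μ) hij
  rw [← lintegral_prod (fun q : Ω × Ω => G q.1 q.2) hG.aemeasurable, ← h,
    lintegral_map hG (by fun_prop)]

lemma lintegral_infinitePi_eval {G : Ω → ℝ≥0∞} (hG : Measurable G) (i : ℕ) :
    ∫⁻ c, G (c i) ∂(Measure.infinitePi fun _ : ℕ => μ) = ∫⁻ ω, G ω ∂μ := by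
  rw [← (measurePreserving_eval_infinitePi (fun _ : ℕ => μ) i).lintegral_comp hG]

/-- Random coding followed by expurgation. From i.i.d. codewords with a small expected failure
functional and small expected pairwise confusions, one extracts a sequence of codewords whose
maximal errors are small simultaneously for several message sets `{0, …, M k - 1}`. -/
lemma exists_expurgated_code {K : ℕ} (M : Fin K → ℕ) (hM : ∀ k, 0 < M k)
    {fail : Ω → ℝ≥0∞} (hfail : Measurable fail) {conf : Fin K → Ω → Ω → ℝ≥0∞}
    (hconf : ∀ k, Measurable fun q : Ω × Ω => conf k q.1 q.2) {ε ε₁ : ℝ≥0∞} (hε0 : ε ≠ 0)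
    (hε : ε ≠ ∞) {δ : Fin K → ℝ≥0∞} (h1 : ∫⁻ ω, fail ω ∂μ ≤ ε₁)
    (h2 : ∀ k ω, ∫⁻ ω', conf k ω ω' ∂μ ≤ δ k) (h3 : ∀ k, 2 * M k * δ k ≤ ε₁)
    (h4 : 4 * (K : ℝ≥0∞) ^ 2 * ε₁ ≤ ε) :
    ∃ c : ℕ → Ω, ∀ k, ∀ m < M k,
      fail (c m) + ∑ m' ∈ (Finset.range (M k)).erase m, conf k (c m) (c m') ≤ ε := by
  classical
  set ν := Measure.infinitePi fun _ : ℕ => μ with hν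
  set e : Fin K → ℕ → (ℕ → Ω) → ℝ≥0∞ := fun k m c =>
    fail (c m) + ∑ m' ∈ (Finset.range (2 * M k)).erase m, conf k (c m) (c m') with he
  have hem : ∀ k m, Measurable (e k m) := fun k m => by
    have : ∀ m', Measurable fun c : ℕ → Ω => conf k (c m) (c m') := fun m' =>
      (hconf k).comp (f := fun c : ℕ → Ω => (c m, c m')) (by fun_prop)
    fun_prop
  have hee : ∀ k m, ∫⁻ c, e k m c ∂ν ≤ 2 * ε₁ := fun k m => by
    have hc : ∀ m', Measurable fun c : ℕ → Ω => conf k (c m) (c m') := fun m' =>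
      (hconf k).comp (f := fun c : ℕ → Ω => (c m, c m')) (by fun_prop)
    rw [he, lintegral_add_left (by fun_prop), lintegral_finsetSum _ fun m' _ => hc m', two_mul ε₁]
    refine add_le_add ((lintegral_infinitePi_eval μ hfail m).trans_le h1) (le_trans ?_ (h3 k))
    refine (Finset.sum_le_card_nsmul _ _ (δ k) fun m' hm' => ?_).trans ?_
    · rw [lintegral_infinitePi_pair μ (hconf k) (Finset.ne_of_mem_erase hm').symm]
      refine (lintegral_mono fun ω => h2 k ω).trans ?_
      simp
    · rw [nsmul_eq_mul]
      gcongr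
      have := Finset.card_erase_le (s := Finset.range (2 * M k)) (a := m)
      rw [Finset.card_range] at this
      exact_mod_cast this
  -- Summing over every `k` whose doubled range contains `m` makes the quality of an index
  -- independent of `k`, so a single subsequence of codewords can serve all message sets.
  set E : ℕ → (ℕ → Ω) → ℝ≥0∞ := fun m c => ∑ k, if m < 2 * M k then e k m c else 0 with hE
  have hEm : ∀ m, Measurable (E m) := fun m => by
    refine Finset.measurable_fun_sum _ fun k _ => ?_
    split_ifs
    · exact hem k m
    · exact measurable_const
  have hEe : ∀ m, ∫⁻ c, E m c ∂ν ≤ K * (2 * ε₁) := fun m => by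
    rw [hE, lintegral_finsetSum]
    · refine (Finset.sum_le_card_nsmul _ _ (2 * ε₁) fun k _ => ?_).trans (by simp)
      split_ifs
      · exact hee k m
      · simp
    · intro k _
      split_ifs
      · exact hem k m
      · exact measurable_const
  set Ψ : (ℕ → Ω) → ℝ≥0∞ := fun c =>
    ∑ k, (2 * M k : ℝ≥0∞)⁻¹ * ∑ m ∈ Finset.range (2 * M k), E m c with hΨ
  have hM2 : ∀ k, (2 * M k : ℝ≥0∞) ≠ 0 := fun k => by
    have := hM k
    simp [this.ne']
  have hM2' : ∀ k, (2 * M k : ℝ≥0∞) ≠ ∞ := fun k => ENNReal.mul_ne_top (by simp) (by simp)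
  have hΨm : Measurable Ψ := by fun_prop
  have hΨe : ∫⁻ c, Ψ c ∂ν ≤ K * (K * (2 * ε₁)) := by
    rw [hΨ, lintegral_finsetSum _ (fun k _ => by fun_prop)]
    refine (Finset.sum_le_card_nsmul _ _ (K * (2 * ε₁)) fun k _ => ?_).trans (by simp)
    rw [lintegral_const_mul _ (by fun_prop), lintegral_finsetSum _ fun m _ => hEm m]
    rw [mul_comm, ← div_eq_mul_inv]
    refine ENNReal.div_le_of_le_mul ?_
    refine (Finset.sum_le_card_nsmul _ _ (K * (2 * ε₁)) fun m _ => hEe m).trans ?_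
    rw [nsmul_eq_mul, Finset.card_range, mul_comm]
    push_cast
    exact le_rfl
  obtain ⟨c, hc⟩ := exists_le_lintegral (μ := ν) hΨm.aemeasurable
  have hcΨ : Ψ c ≤ K * (K * (2 * ε₁)) := hc.trans hΨe
  have hsum : ∀ k, ∑ m ∈ Finset.range (2 * M k), E m c ≤ M k * ε := fun k => by
    have h5 : (2 * M k : ℝ≥0∞)⁻¹ * ∑ m ∈ Finset.range (2 * M k), E m c ≤ K * (K * (2 * ε₁)) :=
      (Finset.single_le_sum (f := fun k => (2 * M k : ℝ≥0∞)⁻¹ *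
        ∑ m ∈ Finset.range (2 * M k), E m c) (fun _ _ => zero_le) (Finset.mem_univ k)).trans hcΨ
    rw [mul_comm, ← div_eq_mul_inv, ENNReal.div_le_iff (hM2 k) (hM2' k)] at h5
    refine h5.trans ?_
    calc (K : ℝ≥0∞) * (K * (2 * ε₁)) * (2 * M k) = M k * (4 * (K : ℝ≥0∞) ^ 2 * ε₁) := by ring
      _ ≤ M k * ε := by gcongr
  set good : ℕ → Prop := fun m => E m c ≤ ε with hgood
  -- Markov's inequality: the average of `E m c` over the first `2 * M k` indices is at most `ε /
  -- 2`, so at most half of these indices are bad.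
  have hcount : ∀ k, M k ≤ Nat.count good (2 * M k) := fun k => by
    have hbad : ((Finset.range (2 * M k)).filter fun m => ¬ good m).card ≤ M k := by
      have h6 : (((Finset.range (2 * M k)).filter fun m => ¬ good m).card : ℝ≥0∞) * ε ≤
          M k * ε := by
        refine le_trans ?_ (hsum k)
        rw [← nsmul_eq_mul]
        refine (Finset.card_nsmul_le_sum _ _ _ fun m hm => ?_).trans
          (Finset.sum_le_sum_of_subset (Finset.filter_subset _ _))
        exact (not_le.1 (Finset.mem_filter.1 hm).2).le
      have := (ENNReal.mul_le_mul_iff_left hε0 hε).1 h6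
      exact_mod_cast this
    rw [Nat.count_eq_card_filter_range]
    have := Finset.card_filter_add_card_filter_not (s := Finset.range (2 * M k)) fun m => good m
    change M k ≤ ((Finset.range (2 * M k)).filter fun m => good m).card
    rw [Finset.card_range] at this
    omega
  -- The good indices are relabelled in increasing order. The first `M k` of them lie below `2 * M
  -- k` for every `k`, so nestedness of the message sets is preserved.
  refine ⟨fun m => c (Nat.nth good m), fun k m hm => ?_⟩
  have hlt : ∀ m' < M k, Nat.nth good m' < 2 * M k := fun m' hm' =>
    Nat.nth_lt_of_lt_count (hm'.trans_le (hcount k))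
  have hcard : ∀ m' < M k, ∀ hf : (Set.ofPred good).Finite, m' < hf.toFinset.card :=
    fun m' hm' hf => hm'.trans_le ((hcount k).trans (by
      rw [Nat.count_eq_card_filter_range]
      exact Finset.card_le_card fun x hx => by simpa using (Finset.mem_filter.1 hx).2))
  have hmem : good (Nat.nth good m) := Nat.nth_mem m (hcard m hm)
  have hle : e k (Nat.nth good m) c ≤ ε := by
    refine le_trans ?_ hmem
    refine le_trans ?_ (Finset.single_le_sum (f := fun k => if Nat.nth good m < 2 * M k then
      e k (Nat.nth good m) c else 0) (fun _ _ => zero_le) (Finset.mem_univ k))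
    simp [hlt m hm]
  refine le_trans (add_le_add le_rfl ?_) hle
  have hinj : ∀ m₁ < M k, ∀ m₂ < M k, Nat.nth good m₁ = Nat.nth good m₂ → m₁ = m₂ := by
    intro m₁ h₁ m₂ h₂ h
    have e1 := Nat.count_nth (p := good) (hcard _ h₁)
    have e2 := Nat.count_nth (p := good) (hcard _ h₂)
    rw [← e1, ← e2, h]
  have himg := Finset.sum_image (f := fun m' => conf k (c (Nat.nth good m)) (c m'))
    (s := (Finset.range (M k)).erase m) (g := Nat.nth good) (fun m₁ h₁ m₂ h₂ h =>
      hinj m₁ (by simpa using (Finset.mem_of_mem_erase h₁)) m₂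
        (by simpa using (Finset.mem_of_mem_erase h₂)) h)
  rw [← himg]
  refine Finset.sum_le_sum_of_subset fun m' hm' => ?_
  obtain ⟨m₁, h₁, rfl⟩ := Finset.mem_image.1 hm'
  have h₁' : m₁ < M k := by simpa using Finset.mem_of_mem_erase h₁
  refine Finset.mem_erase.2 ⟨fun h => Finset.ne_of_mem_erase h₁ (hinj m₁ h₁' m hm h), ?_⟩
  simpa using hlt m₁ h₁'

end Expurgation

/-! ### Binning -/

section Binning

variable {S U Ξ Y : Type*} [MeasurableSpace S] [MeasurableSpace U] [MeasurableSpace Ξ]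
  [MeasurableSpace Y] {B : ℕ}

/-- The entries of a bin, extended by a default word. -/
def binEntry (u₀ : U) (ω : Fin B → U) (j : ℕ) : U := if h : j < B then ω ⟨j, h⟩ else u₀

open Classical in
/-- The first word of the bin `ω` that is compatible with the state `s`, or `u₀` if there is
none. -/
def binSelect (T : Set (S × U)) (u₀ : U) (ω : Fin B → U) (s : S) : U :=
  binEntry u₀ ω (Nat.find (p := fun j => j < B → (s, binEntry u₀ ω j) ∈ T)
    ⟨B, fun h => absurd h (lt_irrefl B)⟩)

lemma measurable_binEntry (u₀ : U) (j : ℕ) :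
    Measurable fun ω : Fin B → U => binEntry u₀ ω j := by
  unfold binEntry
  split_ifs
  · fun_prop
  · exact measurable_const

lemma measurable_binSelect {T : Set (S × U)} (hT : MeasurableSet T) (u₀ : U) :
    Measurable fun q : (Fin B → U) × S => binSelect T u₀ q.1 q.2 := by
  classical
  have hb := fun j => (measurable_binEntry (B := B) u₀ j).comp
    (measurable_fst : Measurable (Prod.fst : (Fin B → U) × S → _))
  refine Measurable.find (f := fun j (q : (Fin B → U) × S) => binEntry u₀ q.1 j)
    (p := fun j q => j < B → (q.2, binEntry u₀ q.1 j) ∈ T) hb (fun j => ?_)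
    (fun q => ⟨B, fun h => absurd h (lt_irrefl B)⟩)
  by_cases hj : j < B
  · simp only [hj, true_imp_iff]
    exact (measurable_snd.prodMk (hb j)) hT
  · simp [hj]

omit [MeasurableSpace S] [MeasurableSpace U] in
lemma binSelect_spec {T : Set (S × U)} {u₀ : U} {ω : Fin B → U} {s : S}
    (h : ∃ j, (s, ω j) ∈ T) :
    (s, binSelect T u₀ ω s) ∈ T ∧ ∃ j, ω j = binSelect T u₀ ω s := by
  classical
  obtain ⟨j, hj⟩ := h
  unfold binSelect
  -- The index `B` satisfies the implication vacuously and stands for the default word; a genuine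
  -- match forces the minimum below `B`.
  have hex : ∃ j, j < B → (s, binEntry u₀ ω j) ∈ T := ⟨B, fun h => absurd h (lt_irrefl B)⟩
  have hlt : Nat.find hex < B := lt_of_le_of_lt (Nat.find_min' hex (m := j) fun _ => by
    simpa [binEntry] using hj) j.2
  exact ⟨Nat.find_spec hex hlt, ⟨Nat.find hex, hlt⟩, by rw [binEntry, dif_pos hlt]⟩

variable (μ : Measure S) [IsProbabilityMeasure μ] (γ : Measure U) [IsProbabilityMeasure γ]
  (ν : Measure Ξ) [IsProbabilityMeasure ν]

omit [IsProbabilityMeasure μ] [IsProbabilityMeasure ν] in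
lemma measurable_binFail [SFinite μ] {T : Set (S × U)} (hT : MeasurableSet T) :
    Measurable fun ω : Fin B → U => μ {s | ∀ j, (s, ω j) ∉ T} := by
  have : MeasurableSet {q : (Fin B → U) × S | ∀ j, (q.2, q.1 j) ∉ T} := by
    rw [Set.ofPred_forall]
    exact MeasurableSet.iInter fun j =>
      (Measurable.prodMk measurable_snd (by fun_prop) hT.compl :
        MeasurableSet ((fun q : (Fin B → U) × S => (q.2, q.1 j)) ⁻¹' Tᶜ))
  exact measurable_measure_prodMk_left this

/-- Covering: a random bin contains a word compatible with a random state. -/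
lemma lintegral_binFail_le {T : Set (S × U)} (hT : MeasurableSet T) (κ : S → Measure U)
    [∀ s, IsProbabilityMeasure (κ s)] {c : ℝ} (hc : 0 ≤ c)
    (hκ : ∀ s, ENNReal.ofReal c * κ s {u | (s, u) ∈ T} ≤ γ {u | (s, u) ∈ T}) {q : ℝ≥0∞}
    (hq : ∫⁻ s, κ s {u | (s, u) ∉ T} ∂μ ≤ q) (hκm : Measurable fun s => κ s {u | (s, u) ∉ T}) :
    ∫⁻ ω, μ {s | ∀ j, (s, ω j) ∉ T} ∂(Measure.pi fun _ : Fin B => γ) ≤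
      2 * q + ENNReal.ofReal (Real.exp (-(c * B / 2))) := by
  have hTs : ∀ s, MeasurableSet {u | (s, u) ∈ T} := fun s => measurable_prodMk_left hT
  have hm : MeasurableSet {q : (Fin B → U) × S | ∀ j, (q.2, q.1 j) ∉ T} := by
    rw [Set.ofPred_forall]
    exact MeasurableSet.iInter fun j =>
      (Measurable.prodMk measurable_snd (by fun_prop) hT.compl :
        MeasurableSet ((fun q : (Fin B → U) × S => (q.2, q.1 j)) ⁻¹' Tᶜ))
  have hpt : ∀ s, (γ {u | (s, u) ∉ T}) ^ B ≤
      2 * κ s {u | (s, u) ∉ T} + ENNReal.ofReal (Real.exp (-(c * B / 2))) := by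
    intro s
    -- If `κ s` misses the compatible words with probability at least one half, the term `2 * κ s`
    -- already exceeds one. Otherwise a fresh word is compatible with probability at least `c / 2`,
    -- and `B` independent trials all fail with probability at most `exp (-c B / 2)`.
    by_cases h : 1 ≤ 2 * κ s {u | (s, u) ∉ T}
    · exact (pow_le_one₀ (zero_le) prob_le_one).trans (h.trans le_self_add)
    · refine le_trans ?_ le_add_self
      have hγ : γ.real {u | (s, u) ∉ T} = 1 - γ.real {u | (s, u) ∈ T} :=
        probReal_compl_eq_one_sub (hTs s)
      have hκ' : (κ s).real {u | (s, u) ∉ T} = 1 - (κ s).real {u | (s, u) ∈ T} :=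
        probReal_compl_eq_one_sub (hTs s)
      have h1 : 2 * (κ s).real {u | (s, u) ∉ T} < 1 := by
        have := (ENNReal.toReal_lt_toReal (by finiteness) (by finiteness)).2 (not_le.1 h)
        simpa [measureReal_def] using this
      have h2 : c * (κ s).real {u | (s, u) ∈ T} ≤ γ.real {u | (s, u) ∈ T} := by
        have := ENNReal.toReal_mono (by finiteness) (hκ s)
        rwa [ENNReal.toReal_mul, ENNReal.toReal_ofReal hc] at this
      have h3 : γ.real {u | (s, u) ∉ T} ≤ Real.exp (-(c / 2)) := by
        have := Real.add_one_le_exp (-(c / 2))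
        nlinarith
      rw [← ENNReal.ofReal_toReal (measure_ne_top γ {u | (s, u) ∉ T}),
        ← ENNReal.ofReal_pow ENNReal.toReal_nonneg]
      refine ENNReal.ofReal_le_ofReal ?_
      refine (pow_le_pow_left₀ ENNReal.toReal_nonneg h3 B).trans_eq ?_
      rw [← Real.exp_nat_mul]
      congr 1
      ring
  calc ∫⁻ ω, μ {s | ∀ j, (s, ω j) ∉ T} ∂(Measure.pi fun _ : Fin B => γ)
      = ((Measure.pi fun _ : Fin B => γ).prod μ) {q | ∀ j, (q.2, q.1 j) ∉ T} := by
        rw [Measure.prod_apply hm]; rfl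
    _ = ∫⁻ s, (γ {u | (s, u) ∉ T}) ^ B ∂μ := by
        rw [Measure.prod_apply_symm hm]
        refine lintegral_congr fun s => ?_
        have : (fun ω : Fin B → U => (ω, s)) ⁻¹' {q | ∀ j, (q.2, q.1 j) ∉ T} =
            Set.pi Set.univ fun _ : Fin B => {u | (s, u) ∉ T} := by
          ext ω; simp
        rw [this, Measure.pi_pi]
        simp
    _ ≤ ∫⁻ s, (2 * κ s {u | (s, u) ∉ T} + ENNReal.ofReal (Real.exp (-(c * B / 2)))) ∂μ :=
        lintegral_mono hpt
    _ ≤ 2 * q + ENNReal.ofReal (Real.exp (-(c * B / 2))) := by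
        rw [lintegral_add_right _ measurable_const, lintegral_const_mul _ hκm]
        simp only [lintegral_const, measure_univ, mul_one]
        gcongr

/-- The probability that the word sent from the bin `ω` is confused with a word of `ω'`. -/
def binConf (T : Set (S × U)) (u₀ : U) (out : S × U × Ξ → Y) (A : Set (U × Y))
    (ω ω' : Fin B → U) : ℝ≥0∞ :=
  ∫⁻ s, ν {ξ | ∃ j, (ω' j, out (s, binSelect T u₀ ω s, ξ)) ∈ A} ∂μ

lemma measurableSet_binConf {T : Set (S × U)} (hT : MeasurableSet T) (u₀ : U)
    {out : S × U × Ξ → Y} (hout : Measurable out) {A : Set (U × Y)} (hA : MeasurableSet A) :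
    MeasurableSet {r : (((Fin B → U) × (Fin B → U)) × S) × Ξ |
      ∃ j, (r.1.1.2 j, out (r.1.2, binSelect T u₀ r.1.1.1 r.1.2, r.2)) ∈ A} := by
  rw [Set.ofPred_exists]
  refine MeasurableSet.iUnion fun j => ?_
  have h1 : Measurable fun r : (((Fin B → U) × (Fin B → U)) × S) × Ξ =>
      binSelect T u₀ r.1.1.1 r.1.2 :=
    (measurable_binSelect hT u₀).comp (f := fun r : (((Fin B → U) × (Fin B → U)) × S) × Ξ =>
      (r.1.1.1, r.1.2)) (by fun_prop)
  have h2 : Measurable fun r : (((Fin B → U) × (Fin B → U)) × S) × Ξ =>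
      (r.1.1.2 j, out (r.1.2, binSelect T u₀ r.1.1.1 r.1.2, r.2)) := by fun_prop
  exact h2 hA

omit [IsProbabilityMeasure μ] [IsProbabilityMeasure ν] in
lemma measurable_binConf [SFinite μ] [SFinite ν] {T : Set (S × U)} (hT : MeasurableSet T) (u₀ : U)
    {out : S × U × Ξ → Y} (hout : Measurable out) {A : Set (U × Y)} (hA : MeasurableSet A) :
    Measurable fun q : (Fin B → U) × (Fin B → U) => binConf μ ν T u₀ out A q.1 q.2 := by
  have h := measurable_measure_prodMk_left (ν := ν) (measurableSet_binConf (B := B) hT u₀ hout hA)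
  exact h.lintegral_prod_right'

lemma lintegral_binConf_le {T : Set (S × U)} (hT : MeasurableSet T) (u₀ : U)
    {out : S × U × Ξ → Y} (hout : Measurable out) {A : Set (U × Y)} (hA : MeasurableSet A)
    {ε : ℝ≥0∞} (hε : ∀ y, γ {u | (u, y) ∈ A} ≤ ε) (ω : Fin B → U) :
    ∫⁻ ω', binConf μ ν T u₀ out A ω ω' ∂(Measure.pi fun _ : Fin B => γ) ≤ B * ε := by
  have hm := measurableSet_binConf (B := B) hT u₀ hout hA
  have hm1 : MeasurableSet {r : ((Fin B → U) × S) × Ξ |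
      ∃ j, (r.1.1 j, out (r.1.2, binSelect T u₀ ω r.1.2, r.2)) ∈ A} :=
    hm.preimage (f := fun r : ((Fin B → U) × S) × Ξ => (((ω, r.1.1), r.1.2), r.2)) (by fun_prop)
  unfold binConf
  -- The output is determined by `ω`, `s` and `ξ`, hence independent of `ω'`. After Tonelli, the
  -- bound `hε`, uniform in `y`, and a union bound over the `B` words suffice.
  rw [lintegral_lintegral_swap (measurable_measure_prodMk_left hm1).aemeasurable]
  refine (lintegral_mono (g := fun _ => (B : ℝ≥0∞) * ε) fun s => ?_).trans (by simp)
  have hm2 : MeasurableSet {r : (Fin B → U) × Ξ |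
      ∃ j, (r.1 j, out (s, binSelect T u₀ ω s, r.2)) ∈ A} :=
    hm1.preimage (f := fun r : (Fin B → U) × Ξ => ((r.1, s), r.2)) (by fun_prop)
  calc ∫⁻ ω', ν {ξ | ∃ j, (ω' j, out (s, binSelect T u₀ ω s, ξ)) ∈ A}
        ∂(Measure.pi fun _ : Fin B => γ)
      = ((Measure.pi fun _ : Fin B => γ).prod ν)
          {r | ∃ j, (r.1 j, out (s, binSelect T u₀ ω s, r.2)) ∈ A} := by
        rw [Measure.prod_apply hm2]; rfl
    _ = ∫⁻ ξ, (Measure.pi fun _ : Fin B => γ)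
          {ω' | ∃ j, (ω' j, out (s, binSelect T u₀ ω s, ξ)) ∈ A} ∂ν := by
        rw [Measure.prod_apply_symm hm2]; rfl
    _ ≤ ∫⁻ _, (B : ℝ≥0∞) * ε ∂ν := by
        refine lintegral_mono fun ξ => ?_
        rw [Set.ofPred_exists]
        refine (measure_iUnion_fintype_le _ _).trans ?_
        refine (Finset.sum_le_card_nsmul _ _ ε fun j _ => ?_).trans (by simp)
        have hAy : MeasurableSet {u | (u, out (s, binSelect T u₀ ω s, ξ)) ∈ A} :=
          measurable_prodMk_right hA
        have := (measurePreserving_eval (fun _ : Fin B => γ) j).measure_preimage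
          hAy.nullMeasurableSet
        exact this.trans_le (hε _)
    _ = B * ε := by simp

/-- Existence of a code with bins, for a state known at the encoder and several message sets. -/
theorem exists_binning_code {K : ℕ} (M : Fin K → ℕ) (hM : ∀ k, 0 < M k) {T : Set (S × U)}
    (hT : MeasurableSet T) (u₀ : U) {out : Fin K → S × U × Ξ → Y} (hout : ∀ k, Measurable (out k))
    {A : Fin K → Set (U × Y)} (hA : ∀ k, MeasurableSet (A k)) {ε ε₁ : ℝ≥0∞} (hε0 : ε ≠ 0)
    (hε : ε ≠ ∞) {δ : Fin K → ℝ≥0∞}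
    (h1 : ∫⁻ ω, μ {s | ∀ j, (s, ω j) ∉ T} ∂(Measure.pi fun _ : Fin B => γ) ≤ ε₁)
    (h2 : ∀ k y, γ {u | (u, y) ∈ A k} ≤ δ k) (h3 : ∀ k, 2 * M k * (B * δ k) ≤ ε₁)
    (h4 : 4 * (K : ℝ≥0∞) ^ 2 * ε₁ ≤ ε) :
    ∃ c : ℕ → Fin B → U, ∀ k, ∀ m < M k,
      ∫⁻ s, ν {ξ | (∀ j, (s, c m j) ∉ T) ∨ ∃ m' < M k, m' ≠ m ∧
        ∃ j, (c m' j, out k (s, binSelect T u₀ (c m) s, ξ)) ∈ A k} ∂μ ≤ ε := by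
  obtain ⟨c, hc⟩ := exists_expurgated_code (Measure.pi fun _ : Fin B => γ) M hM
    (measurable_binFail μ hT) (fun k => measurable_binConf μ ν hT u₀ (hout k) (hA k)) hε0 hε h1
    (fun k ω => lintegral_binConf_le μ γ ν hT u₀ (hout k) (hA k) (h2 k) ω) h3 h4
  refine ⟨c, fun k m hm => le_trans ?_ (hc k m hm)⟩
  have hms : MeasurableSet {s | ∀ j, (s, c m j) ∉ T} := by
    rw [Set.ofPred_forall]
    exact MeasurableSet.iInter fun j => (measurable_prodMk_right hT : MeasurableSet
      ((fun s => (s, c m j)) ⁻¹' T)).compl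
  have hcm : ∀ m', Measurable fun s =>
      ν {ξ | ∃ j, (c m' j, out k (s, binSelect T u₀ (c m) s, ξ)) ∈ A k} := fun m' =>
    measurable_measure_prodMk_left ((measurableSet_binConf (B := B) hT u₀ (hout k) (hA k)).preimage
      (f := fun r : S × Ξ => (((c m, c m'), r.1), r.2)) (by fun_prop))
  calc _ ≤ ∫⁻ s, ({s | ∀ j, (s, c m j) ∉ T}.indicator 1 s +
        ∑ m' ∈ (Finset.range (M k)).erase m,
          ν {ξ | ∃ j, (c m' j, out k (s, binSelect T u₀ (c m) s, ξ)) ∈ A k}) ∂μ := by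
        refine lintegral_mono fun s => ?_
        by_cases hs : ∀ j, (s, c m j) ∉ T
        · rw [Set.indicator_of_mem (by exact hs)]
          exact prob_le_one.trans le_self_add
        · refine le_trans ?_ le_add_self
          refine le_trans (measure_mono ?_) (measure_biUnion_finset_le _ _)
          rintro ξ (h | ⟨m', hm', hne, hj⟩)
          · exact absurd h hs
          · exact Set.mem_biUnion (by simp [hne, hm'] : m' ∈ (Finset.range (M k)).erase m) hj
    _ = _ := by
        rw [lintegral_add_left (measurable_one.indicator hms), lintegral_indicator_one hms,
          lintegral_finsetSum _ fun m' _ => hcm m']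
        rfl

end Binning

/-! ### Products of probability measures -/

lemma lintegral_pi_prod_eq {ι : Type*} [Fintype ι] {E : ι → Type*} [∀ i, MeasurableSpace (E i)]
    (μ : ∀ i, Measure (E i)) [∀ i, IsProbabilityMeasure (μ i)] {f : ∀ i, E i → ℝ≥0∞}
    (hf : ∀ i, Measurable (f i)) :
    ∫⁻ x, ∏ i, f i (x i) ∂(Measure.pi μ) = ∏ i, ∫⁻ x, f i x ∂(μ i) := by
  have h := lintegral_prod_eq_prod_lintegral_of_indepFun Finset.univ (fun i x => f i (x i))
    (μ := Measure.pi μ) (iIndepFun_pi (X := f) fun i => (hf i).aemeasurable)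
    (fun i => (hf i).comp (measurable_pi_apply i))
  rw [h]
  exact Finset.prod_congr rfl fun i _ => (measurePreserving_eval μ i).lintegral_comp (hf i)

lemma pi_eq_withDensity {ι : Type*} [Fintype ι] {E : ι → Type*} [∀ i, MeasurableSpace (E i)]
    (μ ν : ∀ i, Measure (E i)) [∀ i, IsProbabilityMeasure (μ i)]
    [∀ i, IsProbabilityMeasure (ν i)] {f : ∀ i, E i → ℝ≥0∞}
    (hf : ∀ i, Measurable (f i)) (h : ∀ i, ν i = (μ i).withDensity (f i)) :
    Measure.pi ν = (Measure.pi μ).withDensity (fun x => ∏ i, f i (x i)) := by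
  refine Measure.pi_eq fun s hs => ?_
  have hps : MeasurableSet (Set.pi Set.univ s) := MeasurableSet.univ_pi hs
  rw [withDensity_apply _ hps, ← lintegral_indicator hps]
  have h1 : ∀ x : ∀ i, E i, (Set.pi Set.univ s).indicator (fun x => ∏ i, f i (x i)) x =
      ∏ i, (s i).indicator (f i) (x i) := fun x => by
    classical
    by_cases hx : x ∈ Set.pi Set.univ s
    · rw [Set.indicator_of_mem hx]
      exact Finset.prod_congr rfl fun i _ => (Set.indicator_of_mem (hx i trivial) _).symm
    · rw [Set.indicator_of_notMem hx]
      obtain ⟨i, hi⟩ : ∃ i, x i ∉ s i := by simpa [Set.mem_pi] using hx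
      exact (Finset.prod_eq_zero (Finset.mem_univ i) (Set.indicator_of_notMem hi _)).symm
  simp_rw [h1]
  rw [lintegral_pi_prod_eq μ fun i => (hf i).indicator (hs i)]
  refine Finset.prod_congr rfl fun i _ => ?_
  rw [lintegral_indicator (hs i), h i, withDensity_apply _ (hs i)]

lemma lintegral_pi_prod_split {E F : Type*} [MeasurableSpace E] [MeasurableSpace F] (n : ℕ)
    (μ : Measure E) (ν : Measure F) [IsProbabilityMeasure μ] [IsProbabilityMeasure ν]
    {G : (Fin n → E × F) → ℝ≥0∞} (hG : Measurable G) :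
    ∫⁻ c, G c ∂(Measure.pi fun _ : Fin n => μ.prod ν) =
      ∫⁻ x, ∫⁻ y, G (fun i => (x i, y i)) ∂(Measure.pi fun _ : Fin n => ν)
        ∂(Measure.pi fun _ : Fin n => μ) := by
  have h := (measurePreserving_arrowProdEquivProdArrow E F (Fin n) (fun _ => μ)
    (fun _ => ν)).symm
  rw [← h.lintegral_comp hG, lintegral_prod (fun q => G
    ((MeasurableEquiv.arrowProdEquivProdArrow E F (Fin n)).symm q)) (Measurable.aemeasurable
    (hG.comp (MeasurableEquiv.measurable _)))]
  rfl

/-! ### The weak law of large numbers on finite products -/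

section WeakLaw

variable {E : Type*} [MeasurableSpace E] (μ : Measure E) [IsProbabilityMeasure μ]

lemma pi_eq_map_infinitePi (n : ℕ) : Measure.pi (fun _ : Fin n => μ) =
    (Measure.infinitePi fun _ : ℕ => μ).map (fun ω (i : Fin n) => ω i) := by
  have := Measure.map_infinitePi_infinitePi_of_inj (P := fun _ : ℕ => μ)
    (f := fun i : Fin n => (i : ℕ)) Fin.val_injective
  rw [this, Measure.infinitePi_eq_pi]

/-- A sequence of events for i.i.d. samples whose probability tends to zero. -/
def Rare (W : (n : ℕ) → Set (Fin n → E)) : Prop :=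
  Filter.Tendsto (fun n => Measure.pi (fun _ : Fin n => μ) (W n)) Filter.atTop (nhds 0)

variable {μ}

omit [IsProbabilityMeasure μ] in
lemma Rare.union {V W : (n : ℕ) → Set (Fin n → E)} (hV : Rare μ V) (hW : Rare μ W) :
    Rare μ (fun n => V n ∪ W n) := by
  have h := Filter.Tendsto.add hV hW
  rw [add_zero] at h
  exact tendsto_of_tendsto_of_tendsto_of_le_of_le tendsto_const_nhds h
    (fun n => zero_le) fun n => measure_union_le _ _

omit [IsProbabilityMeasure μ] in
lemma Rare.iUnion {ι : Type*} [Fintype ι] {W : ι → (n : ℕ) → Set (Fin n → E)}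
    (hW : ∀ k, Rare μ (W k)) : Rare μ (fun n => ⋃ k, W k n) := by
  have h := tendsto_finsetSum Finset.univ fun k _ => hW k
  rw [Finset.sum_const_zero] at h
  exact tendsto_of_tendsto_of_tendsto_of_le_of_le tendsto_const_nhds h
    (fun n => zero_le) fun n => measure_iUnion_fintype_le _ _

/-- The strong law holds on the infinite product, almost sure convergence gives convergence in
measure, and the events concern only the first `n` coordinates. -/
lemma rare_of_integral_lt {f : E → ℝ} (hf : Measurable f) (hi : Integrable f μ) {t : ℝ}
    (ht : ∫ x, f x ∂μ < t) : Rare μ (fun n => {c | n * t < ∑ i, f (c i)}) := by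
  set P := Measure.infinitePi fun _ : ℕ => μ with hP
  set X : ℕ → (ℕ → E) → ℝ := fun i ω => f (ω i) with hX
  have hmp : ∀ i, MeasurePreserving (fun ω : ℕ → E => ω i) P μ := fun i =>
    measurePreserving_eval_infinitePi (fun _ : ℕ => μ) i
  have hXi : Integrable (X 0) P := (hmp 0).integrable_comp_of_integrable hi
  have hind : Pairwise (Function.onFun (fun f g => IndepFun f g P) X) := fun i j hij =>
    (iIndepFun_infinitePi (X := fun _ : ℕ => f) (fun _ => hf)).indepFun hij
  have hid : ∀ i, IdentDistrib (X i) (X 0) P P := fun i =>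
    { aemeasurable_fst := (hf.comp (measurable_pi_apply i)).aemeasurable
      aemeasurable_snd := (hf.comp (measurable_pi_apply 0)).aemeasurable
      map_eq := by
        have : ∀ j, P.map (X j) = μ.map f := fun j => by
          rw [← (hmp j).map_eq, Measure.map_map hf (hmp j).measurable]; rfl
        rw [this, this] }
  have hlaw := strong_law_ae_real X hXi hind hid
  have hE : ∫ ω, X 0 ω ∂P = ∫ x, f x ∂μ := by
    rw [← (hmp 0).map_eq, integral_map (hmp 0).measurable.aemeasurable hf.aestronglyMeasurable]
  have hXm : ∀ n : ℕ, Measurable fun ω => (∑ i ∈ Finset.range n, X i ω) / n := fun n => by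
    refine (Finset.measurable_fun_sum _ fun i _ => ?_).div_const _
    exact hf.comp (measurable_pi_apply i)
  have hmeas := tendstoInMeasure_of_tendsto_ae (fun n => (hXm n).aestronglyMeasurable) hlaw
  rw [tendstoInMeasure_iff_dist] at hmeas
  refine tendsto_of_tendsto_of_tendsto_of_le_of_le' tendsto_const_nhds
    (hmeas (t - ∫ x, f x ∂μ) (by linarith)) (Filter.Eventually.of_forall fun n => zero_le) ?_
  filter_upwards [Filter.eventually_gt_atTop 0] with n hn
  have hn' : (0 : ℝ) < n := by exact_mod_cast hn
  rw [pi_eq_map_infinitePi, Measure.map_apply (by fun_prop)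
    (measurableSet_lt measurable_const (by fun_prop))]
  refine measure_mono fun ω hω => ?_
  simp only [Set.mem_preimage, Set.mem_ofPred_eq] at hω ⊢
  rw [hE, Real.dist_eq]
  refine le_trans ?_ (le_abs_self _)
  have h2 : t < (∑ i ∈ Finset.range n, X i ω) / n := by
    rw [lt_div_iff₀ hn', mul_comm]
    rwa [Finset.sum_range]
  linarith

end WeakLaw

/-! ### Gaussian codewords -/

/-- Packing: a random Gaussian word is unlikely to be close, after scaling, to a given sequence of
large energy. -/
lemma pi_cgauss_packing_le {a w : ℝ} (ha : 0 < a) (hw : 0 < w) (c : ℂ) (t b : ℝ) {n : ℕ}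
    (y : Fin n → ℂ) :
    (Measure.pi fun _ : Fin n => cgauss 0 a)
      {u | ∑ i, ‖y i - c * u i‖ ^ 2 ≤ n * t ∧ n * b ≤ ∑ i, ‖y i‖ ^ 2} ≤
    ENNReal.ofReal (Real.exp (n * (t / w - Real.log ((‖c‖ ^ 2 * a + w) / w) -
      b / (‖c‖ ^ 2 * a + w)))) := by
  have hb0 : 0 < ‖c‖ ^ 2 * a + w := by positivity
  by_cases hy : n * b ≤ ∑ i, ‖y i‖ ^ 2
  swap
  · simp [hy]
  -- Up to the factor `π w exp (t / w)` the integrand is the density of `CN(c u, w)` at `y i`, so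
  -- its mean over `u` is a Gaussian density of variance `|c|² a + w`.
  have hone : ∀ i, ∫⁻ u, ENNReal.ofReal (Real.exp ((t - ‖y i - c * u‖ ^ 2) / w)) ∂(cgauss 0 a) =
      ENNReal.ofReal (Real.exp (t / w - Real.log ((‖c‖ ^ 2 * a + w) / w) -
        ‖y i‖ ^ 2 / (‖c‖ ^ 2 * a + w))) := fun i => by
    have h := lintegral_cgaussPDF_mul ha hw c (y i)
    have h1 : ∀ u, ENNReal.ofReal (Real.exp ((t - ‖y i - c * u‖ ^ 2) / w)) =
        ENNReal.ofReal (Real.pi * w * Real.exp (t / w)) *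
          ENNReal.ofReal (cgaussPDF (c * u) w (y i)) := fun u => by
      rw [← ENNReal.ofReal_mul (by positivity), cgaussPDF, sub_div, sub_eq_add_neg, Real.exp_add,
        neg_div]
      congr 1
      field_simp
    simp_rw [h1]
    rw [lintegral_const_mul' _ _ ENNReal.ofReal_ne_top, h, ← ENNReal.ofReal_mul (by positivity),
      cgaussPDF, Real.exp_sub, Real.exp_sub, Real.exp_log (by positivity), sub_zero, neg_div,
      Real.exp_neg]
    congr 1
    field_simp
  calc _ ≤ ∫⁻ u, ∏ i, ENNReal.ofReal (Real.exp ((t - ‖y i - c * u i‖ ^ 2) / w))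
        ∂(Measure.pi fun _ : Fin n => cgauss 0 a) := by
        have hm : Measurable fun u : Fin n → ℂ =>
            ∏ i, ENNReal.ofReal (Real.exp ((t - ‖y i - c * u i‖ ^ 2) / w)) := by fun_prop
        -- Chernoff bound: on the event the product of exponentials is at least one, so its mean
        -- bounds the probability.
        refine le_trans (measure_mono ?_) ((one_mul _).symm.trans_le
          (mul_meas_ge_le_lintegral hm 1))
        rintro u ⟨hu, -⟩
        simp only [Set.mem_ofPred_eq]
        rw [← ENNReal.ofReal_prod_of_nonneg fun i _ => (Real.exp_pos _).le, ← Real.exp_sum,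
          ← ENNReal.ofReal_one]
        refine ENNReal.ofReal_le_ofReal (Real.one_le_exp ?_)
        rw [← Finset.sum_div, Finset.sum_sub_distrib]
        simp only [Finset.sum_const, Finset.card_univ, Fintype.card_fin, nsmul_eq_mul]
        exact div_nonneg (by linarith) hw.le
    _ = ∏ i, ENNReal.ofReal (Real.exp (t / w - Real.log ((‖c‖ ^ 2 * a + w) / w) -
        ‖y i‖ ^ 2 / (‖c‖ ^ 2 * a + w))) := by
        rw [lintegral_pi_prod_eq (fun _ => cgauss 0 a) (f := fun i u =>
          ENNReal.ofReal (Real.exp ((t - ‖y i - c * u‖ ^ 2) / w))) fun i => by fun_prop]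
        exact Finset.prod_congr rfl fun i _ => hone i
    _ ≤ _ := by
        rw [← ENNReal.ofReal_prod_of_nonneg fun i _ => (Real.exp_pos _).le, ← Real.exp_sum]
        refine ENNReal.ofReal_le_ofReal (Real.exp_le_exp.2 ?_)
        rw [Finset.sum_sub_distrib, ← Finset.sum_div]
        simp only [Finset.sum_const, Finset.card_univ, Fintype.card_fin, nsmul_eq_mul]
        have := div_le_div_of_nonneg_right hy hb0.le
        rw [mul_div_assoc] at this
        linarith

/-- Comparison of the law of a Gaussian codeword with a shifted Gaussian law. -/
lemma pi_cgauss_shift_le {a P : ℝ} (ha : 0 < a) (hP : 0 < P) {ζ : ℝ} {n : ℕ} (m : Fin n → ℂ)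
    {T : Set (Fin n → ℂ)} (hT : MeasurableSet T)
    (h1 : ∀ u ∈ T, n * (P - ζ) ≤ ∑ i, ‖u i - m i‖ ^ 2)
    (h2 : ∀ u ∈ T, ∑ i, ‖u i‖ ^ 2 ≤ n * (a + ζ)) :
    ENNReal.ofReal (Real.exp (-(n * (Real.log (a / P) + ζ / P + ζ / a)))) *
      (Measure.pi fun i => cgauss (m i) P) T ≤ (Measure.pi fun _ : Fin n => cgauss 0 a) T := by
  -- The density ratio of the two Gaussian laws; on `T` the energy bounds keep its product over the
  -- block above the stated exponential.
  have hd : ∀ i, cgauss 0 a = (cgauss (m i) P).withDensity (fun u =>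
      ENNReal.ofReal (Real.exp (‖u - m i‖ ^ 2 / P - ‖u‖ ^ 2 / a - Real.log (a / P)))) := fun i => by
    refine Measure.ext_of_lintegral _ fun F hF => ?_
    rw [lintegral_withDensity_eq_lintegral_mul _ (by fun_prop) hF, lintegral_cgauss_eq _ ha hF,
      lintegral_cgauss_eq _ hP (by fun_prop)]
    refine lintegral_congr fun u => ?_
    rw [Pi.mul_apply, ← mul_assoc, ← ENNReal.ofReal_mul (cgaussPDF_pos _ hP _).le]
    congr 2
    rw [cgaussPDF, cgaussPDF, Real.exp_sub, Real.exp_sub, Real.exp_log (by positivity), sub_zero,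
      neg_div, neg_div, Real.exp_neg, Real.exp_neg]
    field_simp
  rw [pi_eq_withDensity (fun i => cgauss (m i) P) (fun _ : Fin n => cgauss 0 a)
    (fun i => by fun_prop) hd, withDensity_apply _ hT, ← setLIntegral_const]
  refine setLIntegral_mono' hT fun u hu => ?_
  rw [← ENNReal.ofReal_prod_of_nonneg fun i _ => (Real.exp_pos _).le, ← Real.exp_sum]
  refine ENNReal.ofReal_le_ofReal (Real.exp_le_exp.2 ?_)
  rw [Finset.sum_sub_distrib, Finset.sum_sub_distrib, ← Finset.sum_div, ← Finset.sum_div]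
  simp only [Finset.sum_const, Finset.card_univ, Fintype.card_fin, nsmul_eq_mul]
  have e1 := div_le_div_of_nonneg_right (h1 u hu) hP.le
  have e2 := div_le_div_of_nonneg_right (h2 u hu) ha.le
  have e3 : n * (P - ζ) / P = n - n * (ζ / P) := by field_simp
  have e4 : n * (a + ζ) / a = n + n * (ζ / a) := by field_simp
  rw [e3] at e1
  rw [e4] at e2
  linarith

/-! ### The letter law -/

/-- The law of the multiplicative and additive noise of the composite channel. -/
def noiseLaw (p : Params) : Measure (ℂ × ℂ) :=
  (cgauss 0 (dlt p * p.σE2)).prod (cgauss 0 p.σZ2)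

instance (p : Params) : IsProbabilityMeasure (noiseLaw p) := by
  unfold noiseLaw; infer_instance

/-- The law of state, input and noise in one channel use. -/
def letterLaw (p : Params) : Measure ((ℂ × ℂ) × (ℂ × ℂ)) :=
  ((cgauss 0 p.Q).prod (cgauss 0 p.Pbar)).prod (noiseLaw p)

instance (p : Params) : IsProbabilityMeasure (letterLaw p) := by
  unfold letterLaw; infer_instance

/-- The output of one channel use with mean gain `h`. -/
def letterOut (h : ℂ) (q : (ℂ × ℂ) × (ℂ × ℂ)) : ℂ := (h + q.2.1) * (q.1.2 + q.1.1) + q.2.2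

@[fun_prop]
lemma measurable_letterOut (h : ℂ) : Measurable (letterOut h) := by unfold letterOut; fun_prop

lemma lintegral_letterLaw (p : Params) {F : (ℂ × ℂ) × (ℂ × ℂ) → ℝ≥0∞} (hF : Measurable F) :
    ∫⁻ q, F q ∂(letterLaw p) = ∫⁻ s, ∫⁻ x, ∫⁻ w, ∫⁻ z, F ((s, x), (w, z)) ∂(cgauss 0 p.σZ2)
      ∂(cgauss 0 (dlt p * p.σE2)) ∂(cgauss 0 p.Pbar) ∂(cgauss 0 p.Q) := by
  have hm : ∀ a : ℂ × ℂ, Measurable fun b : ℂ × ℂ => F (a, b) := fun a => by fun_prop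
  rw [letterLaw, lintegral_prod _ hF.aemeasurable, lintegral_prod _ (Measurable.aemeasurable
    (Measurable.lintegral_prod_right' (f := F) hF))]
  refine lintegral_congr fun s => lintegral_congr fun x => ?_
  rw [noiseLaw, lintegral_prod _ (hm (s, x)).aemeasurable]

section Letter

variable {p : Params} (hσh : 0 < p.σh2) (hσE : 0 < p.σE2) (hσZ : 0 < p.σZ2) (hQ : 0 < p.Q)
  (hP : 0 < p.Pbar)
include hQ hP

lemma lintegral_sq_letterLaw (k g : ℂ) :
    ∫⁻ q, ‖k * q.1.1 + g * q.1.2‖ₑ ^ 2 ∂(letterLaw p) =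
      ENNReal.ofReal (‖k‖ ^ 2 * p.Q + ‖g‖ ^ 2 * p.Pbar) := by
  have hsq : ∀ z : ℂ, ‖z‖ₑ ^ 2 = ENNReal.ofReal (‖z‖ ^ 2) := fun z => by
    rw [ENNReal.ofReal_pow (norm_nonneg _), ofReal_norm]
  rw [lintegral_letterLaw p (by fun_prop)]
  simp only [lintegral_const, measure_univ, mul_one, lintegral_enorm_sq_cgauss_mul _ _ hP.le]
  rw [lintegral_add_right _ measurable_const]
  have := lintegral_enorm_sq_cgauss_mul 0 k hQ.le
  simp only [zero_add] at this
  rw [this]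
  simp only [lintegral_const, measure_univ, mul_one, hsq, norm_zero, zero_pow two_ne_zero,
    ENNReal.ofReal_zero, zero_add]
  rw [← ENNReal.ofReal_mul (by positivity), ← ENNReal.ofReal_mul (by positivity),
    ← ENNReal.ofReal_add (by positivity) (by positivity)]

include hσh hσE hσZ

lemma lintegral_sq_letterOut (h g k : ℂ) :
    ∫⁻ q, ‖letterOut h q + g * q.1.2 + k * q.1.1‖ₑ ^ 2 ∂(letterLaw p) =
      ENNReal.ofReal (‖h + g‖ ^ 2 * p.Pbar + ‖h + k‖ ^ 2 * p.Q + NN p) := by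
  rw [← lintegral_sq_composite hσh hσE hσZ hQ hP, lintegral_letterLaw p (by fun_prop)]
  refine lintegral_congr fun s => lintegral_congr fun x => ?_
  rw [lintegral_cgauss h _ (F := fun θ => ∫⁻ z, ‖θ * (x + s) + z + g * x + k * s‖ₑ ^ 2
    ∂(cgauss 0 p.σZ2)) (Measurable.lintegral_prod_right' (f := fun r : ℂ × ℂ =>
      ‖r.1 * (x + s) + r.2 + g * x + k * s‖ₑ ^ 2) (by fun_prop))]
  rfl

lemma lintegral_sq_residual (α : ℝ) (h : ℂ) :
    ∫⁻ q, ‖letterOut h q - regCoeff p α h * (q.1.2 + α * q.1.1)‖ₑ ^ 2 ∂(letterLaw p) =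
      ENNReal.ofReal (resVar p α h) := by
  have := lintegral_sq_letterOut hσh hσE hσZ hQ hP h (-regCoeff p α h) (-(regCoeff p α h * α))
  rw [← sub_eq_add_neg, ← sub_eq_add_neg, residual_sq hQ hP] at this
  rw [← this]
  refine lintegral_congr fun q => ?_
  ring_nf

lemma lintegral_sq_output (h : ℂ) :
    ∫⁻ q, ‖letterOut h q‖ₑ ^ 2 ∂(letterLaw p) = ENNReal.ofReal (varY p h) := by
  have := lintegral_sq_letterOut hσh hσE hσZ hQ hP h 0 0
  simpa [varY, mul_add] using this

end Letter

/-! ### Typical sequences -/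

/-- The samples of state, input and noise with an exceptional empirical energy; `h` and `r` list
the channel gains and the tolerances. -/
def atypical (p : Params) (α Pm ζ : ℝ) {K : ℕ} (h : Fin K → ℂ) (r : Fin K → ℝ) (n : ℕ) :
    Set (Fin n → (ℂ × ℂ) × (ℂ × ℂ)) :=
  {c | n * Pm < ∑ i, ‖(c i).1.2‖ ^ 2} ∪
  {c | n * (-(p.Pbar - ζ)) < ∑ i, -‖(c i).1.2‖ ^ 2} ∪
  {c | n * (varU p α + ζ) < ∑ i, ‖(c i).1.2 + α * (c i).1.1‖ ^ 2} ∪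
  {c | n * (p.Pbar + p.Q + 1) < ∑ i, ‖(c i).1.2 + (c i).1.1‖ ^ 2} ∪
  ⋃ k, ({c | n * (resVar p α (h k) + r k) <
      ∑ i, ‖letterOut (h k) (c i) - regCoeff p α (h k) * ((c i).1.2 + α * (c i).1.1)‖ ^ 2} ∪
    {c | n * (-(varY p (h k) - r k)) < ∑ i, -‖letterOut (h k) (c i)‖ ^ 2})

lemma measurableSet_atypical (p : Params) (α Pm ζ : ℝ) {K : ℕ} (h : Fin K → ℂ) (r : Fin K → ℝ)
    (n : ℕ) : MeasurableSet (atypical p α Pm ζ h r n) := by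
  have hl : ∀ k, Measurable fun c : (Fin n → (ℂ × ℂ) × (ℂ × ℂ)) => fun i =>
      letterOut (h k) (c i) := fun k => by fun_prop
  unfold atypical
  refine ((((measurableSet_lt measurable_const (by fun_prop)).union
    (measurableSet_lt measurable_const (by fun_prop))).union
    (measurableSet_lt measurable_const (by fun_prop))).union
    (measurableSet_lt measurable_const (by fun_prop))).union (MeasurableSet.iUnion fun k =>
    (measurableSet_lt measurable_const (by fun_prop)).union
    (measurableSet_lt measurable_const (by fun_prop)))

lemma rare_atypical {p : Params} (hσh : 0 < p.σh2) (hσE : 0 < p.σE2) (hσZ : 0 < p.σZ2)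
    (hQ : 0 < p.Q) (hP : 0 < p.Pbar) (α : ℝ) {Pm ζ : ℝ} (hPm : p.Pbar < Pm) (hζ : 0 < ζ) {K : ℕ}
    (h : Fin K → ℂ) {r : Fin K → ℝ} (hr : ∀ k, 0 < r k) :
    Rare (letterLaw p) (atypical p α Pm ζ h r) := by
  have up : ∀ {g : (ℂ × ℂ) × (ℂ × ℂ) → ℂ} {t t' : ℝ}, Measurable g → 0 ≤ t →
      ∫⁻ q, ‖g q‖ₑ ^ 2 ∂(letterLaw p) = ENNReal.ofReal t → t < t' →
      Rare (letterLaw p) fun n => {c | n * t' < ∑ i, ‖g (c i)‖ ^ 2} := by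
    intro g t t' hg ht hi htt
    refine rare_of_integral_lt (f := fun q => ‖g q‖ ^ 2) (by fun_prop)
      (integrable_sq_norm_of_lintegral hg hi) ?_
    rwa [integral_sq_norm_of_lintegral hg ht hi]
  have low : ∀ {g : (ℂ × ℂ) × (ℂ × ℂ) → ℂ} {t t' : ℝ}, Measurable g → 0 ≤ t →
      ∫⁻ q, ‖g q‖ₑ ^ 2 ∂(letterLaw p) = ENNReal.ofReal t → t' < t →
      Rare (letterLaw p) fun n => {c | n * (-t') < ∑ i, -‖g (c i)‖ ^ 2} := by
    intro g t t' hg ht hi htt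
    refine rare_of_integral_lt (f := fun q => -‖g q‖ ^ 2) (by fun_prop)
      (integrable_sq_norm_of_lintegral hg hi).neg ?_
    rw [integral_neg, integral_sq_norm_of_lintegral hg ht hi]
    linarith
  have hx : ∫⁻ q, ‖q.1.2‖ₑ ^ 2 ∂(letterLaw p) = ENNReal.ofReal p.Pbar := by
    simpa using lintegral_sq_letterLaw hQ hP 0 1
  have hu : ∫⁻ q, ‖q.1.2 + α * q.1.1‖ₑ ^ 2 ∂(letterLaw p) = ENNReal.ofReal (varU p α) := by
    have := lintegral_sq_letterLaw hQ hP α 1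
    simpa [varU, add_comm] using this
  have hxs : ∫⁻ q, ‖q.1.2 + q.1.1‖ₑ ^ 2 ∂(letterLaw p) = ENNReal.ofReal (p.Pbar + p.Q) := by
    have := lintegral_sq_letterLaw hQ hP 1 1
    simpa [add_comm] using this
  have hvU := varU_pos hQ hP α
  refine (((((up (by fun_prop) hP.le hx hPm).union
    (low (by fun_prop) hP.le hx (by linarith))).union
    (up (by fun_prop) hvU.le hu (by linarith))).union
    (up (by fun_prop) (by positivity) hxs (by linarith))).union (Rare.iUnion fun k => ?_))
  have hrv := resVar_pos hσh hσE hσZ hQ hP α (h k)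
  have hyv : 0 ≤ varY p (h k) := by
    have := NN_pos hσh hσE hσZ hQ hP
    unfold varY; positivity
  exact (up (by fun_prop) hrv.le (lintegral_sq_residual hσh hσE hσZ hQ hP α (h k))
    (by linarith [hr k])).union (low (by fun_prop) hyv (lintegral_sq_output hσh hσE hσZ hQ hP (h k))
    (by linarith [hr k]))

section Cells

/-! ### Robustness with respect to the channel gain -/

/-- Changing the gain shifts the output by `(h - h') (x + s)`. Apply `(a + r b)² ≤ (1 + r) a² + (r +
r²) b²`, a consequence of `2 a b ≤ a² + b²`, letter by letter. -/
lemma sum_sq_letterOut_sub_le {n : ℕ} {r C : ℝ} (hr : 0 < r) {h h' : ℂ} (hh : ‖h - h'‖ ≤ r)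
    (c : Fin n → (ℂ × ℂ) × (ℂ × ℂ)) (hC : ∑ i, ‖(c i).1.2 + (c i).1.1‖ ^ 2 ≤ n * C)
    (v : Fin n → ℂ) :
    ∑ i, ‖letterOut h (c i) - v i‖ ^ 2 ≤
      (1 + r) * ∑ i, ‖letterOut h' (c i) - v i‖ ^ 2 + n * ((r + r ^ 2) * C) := by
  have hpt : ∀ i, ‖letterOut h (c i) - v i‖ ^ 2 ≤ (1 + r) * ‖letterOut h' (c i) - v i‖ ^ 2 +
      (r + r ^ 2) * ‖(c i).1.2 + (c i).1.1‖ ^ 2 := fun i => by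
    set a := ‖letterOut h' (c i) - v i‖
    set b := ‖(c i).1.2 + (c i).1.1‖
    have h1 : ‖letterOut h (c i) - v i‖ ≤ a + r * b := by
      have e : letterOut h (c i) - v i =
          (letterOut h' (c i) - v i) + (h - h') * ((c i).1.2 + (c i).1.1) := by
        unfold letterOut; ring
      rw [e]
      refine (norm_add_le _ _).trans ?_
      rw [norm_mul]
      gcongr
    have h2 : ‖letterOut h (c i) - v i‖ ^ 2 ≤ (a + r * b) ^ 2 :=
      pow_le_pow_left₀ (norm_nonneg _) h1 2
    nlinarith [mul_nonneg hr.le (sq_nonneg (a - b))]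
  calc ∑ i, ‖letterOut h (c i) - v i‖ ^ 2
      ≤ ∑ i, ((1 + r) * ‖letterOut h' (c i) - v i‖ ^ 2 +
        (r + r ^ 2) * ‖(c i).1.2 + (c i).1.1‖ ^ 2) := Finset.sum_le_sum fun i _ => hpt i
    _ = (1 + r) * ∑ i, ‖letterOut h' (c i) - v i‖ ^ 2 +
        (r + r ^ 2) * ∑ i, ‖(c i).1.2 + (c i).1.1‖ ^ 2 := by
        rw [Finset.sum_add_distrib, Finset.mul_sum, Finset.mul_sum]
    _ ≤ _ := by
        have : (r + r ^ 2) * ∑ i, ‖(c i).1.2 + (c i).1.1‖ ^ 2 ≤ (r + r ^ 2) * (n * C) := by gcongr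
        linarith

variable (p : Params) (α : ℝ)

/-- The bound of the empirical power of `X + S`. -/
def sumPow : ℝ := p.Pbar + p.Q + 1

/-- The distance threshold of the decoder. -/
def decDist (h : ℂ) (r : ℝ) : ℝ := (1 + r) * (resVar p α h + r) + (r + r ^ 2) * sumPow p

/-- The energy threshold of the decoder. -/
def decPow (h : ℂ) (r : ℝ) : ℝ := (varY p h - r - (r + r ^ 2) * sumPow p) / (1 + r)

/-- The distance threshold for confusions. -/
def confDist (h : ℂ) (r : ℝ) : ℝ := (1 + r) * decDist p α h r + (r + r ^ 2) * sumPow p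

/-- The energy threshold for confusions. -/
def confPow (h : ℂ) (r : ℝ) : ℝ := (decPow p h r - (r + r ^ 2) * sumPow p) / (1 + r)

/-- The pairs of a codeword and an output that pass a threshold test. -/
def testSet (h : ℂ) (t b : ℝ) (n : ℕ) : Set ((Fin n → ℂ) × (Fin n → ℂ)) :=
  {q | ∑ i, ‖q.2 i - regCoeff p α h * q.1 i‖ ^ 2 ≤ n * t ∧ n * b ≤ ∑ i, ‖q.2 i‖ ^ 2}

lemma measurableSet_testSet (h : ℂ) (t b : ℝ) (n : ℕ) :
    MeasurableSet (testSet p α h t b n) := by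
  unfold testSet
  rw [Set.ofPred_and]
  exact (measurableSet_le (by fun_prop) measurable_const).inter
    (measurableSet_le measurable_const (by fun_prop))

variable {p α}

/-- At `r = 0` both quotients equal one, and they are continuous there. Their difference is the loss
in the packing exponent. -/
lemma exists_cell_radius (hσh : 0 < p.σh2) (hσE : 0 < p.σE2) (hσZ : 0 < p.σZ2) (hQ : 0 < p.Q)
    (hP : 0 < p.Pbar) (h : ℂ) {η : ℝ} (hη : 0 < η) :
    ∃ r, 0 < r ∧ confDist p α h r / resVar p α h - confPow p h r / varY p h < η := by
  have hR := resVar_pos hσh hσE hσZ hQ hP α h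
  have hY : 0 < varY p h := by
    have := NN_pos hσh hσE hσZ hQ hP
    unfold varY; positivity
  have hc : ContinuousAt (fun r => confDist p α h r / resVar p α h - confPow p h r / varY p h) 0 := by
    unfold confDist confPow decDist decPow
    have h1 : (1 + (0 : ℝ)) ≠ 0 := by norm_num
    fun_prop (disch := assumption)
  have h0 : confDist p α h 0 / resVar p α h - confPow p h 0 / varY p h < η := by
    simp [confDist, confPow, decDist, decPow, hR.ne', hY.ne', hη]
  have hev := hc.eventually_lt_const h0
  obtain ⟨r, hr, hr0⟩ := ((hev.filter_mono nhdsWithin_le_nhds).and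
    (self_mem_nhdsWithin (s := Set.Ioi (0 : ℝ)))).exists
  exact ⟨r, hr0, hr⟩

/-- Typicality at the cell centre ensures that the sent word passes the decoder's test at every gain
of the cell. -/
lemma mem_testSet_of_typical {n : ℕ} {h h' : ℂ} {r : ℝ} (hr : 0 < r) (hh : ‖h' - h‖ ≤ r)
    {c : Fin n → (ℂ × ℂ) × (ℂ × ℂ)} (hC : ∑ i, ‖(c i).1.2 + (c i).1.1‖ ^ 2 ≤ n * sumPow p)
    (h1 : ∑ i, ‖letterOut h (c i) - regCoeff p α h * ((c i).1.2 + α * (c i).1.1)‖ ^ 2 ≤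
      n * (resVar p α h + r))
    (h2 : n * (varY p h - r) ≤ ∑ i, ‖letterOut h (c i)‖ ^ 2) :
    ((fun i => (c i).1.2 + α * (c i).1.1, fun i => letterOut h' (c i)) :
      (Fin n → ℂ) × (Fin n → ℂ)) ∈ testSet p α h (decDist p α h r) (decPow p h r) n := by
  refine ⟨?_, ?_⟩
  · refine (sum_sq_letterOut_sub_le hr hh c hC _).trans ?_
    unfold decDist
    have := mul_le_mul_of_nonneg_left h1 (by positivity : 0 ≤ 1 + r)
    linarith
  · have := sum_sq_letterOut_sub_le hr (by rwa [norm_sub_rev] at hh) c hC (fun _ => 0)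
    simp only [sub_zero] at this
    unfold decPow
    rw [← mul_div_assoc, div_le_iff₀ (by positivity)]
    linarith

/-- The opposite transfer: a wrong word accepted at some gain of the cell passes the still looser
test at the centre. One event per cell thus covers the confusions at all its gains. -/
lemma mem_testSet_conf {n : ℕ} {h h' : ℂ} {r : ℝ} (hr : 0 < r) (hh : ‖h' - h‖ ≤ r)
    {c : Fin n → (ℂ × ℂ) × (ℂ × ℂ)} (hC : ∑ i, ‖(c i).1.2 + (c i).1.1‖ ^ 2 ≤ n * sumPow p)
    {u : Fin n → ℂ} (hu : ((u, fun i => letterOut h' (c i)) : (Fin n → ℂ) × (Fin n → ℂ)) ∈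
      testSet p α h (decDist p α h r) (decPow p h r) n) :
    ((u, fun i => letterOut h (c i)) : (Fin n → ℂ) × (Fin n → ℂ)) ∈
      testSet p α h (confDist p α h r) (confPow p h r) n := by
  obtain ⟨h1, h2⟩ := hu
  simp only at h1 h2
  refine ⟨?_, ?_⟩
  · refine (sum_sq_letterOut_sub_le hr (by rwa [norm_sub_rev] at hh) c hC _).trans ?_
    unfold confDist
    have := mul_le_mul_of_nonneg_left h1 (by positivity : 0 ≤ 1 + r)
    linarith
  · have := sum_sq_letterOut_sub_le hr hh c hC (fun _ => 0)
    simp only [sub_zero] at this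
    unfold confPow
    rw [← mul_div_assoc, div_le_iff₀ (by positivity)]
    linarith

end Cells

/-! ### Typical pairs of a state and a codeword -/

/-- The letters of a block with state `s`, codeword `u` and noise `ξ`. -/
def letters (α : ℝ) {n : ℕ} (s u : Fin n → ℂ) (ξ : Fin n → ℂ × ℂ) (i : Fin n) :
    (ℂ × ℂ) × (ℂ × ℂ) := ((s i, u i - α * s i), ξ i)

@[fun_prop]
lemma measurable_letters (α : ℝ) {n : ℕ} {β : Type*} [MeasurableSpace β] {f g : β → Fin n → ℂ}
    {k : β → Fin n → ℂ × ℂ} (hf : Measurable f) (hg : Measurable g) (hk : Measurable k) :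
    Measurable fun b => letters α (f b) (g b) (k b) := by
  unfold letters
  fun_prop

/-- The pairs of a state and a codeword for which the event `W` has small conditional
probability. -/
def typicalPairs (p : Params) (α : ℝ) {n : ℕ} (W : Set (Fin n → (ℂ × ℂ) × (ℂ × ℂ))) (ε : ℝ≥0∞) :
    Set ((Fin n → ℂ) × (Fin n → ℂ)) :=
  {q | (Measure.pi fun _ : Fin n => noiseLaw p) {ξ | letters α q.1 q.2 ξ ∈ W} ≤ ε}

section Typical

variable (p : Params) (α : ℝ) {n : ℕ} {W : Set (Fin n → (ℂ × ℂ) × (ℂ × ℂ))}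

lemma measurable_noise_letters (hW : MeasurableSet W) :
    Measurable fun q : (Fin n → ℂ) × (Fin n → ℂ) =>
      (Measure.pi fun _ : Fin n => noiseLaw p) {ξ | letters α q.1 q.2 ξ ∈ W} := by
  have h : MeasurableSet {r : ((Fin n → ℂ) × (Fin n → ℂ)) × (Fin n → ℂ × ℂ) |
      letters α r.1.1 r.1.2 r.2 ∈ W} := hW.preimage (by fun_prop)
  exact measurable_measure_prodMk_left h

lemma measurableSet_typicalPairs (hW : MeasurableSet W) (ε : ℝ≥0∞) :
    MeasurableSet (typicalPairs p α W ε) :=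
  measurableSet_le (measurable_noise_letters p α hW) measurable_const

/-- The conditional probability of `W` is below one, so some noise avoids `W`. Constraints that do
not involve the noise therefore hold surely for a typical pair. -/
lemma exists_noise_of_typical {ε : ℝ≥0∞} (hε : ε < 1) {q : (Fin n → ℂ) × (Fin n → ℂ)}
    (hq : q ∈ typicalPairs p α W ε) : ∃ ξ, letters α q.1 q.2 ξ ∉ W := by
  by_contra! h
  have : {ξ | letters α q.1 q.2 ξ ∈ W} = Set.univ := Set.eq_univ_of_forall h
  have h1 : (Measure.pi fun _ : Fin n => noiseLaw p) {ξ | letters α q.1 q.2 ξ ∈ W} ≤ ε := hq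
  rw [this, measure_univ] at h1
  exact absurd h1 (not_le.2 hε)

lemma pi_cgauss_apply (P : ℝ) (m : Fin n → ℂ) {E : Set (Fin n → ℂ)} (hE : MeasurableSet E) :
    (Measure.pi fun i => cgauss (m i) P) E =
      (Measure.pi fun _ : Fin n => cgauss 0 P) {x | (fun i => m i + x i) ∈ E} := by
  have h : (Measure.pi fun i => cgauss (m i) P) =
      (Measure.pi fun _ : Fin n => cgauss 0 P).map (fun x i => m i + x i) := by
    rw [Measure.pi_map_pi (f := fun i x => m i + x) (fun i => by fun_prop)]
    congr 1
    funext i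
    exact cgauss_eq_map _ _
  rw [h, Measure.map_apply (by fun_prop) hE]
  rfl

lemma measurable_pi_cgauss_shift (P : ℝ) {T : Set ((Fin n → ℂ) × (Fin n → ℂ))}
    (hT : MeasurableSet T) : Measurable fun s : Fin n → ℂ =>
      (Measure.pi fun i => cgauss (α * s i) P) {u | (s, u) ∉ T} := by
  have h : ∀ s : Fin n → ℂ, (Measure.pi fun i => cgauss (α * s i) P) {u | (s, u) ∉ T} =
      (Measure.pi fun _ : Fin n => cgauss 0 P) {x | (s, fun i => α * s i + x i) ∉ T} := fun s =>
    pi_cgauss_apply P _ (measurable_prodMk_left hT).compl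
  simp_rw [h]
  have hm : MeasurableSet {r : (Fin n → ℂ) × (Fin n → ℂ) |
      (r.1, fun i => α * r.1 i + r.2 i) ∉ T} := hT.compl.preimage
        (f := fun r : (Fin n → ℂ) × (Fin n → ℂ) => (r.1, fun i => α * r.1 i + r.2 i)) (by fun_prop)
  exact measurable_measure_prodMk_left hm

/-- Markov's inequality for the conditional probability of `W`. When `u - α s` is Gaussian and
independent of `s`, the letters are i.i.d. with law `letterLaw p`. -/
lemma lintegral_not_typical_le (hW : MeasurableSet W) {ε : ℝ≥0∞} (hε0 : ε ≠ 0) (hε : ε ≠ ∞) :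
    ∫⁻ s, (Measure.pi fun i => cgauss (α * s i) p.Pbar) {u | (s, u) ∉ typicalPairs p α W ε}
      ∂(Measure.pi fun _ : Fin n => cgauss 0 p.Q) ≤
    ε⁻¹ * (Measure.pi fun _ : Fin n => letterLaw p) W := by
  have hT := measurableSet_typicalPairs p α hW ε
  have hs : ∀ s : Fin n → ℂ, (Measure.pi fun i => cgauss (α * s i) p.Pbar)
      {u | (s, u) ∉ typicalPairs p α W ε} ≤
      ε⁻¹ * ∫⁻ x, (Measure.pi fun _ : Fin n => noiseLaw p)
        {ξ | (fun i => ((s i, x i), ξ i)) ∈ W} ∂(Measure.pi fun _ : Fin n => cgauss 0 p.Pbar) := by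
    intro s
    have hm : Measurable fun x : Fin n → ℂ => (Measure.pi fun _ : Fin n => noiseLaw p)
        {ξ | letters α s (fun i => α * s i + x i) ξ ∈ W} :=
      (measurable_noise_letters p α hW).comp (f := fun x : Fin n → ℂ =>
        (s, fun i => α * s i + x i)) (by fun_prop)
    have hTs : MeasurableSet {u | (s, u) ∉ typicalPairs p α W ε} := (measurable_prodMk_left hT).compl
    rw [pi_cgauss_apply p.Pbar _ hTs, mul_comm, ← div_eq_mul_inv]
    have hmono : {x : Fin n → ℂ | (fun i => α * s i + x i) ∈ {u | (s, u) ∉ typicalPairs p α W ε}} ⊆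
        {x : Fin n → ℂ | ε ≤ (Measure.pi fun _ : Fin n => noiseLaw p)
          {ξ | letters α s (fun i => α * s i + x i) ξ ∈ W}} := fun x hx => by
      have hx' : ¬ _ ≤ ε := hx
      exact (not_le.1 hx').le
    refine (measure_mono hmono).trans
      ((meas_ge_le_lintegral_div hm.aemeasurable hε0 hε).trans_eq ?_)
    have hl : ∀ (x : Fin n → ℂ) (ξ : Fin n → ℂ × ℂ), letters α s (fun i => α * s i + x i) ξ =
        fun i => ((s i, x i), ξ i) := fun x ξ => by
      funext i
      rw [letters, add_sub_cancel_left]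
    simp only [hl]
  refine (lintegral_mono hs).trans_eq ?_
  rw [lintegral_const_mul' _ _ (ENNReal.inv_ne_top.2 hε0)]
  congr 1
  have hi : Measurable (W.indicator (1 : (Fin n → (ℂ × ℂ) × (ℂ × ℂ)) → ℝ≥0∞)) :=
    measurable_one.indicator hW
  have hg : Measurable fun c : Fin n → ℂ × ℂ => ∫⁻ ξ, W.indicator
      (1 : (Fin n → (ℂ × ℂ) × (ℂ × ℂ)) → ℝ≥0∞) (fun i => (c i, ξ i))
        ∂(Measure.pi fun _ : Fin n => noiseLaw p) :=
    Measurable.lintegral_prod_right' (f := fun r : (Fin n → ℂ × ℂ) × (Fin n → ℂ × ℂ) =>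
      W.indicator (1 : (Fin n → (ℂ × ℂ) × (ℂ × ℂ)) → ℝ≥0∞) (fun i => (r.1 i, r.2 i))) (by fun_prop)
  rw [← lintegral_indicator_one hW]
  unfold letterLaw
  rw [lintegral_pi_prod_split n _ (noiseLaw p) hi, lintegral_pi_prod_split n _ _ hg]
  refine lintegral_congr fun s => lintegral_congr fun x => ?_
  have hms : MeasurableSet {ξ : Fin n → ℂ × ℂ | (fun i => ((s i, x i), ξ i)) ∈ W} :=
    hW.preimage (by fun_prop)
  rw [← lintegral_indicator_one hms]
  rfl

end Typical

/-! ### Codes of a given block length -/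

/-- The first message below `M` whose bin contains a word that passes the test `A`, or `M`. -/
lemma exists_measurable_decoder {U Y : Type*} [MeasurableSpace U] [MeasurableSpace Y] {B : ℕ}
    (M : ℕ) (c : ℕ → Fin B → U) {A : Set (U × Y)} (hA : MeasurableSet A) :
    ∃ dec : Y → ℕ, Measurable dec ∧ ∀ y, ∀ m < M, (∃ j, (c m j, y) ∈ A) →
      (∀ m' < M, m' ≠ m → ∀ j, (c m' j, y) ∉ A) → dec y = m := by
  classical
  have hex : ∀ y, ∃ m, m = M ∨ ∃ j, (c m j, y) ∈ A := fun y => ⟨M, Or.inl rfl⟩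
  refine ⟨fun y => Nat.find (hex y), measurable_find hex fun m => ?_, fun y m hm h1 h2 => ?_⟩
  · by_cases h : m = M
    · simp [h]
    · simp only [h, false_or]
      rw [Set.ofPred_exists]
      exact MeasurableSet.iUnion fun j => (measurable_prodMk_left hA :
        MeasurableSet ((fun y => (c m j, y)) ⁻¹' A))
  · have hle : Nat.find (hex y) ≤ m := Nat.find_min' (hex y) (Or.inr h1)
    change Nat.find (hex y) = m
    rcases Nat.find_spec (hex y) with h | ⟨j, hj⟩
    · omega
    · by_contra hne
      exact h2 _ (by omega) hne j hj

section Block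

variable {p : Params} {α : ℝ} {n B : ℕ} {Pm ζ : ℝ} {K : ℕ} {h : Fin K → ℂ} {r : Fin K → ℝ}

/-- Among the consequences of typicality are the energy bounds. -/
lemma energies_of_typical {ε : ℝ≥0∞} (hε : ε < 1) {q : (Fin n → ℂ) × (Fin n → ℂ)}
    (hq : q ∈ typicalPairs p α (atypical p α Pm ζ h r n) ε) :
    ∑ i, ‖q.2 i - α * q.1 i‖ ^ 2 ≤ n * Pm ∧
    n * (p.Pbar - ζ) ≤ ∑ i, ‖q.2 i - α * q.1 i‖ ^ 2 ∧
    ∑ i, ‖q.2 i‖ ^ 2 ≤ n * (varU p α + ζ) ∧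
    ∑ i, ‖(q.2 i - α * q.1 i) + q.1 i‖ ^ 2 ≤ n * sumPow p := by
  obtain ⟨ξ, hξ⟩ := exists_noise_of_typical p α hε hq
  simp only [atypical, letters, Set.mem_union, Set.mem_ofPred_eq, not_or, not_lt,
    Finset.sum_neg_distrib, sub_add_cancel] at hξ
  obtain ⟨⟨⟨⟨h1, h2⟩, h3⟩, h4⟩, -⟩ := hξ
  exact ⟨h1, by linarith, h3, h4⟩

lemma tests_of_notMem_atypical {c : Fin n → (ℂ × ℂ) × (ℂ × ℂ)}
    (hc : c ∉ atypical p α Pm ζ h r n) (k : Fin K) :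
    ∑ i, ‖letterOut (h k) (c i) - regCoeff p α (h k) * ((c i).1.2 + α * (c i).1.1)‖ ^ 2 ≤
      n * (resVar p α (h k) + r k) ∧
    n * (varY p (h k) - r k) ≤ ∑ i, ‖letterOut (h k) (c i)‖ ^ 2 := by
  simp only [atypical, Set.mem_union, Set.mem_iUnion, Set.mem_ofPred_eq, not_or, not_lt,
    Finset.sum_neg_distrib, not_exists] at hc
  obtain ⟨-, h5⟩ := hc
  exact ⟨(h5 k).1, by linarith [(h5 k).2]⟩

open Classical in
/-- The encoder of a code with bins: it sends `u - α s` for the first word `u` of the bin that is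
typical with `s`, and zero if there is none. -/
def binEncoder (α : ℝ) (T : Set ((Fin n → ℂ) × (Fin n → ℂ))) (ω : Fin B → Fin n → ℂ)
    (s : Fin n → ℂ) : Fin n → ℂ :=
  if (s, binSelect T 0 ω s) ∈ T then fun i => binSelect T 0 ω s i - α * s i else 0

lemma measurable_binEncoder {T : Set ((Fin n → ℂ) × (Fin n → ℂ))} (hT : MeasurableSet T)
    (ω : Fin B → Fin n → ℂ) : Measurable (binEncoder α T ω) := by
  classical
  have h1 : Measurable fun s => binSelect T 0 ω s :=
    (measurable_binSelect hT 0).comp (f := fun s => (ω, s)) (by fun_prop)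
  unfold binEncoder
  refine Measurable.ite (hT.preimage (f := fun s => (s, binSelect T 0 ω s)) (by fun_prop)) ?_
    measurable_const
  fun_prop

/-- The error probability of a code with bins at any channel gain of a cell. -/
lemma lintegral_error_le (hr : ∀ k, 0 < r k) {ε ε₂ : ℝ≥0∞} (hε₂ : ε₂ < 1)
    {M : Fin K → ℕ} {c : ℕ → Fin B → Fin n → ℂ}
    (k : Fin K) {m : ℕ} (hm : m < M k)
    (hc : ∫⁻ s, (Measure.pi fun _ : Fin n => noiseLaw p)
      {ξ | (∀ j, (s, c m j) ∉ typicalPairs p α (atypical p α Pm ζ h r n) ε₂) ∨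
        ∃ m' < M k, m' ≠ m ∧ ∃ j, (c m' j, fun i => letterOut (h k) (letters α s
          (binSelect (typicalPairs p α (atypical p α Pm ζ h r n) ε₂) 0 (c m) s) ξ i)) ∈
            testSet p α (h k) (confDist p α (h k) (r k)) (confPow p (h k) (r k)) n}
      ∂(Measure.pi fun _ : Fin n => cgauss 0 p.Q) ≤ ε)
    {dec : (Fin n → ℂ) → ℕ}
    (hdec : ∀ y, ∀ m < M k,
      (∃ j, (c m j, y) ∈ testSet p α (h k) (decDist p α (h k) (r k)) (decPow p (h k) (r k)) n) →
      (∀ m' < M k, m' ≠ m → ∀ j, (c m' j, y) ∉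
        testSet p α (h k) (decDist p α (h k) (r k)) (decPow p (h k) (r k)) n) → dec y = m)
    {h' : ℂ} (hh : ‖h' - h k‖ ≤ r k) :
    ∫⁻ s, (Measure.pi fun _ : Fin n => noiseLaw p)
      {ξ | dec (fun i => letterOut h' ((s i, binEncoder α
        (typicalPairs p α (atypical p α Pm ζ h r n) ε₂) (c m) s i), ξ i)) ≠ m}
      ∂(Measure.pi fun _ : Fin n => cgauss 0 p.Q) ≤ ε + ε₂ := by
  set T := typicalPairs p α (atypical p α Pm ζ h r n) ε₂ with hT
  refine le_trans (lintegral_mono (g := fun s => (Measure.pi fun _ : Fin n => noiseLaw p)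
      {ξ | (∀ j, (s, c m j) ∉ T) ∨
        ∃ m' < M k, m' ≠ m ∧ ∃ j, (c m' j, fun i => letterOut (h k) (letters α s
          (binSelect T 0 (c m) s) ξ i)) ∈
            testSet p α (h k) (confDist p α (h k) (r k)) (confPow p (h k) (r k)) n} + ε₂)
      fun s => ?_) ?_
  · by_cases hs : ∃ j, (s, c m j) ∈ T
    swap
    · push Not at hs
      simp only [hs, not_false_eq_true, implies_true, true_or]
      refine le_trans ?_ le_self_add
      exact measure_mono fun _ _ => trivial
    obtain ⟨hsel, hu'⟩ := binSelect_spec (u₀ := 0) hs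
    set u := binSelect T 0 (c m) s
    obtain ⟨-, -, -, hC⟩ := energies_of_typical hε₂ hsel
    have henc : binEncoder α T (c m) s = fun i => u i - α * s i := by
      unfold binEncoder; rw [if_pos hsel]
    -- Outside the confusion event at the centre and the atypical event, whose conditional
    -- probability is at most `ε₂` by the choice of `u`, decoding is correct at the gain `h'`.
    refine le_trans (measure_mono (t := {ξ | _ ∨ _} ∪ {ξ | letters α s u ξ ∈
      atypical p α Pm ζ h r n}) fun ξ hξ => ?_) ((measure_union_le _ _).trans
        (add_le_add le_rfl hsel))
    by_contra hnot
    simp only [Set.mem_union, Set.mem_ofPred_eq, not_or] at hnot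
    obtain ⟨⟨-, hconf⟩, hty⟩ := hnot
    refine hξ ?_
    have hy : (fun i => letterOut h' ((s i, binEncoder α T (c m) s i), ξ i)) =
        fun i => letterOut h' (letters α s u ξ i) := by
      rw [henc]; rfl
    rw [hy]
    refine hdec _ m hm ?_ fun m' hm' hne j hj => hconf ⟨m', hm', hne, j, ?_⟩
    · obtain ⟨j, hj⟩ := hu'
      have h1 := tests_of_notMem_atypical hty k
      have := mem_testSet_of_typical (hr k) hh (c := letters α s u ξ) hC h1.1 h1.2
      simp only [letters, sub_add_cancel] at this
      exact ⟨j, by rw [hj]; exact this⟩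
    · exact mem_testSet_conf (hr k) hh (c := letters α s u ξ) hC hj
  · rw [lintegral_add_right _ measurable_const]
    refine add_le_add hc ?_
    simp

end Block

/-! ### Asymptotics of the random code -/

/-- The margin `4 * η` in the rate is spent as follows: `2 * η` on oversized bins, less than `η` on
the cell's test thresholds, and `η` on exponential decay of the confusion probability. -/
lemma exists_block_code {p : Params} (hσh : 0 < p.σh2) (hσE : 0 < p.σE2) (hσZ : 0 < p.σZ2)
    (hQ : 0 < p.Q) (hP : 0 < p.Pbar) (α : ℝ) {Pm : ℝ} (hPm : p.Pbar < Pm) {K : ℕ}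
    {h : Fin K → ℂ} {r ρ : Fin K → ℝ} {η : ℝ} (hη : 0 < η) (hr : ∀ k, 0 < r k)
    (hcell : ∀ k, confDist p α (h k) (r k) / resVar p α (h k) -
      confPow p (h k) (r k) / varY p (h k) < η)
    (hρ0 : ∀ k, 0 ≤ ρ k) (hρ : ∀ k, ρ k ≤ natRate p α (h k) - 4 * η) {ε : ℝ} (hε0 : 0 < ε)
    (hε1 : ε < 1) :
    ∀ᶠ n : ℕ in Filter.atTop, ∃ enc : ℕ → (Fin n → ℂ) → (Fin n → ℂ),
      (∀ m, Measurable (enc m)) ∧ (∀ m s, ∑ i, ‖enc m s i‖ ^ 2 ≤ n * Pm) ∧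
      ∀ k, ∃ dec : (Fin n → ℂ) → ℕ, Measurable dec ∧ ∀ m < ⌈Real.exp (n * ρ k)⌉₊,
        ∀ h', ‖h' - h k‖ ≤ r k → ∫⁻ s, (Measure.pi fun _ : Fin n => noiseLaw p)
          {ξ | dec (fun i => letterOut h' ((s i, enc m s i), ξ i)) ≠ m}
          ∂(Measure.pi fun _ : Fin n => cgauss 0 p.Q) ≤ ENNReal.ofReal ε := by
  have hU := varU_pos hQ hP α
  -- With this tolerance the covering exponent loses at most `η`, since `varU` is at least `Pbar`.
  set ζ : ℝ := η * p.Pbar / 2 with hζ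
  have hζ0 : 0 < ζ := by positivity
  set I := Real.log (varU p α / p.Pbar) with hI
  set ε₂ : ℝ≥0∞ := ENNReal.ofReal (ε / 2) with hε₂
  have hε₂0 : ε₂ ≠ 0 := by simpa [hε₂] using hε0
  have hε₂t : ε₂ ≠ ∞ := ENNReal.ofReal_ne_top
  have hε₂1 : ε₂ < 1 := by
    rw [hε₂, ← ENNReal.ofReal_one]
    exact (ENNReal.ofReal_lt_ofReal_iff one_pos).2 (by linarith)
  set q : ℕ → ℝ≥0∞ := fun n => ε₂⁻¹ * (Measure.pi fun _ : Fin n => letterLaw p)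
    (atypical p α Pm ζ h r n) with hq
  set ε₁ : ℕ → ℝ≥0∞ := fun n => (2 * q n + ENNReal.ofReal (Real.exp (-(Real.exp (n * η) / 2)))) +
    ENNReal.ofReal (8 * Real.exp (-(n * η))) with hε₁
  have hq0 : Filter.Tendsto q Filter.atTop (nhds 0) := by
    have := ENNReal.Tendsto.const_mul (a := ε₂⁻¹)
      (rare_atypical hσh hσE hσZ hQ hP α hPm hζ0 h hr) (Or.inr (ENNReal.inv_ne_top.2 hε₂0))
    simpa using this
  have hnη : Filter.Tendsto (fun n : ℕ => (n : ℝ) * η) Filter.atTop Filter.atTop :=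
    tendsto_natCast_atTop_atTop.atTop_mul_const hη
  have hε₁0 : Filter.Tendsto ε₁ Filter.atTop (nhds 0) := by
    have t1 : Filter.Tendsto (fun n : ℕ => Real.exp (-(Real.exp (n * η) / 2))) Filter.atTop
        (nhds 0) := Real.tendsto_exp_neg_atTop_nhds_zero.comp
          ((Real.tendsto_exp_atTop.comp hnη).atTop_div_const two_pos)
    have t2 : Filter.Tendsto (fun n : ℕ => 8 * Real.exp (-(n * η))) Filter.atTop (nhds 0) := by
      simpa using (Real.tendsto_exp_neg_atTop_nhds_zero.comp hnη).const_mul 8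
    have t3 := ENNReal.Tendsto.const_mul (a := 2) hq0 (Or.inr (by simp))
    have := (t3.add (ENNReal.tendsto_ofReal t1)).add (ENNReal.tendsto_ofReal t2)
    simpa only [mul_zero, ENNReal.ofReal_zero, add_zero] using this
  have hev : ∀ᶠ n in Filter.atTop, 4 * (K : ℝ≥0∞) ^ 2 * ε₁ n < ε₂ := by
    have := ENNReal.Tendsto.const_mul (a := 4 * (K : ℝ≥0∞) ^ 2) hε₁0
      (Or.inr (by finiteness))
    rw [mul_zero] at this
    exact this.eventually_lt_const hε₂0.bot_lt
  filter_upwards [hev] with n hn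
  set W := atypical p α Pm ζ h r n
  have hW : MeasurableSet W := measurableSet_atypical p α Pm ζ h r n
  set T := typicalPairs p α W ε₂
  have hT : MeasurableSet T := measurableSet_typicalPairs p α hW ε₂
  -- Of the excess `2 * η` over `I(U;S)`, at most one `η` is lost in the change of measure; the
  -- other makes the covering failure doubly exponentially small.
  set B := ⌈Real.exp (n * (I + 2 * η))⌉₊ with hB
  have hceil : ∀ x : ℝ, 0 ≤ x → (⌈Real.exp x⌉₊ : ℝ) ≤ 2 * Real.exp x := fun x hx => by
    have h1 := (Nat.ceil_lt_add_one (Real.exp_pos x).le).le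
    have h2 := Real.one_le_exp hx
    linarith
  have hI0 : 0 ≤ I := Real.log_nonneg (varU_div_ge_one hQ hP α)
  have hratio : ζ / p.Pbar + ζ / varU p α ≤ η := by
    have h1 : ζ / p.Pbar = η / 2 := by rw [hζ]; field_simp
    have h2 : ζ / varU p α ≤ ζ / p.Pbar := div_le_div_of_nonneg_left hζ0.le hP
      ((one_le_div hP).1 (varU_div_ge_one hQ hP α))
    linarith
  have hcover := lintegral_binFail_le (B := B) (Measure.pi fun _ : Fin n => cgauss 0 p.Q)
    (Measure.pi fun _ : Fin n => cgauss 0 (varU p α)) hT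
    (fun s => Measure.pi fun i => cgauss (α * s i) p.Pbar)
    (c := Real.exp (-(n * (I + ζ / p.Pbar + ζ / varU p α)))) (Real.exp_pos _).le
    (fun s => pi_cgauss_shift_le hU hP _ (measurable_prodMk_left hT)
      (fun u hu => (energies_of_typical hε₂1 (q := (s, u)) hu).2.1)
      (fun u hu => (energies_of_typical hε₂1 (q := (s, u)) hu).2.2.1))
    (lintegral_not_typical_le p α hW hε₂0 hε₂t) (measurable_pi_cgauss_shift α p.Pbar hT)
  have hcover' : ∫⁻ ω, (Measure.pi fun _ : Fin n => cgauss 0 p.Q) {s | ∀ j, (s, ω j) ∉ T}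
      ∂(Measure.pi fun _ : Fin B => Measure.pi fun _ : Fin n => cgauss 0 (varU p α)) ≤ ε₁ n := by
    refine hcover.trans (le_trans (add_le_add le_rfl (ENNReal.ofReal_le_ofReal ?_)) le_self_add)
    refine Real.exp_le_exp.2 (neg_le_neg (div_le_div_of_nonneg_right ?_ two_pos.le))
    refine le_trans ?_ (mul_le_mul_of_nonneg_left (Nat.le_ceil _) (Real.exp_pos _).le)
    rw [← Real.exp_add]
    refine Real.exp_le_exp.2 ?_
    have := mul_le_mul_of_nonneg_left hratio (Nat.cast_nonneg (α := ℝ) n)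
    nlinarith
  have hpack : ∀ k, 2 * ((⌈Real.exp (n * ρ k)⌉₊ : ℕ) : ℝ≥0∞) * (B * ENNReal.ofReal (Real.exp
      (n * (confDist p α (h k) (r k) / resVar p α (h k) - Real.log (varY p (h k) /
        resVar p α (h k)) - confPow p (h k) (r k) / varY p (h k))))) ≤ ε₁ n := fun k => by
    refine le_trans ?_ le_add_self
    have e1 := hceil (n * ρ k) (mul_nonneg (Nat.cast_nonneg _) (hρ0 k))
    have e2 := hceil (n * (I + 2 * η)) (by positivity)
    rw [← ENNReal.ofReal_natCast, ← ENNReal.ofReal_natCast, ← ENNReal.ofReal_ofNat 2,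
      ← ENNReal.ofReal_mul (by positivity), ← ENNReal.ofReal_mul (by positivity),
      ← ENNReal.ofReal_mul (by positivity)]
    refine ENNReal.ofReal_le_ofReal ?_
    calc _ ≤ 2 * (2 * Real.exp (n * ρ k)) * (2 * Real.exp (n * (I + 2 * η)) * Real.exp
          (n * (confDist p α (h k) (r k) / resVar p α (h k) - Real.log (varY p (h k) /
            resVar p α (h k)) - confPow p (h k) (r k) / varY p (h k)))) := by gcongr
      _ = 8 * Real.exp (n * ρ k + n * (I + 2 * η) +
          (n * (confDist p α (h k) (r k) / resVar p α (h k) - Real.log (varY p (h k) /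
            resVar p α (h k)) - confPow p (h k) (r k) / varY p (h k)))) := by
          rw [Real.exp_add, Real.exp_add]; ring
      _ ≤ 8 * Real.exp (-(n * η)) := by
          refine mul_le_mul_of_nonneg_left (Real.exp_le_exp.2 ?_) (by norm_num)
          have hk := hρ k
          rw [natRate] at hk
          rw [← mul_add, ← mul_add, ← mul_neg]
          refine mul_le_mul_of_nonneg_left ?_ (Nat.cast_nonneg n)
          linarith [hcell k]
  obtain ⟨c, hc⟩ := exists_binning_code (B := B) (Measure.pi fun _ : Fin n => cgauss 0 p.Q)
    (Measure.pi fun _ : Fin n => cgauss 0 (varU p α)) (Measure.pi fun _ : Fin n => noiseLaw p)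
    (fun k => ⌈Real.exp (n * ρ k)⌉₊) (fun k => Nat.ceil_pos.2 (Real.exp_pos _)) hT 0
    (out := fun k q => fun i => letterOut (h k) (letters α q.1 q.2.1 q.2.2 i))
    (fun k => by fun_prop)
    (A := fun k => testSet p α (h k) (confDist p α (h k) (r k)) (confPow p (h k) (r k)) n)
    (fun k => measurableSet_testSet p α _ _ _ n) hε₂0 hε₂t hcover'
    (fun k y => by
      have := pi_cgauss_packing_le hU (resVar_pos hσh hσE hσZ hQ hP α (h k))
        (regCoeff p α (h k)) (confDist p α (h k) (r k)) (confPow p (h k) (r k)) y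
      rw [sq_norm_regCoeff_mul_add hQ hP α (h k)] at this
      exact this) hpack hn.le
  refine ⟨fun m => binEncoder α T (c m), fun m => measurable_binEncoder hT (c m), fun m s => ?_,
    fun k => ?_⟩
  · change ∑ i, ‖binEncoder α T (c m) s i‖ ^ 2 ≤ n * Pm
    unfold binEncoder
    split_ifs with hs
    · exact (energies_of_typical hε₂1 hs).1
    · simp only [Pi.zero_apply, norm_zero, ne_eq, OfNat.ofNat_ne_zero, not_false_eq_true, zero_pow,
        Finset.sum_const_zero]
      have : 0 < Pm := hP.trans hPm
      positivity
  · obtain ⟨dec, hdec, hd⟩ := exists_measurable_decoder ⌈Real.exp (n * ρ k)⌉₊ c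
      (measurableSet_testSet p α (h k) (decDist p α (h k) (r k)) (decPow p (h k) (r k)) n)
    refine ⟨dec, hdec, fun m hm h' hh => ?_⟩
    have := lintegral_error_le (M := fun k => ⌈Real.exp (n * ρ k)⌉₊) hr hε₂1 k hm
      (hc k m hm) hd hh
    refine this.trans_eq ?_
    rw [hε₂, ← ENNReal.ofReal_add (by positivity) (by positivity), add_halves]

/-! ### The operational mean capacity -/

/-- Fading and additive noise are rewritten as fixed laws shifted by the mean gain and the signal,
so that the error becomes an event of the noise pairs, whose law depends neither on the codeword nor
on the estimate. -/
lemma errorProb_eq (q : Params) {n : ℕ} {f : (Fin n → ℂ) → (Fin n → ℂ)}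
    {dec : (Fin n → ℂ) → ℕ} (hdec : Measurable dec) (m : ℕ) {hhat : ℂ}
    (hpost : posterior q hhat = cgauss ((dlt q : ℝ) * hhat) (dlt q * q.σE2)) :
    errorProb q f dec m hhat = ∫⁻ s, (Measure.pi fun _ : Fin n => noiseLaw q)
      {ξ | dec (fun i => letterOut ((dlt q : ℝ) * hhat) ((s i, f s i), ξ i)) ≠ m}
      ∂(Measure.pi fun _ : Fin n => cgauss 0 q.Q) := by
  unfold errorProb stateLaw
  refine lintegral_congr fun s => ?_
  have hE : MeasurableSet {y : Fin n → ℂ | dec y ≠ m} := hdec (measurableSet_singleton m).compl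
  have h1 : ∀ θ : Fin n → ℂ, (Measure.pi fun i => channel q ((f s i, s i), θ i)) {y | dec y ≠ m} =
      (Measure.pi fun _ : Fin n => cgauss 0 q.σZ2)
        {z | dec (fun i => θ i * (f s i + s i) + z i) ≠ m} := fun θ => by
    have h : (Measure.pi fun i => channel q ((f s i, s i), θ i)) =
        (Measure.pi fun _ : Fin n => cgauss 0 q.σZ2).map
          (fun z i => θ i * (f s i + s i) + z i) := by
      rw [Measure.pi_map_pi (f := fun i z => θ i * (f s i + s i) + z) (fun i => by fun_prop)]
      congr 1
      funext i
      exact channel_eq_map q _ _ _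
    rw [h, Measure.map_apply (by fun_prop) hE]
    rfl
  have h2 : (Measure.pi fun _ : Fin n => posterior q hhat) =
      (Measure.pi fun _ : Fin n => cgauss 0 (dlt q * q.σE2)).map
        (fun w i => (dlt q : ℝ) * hhat + w i) := by
    rw [Measure.pi_map_pi (f := fun _ w => (dlt q : ℝ) * hhat + w) (fun i => by fun_prop)]
    congr 1
    funext i
    rw [hpost]
    exact cgauss_eq_map _ _
  have hm1 : MeasurableSet {r : (Fin n → ℂ) × (Fin n → ℂ) |
      dec (fun i => r.1 i * (f s i + s i) + r.2 i) ≠ m} :=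
    hE.preimage (f := fun r : (Fin n → ℂ) × (Fin n → ℂ) =>
      fun i => r.1 i * (f s i + s i) + r.2 i) (by fun_prop)
  have hm2 : MeasurableSet {ξ : Fin n → ℂ × ℂ |
      dec (fun i => letterOut ((dlt q : ℝ) * hhat) ((s i, f s i), ξ i)) ≠ m} :=
    hE.preimage (f := fun ξ : Fin n → ℂ × ℂ => fun i =>
      letterOut ((dlt q : ℝ) * hhat) ((s i, f s i), ξ i)) (by fun_prop)
  have hmm : Measurable fun θ : Fin n → ℂ => (Measure.pi fun _ : Fin n => cgauss 0 q.σZ2)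
      {z | dec (fun i => θ i * (f s i + s i) + z i) ≠ m} := measurable_measure_prodMk_left hm1
  simp_rw [h1]
  rw [h2, lintegral_map hmm (by fun_prop),
    ← lintegral_indicator_one hm2]
  unfold noiseLaw
  rw [lintegral_pi_prod_split n _ _ (measurable_one.indicator hm2)]
  refine lintegral_congr fun w => ?_
  have hm3 : MeasurableSet {z : Fin n → ℂ |
      dec (fun i => ((dlt q : ℝ) * hhat + w i) * (f s i + s i) + z i) ≠ m} :=
    hE.preimage (f := fun z : Fin n → ℂ => fun i =>
      ((dlt q : ℝ) * hhat + w i) * (f s i + s i) + z i) (by fun_prop)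
  rw [← lintegral_indicator_one hm3]
  rfl

lemma continuous_natRate {p : Params} (hσh : 0 < p.σh2) (hσE : 0 < p.σE2) (hσZ : 0 < p.σZ2)
    (hQ : 0 < p.Q) (hP : 0 < p.Pbar) (α : ℝ) : Continuous (natRate p α) := by
  have hR := fun h => (resVar_pos hσh hσE hσZ hQ hP α h).ne'
  have h1 := fun h => (zero_lt_one.trans_le (varY_div_resVar_ge_one hσh hσE hσZ hQ hP α h)).ne'
  unfold natRate
  refine Continuous.sub (Continuous.log (Continuous.div ?_ ?_ hR) h1) continuous_const
  · unfold varY; fun_prop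
  · unfold resVar; fun_prop

/-- This removes the back-off in power. Varying the design power leaves `δ` unchanged but affects
`NN`, `varU` and both variances of `Y`. -/
lemma tendsto_natRate_power {q : Params} (hσh : 0 < q.σh2) (hσE : 0 < q.σE2) (hσZ : 0 < q.σZ2)
    (hQ : 0 < q.Q) (hP : 0 < q.Pbar) (α : ℝ) (g : ℂ) :
    Filter.Tendsto (fun P => natRate { q with Pbar := P } α g) (nhds q.Pbar)
      (nhds (natRate q α g)) := by
  have hU : varU q α ≠ 0 := (varU_pos hQ hP α).ne'
  have hR : resVar q α g ≠ 0 := (resVar_pos hσh hσE hσZ hQ hP α g).ne'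
  have h1 : varY q g / resVar q α g ≠ 0 :=
    (zero_lt_one.trans_le (varY_div_resVar_ge_one hσh hσE hσZ hQ hP α g)).ne'
  have h2 : varU q α / q.Pbar ≠ 0 := (zero_lt_one.trans_le (varU_div_ge_one hQ hP α)).ne'
  have cU : ContinuousAt (fun P => varU { q with Pbar := P } α) q.Pbar := by
    unfold varU; fun_prop
  have cN : ContinuousAt (fun P => NN { q with Pbar := P }) q.Pbar := by
    change ContinuousAt (fun P => q.σZ2 + dlt q * q.σE2 * (P + q.Q)) q.Pbar
    fun_prop
  have cY : ContinuousAt (fun P => varY { q with Pbar := P } g) q.Pbar := by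
    unfold varY; fun_prop
  have cR : ContinuousAt (fun P => resVar { q with Pbar := P } α g) q.Pbar := by
    unfold resVar
    exact ((continuousAt_const).mul (((continuousAt_id.mul continuousAt_const)).div cU hU)).add cN
  exact ((cY.div cR hR).log h1).sub ((cU.div continuousAt_id hP.ne').log h2)

lemma exists_encoders {q : Params} (hσh : 0 < q.σh2) (hσE : 0 < q.σE2) (hσZ : 0 < q.σZ2)
    (hQ : 0 < q.Q) (α : ℝ) {P : ℝ} (hP : 0 < P) (hPq : P < q.Pbar) {η : ℝ} (hη : 0 < η) (L : ℝ)
    {ε : ℝ} (hε0 : 0 < ε) (hε1 : ε < 1) :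
    ∃ Φ : Encoders q, ∀ hhat ∈ Metric.closedBall (0 : ℂ) L,
      posterior q hhat = cgauss ((dlt q : ℝ) * hhat) (dlt q * q.σE2) →
      ENNReal.ofReal ((natRate { q with Pbar := P } α ((dlt q : ℝ) * hhat) - 5 * η) / Real.log 2) ≤
        epsCapacity q Φ ε hhat := by
  set p : Params := { q with Pbar := P } with hp
  have hl2 := Real.log_pos one_lt_two
  have hcont := continuous_natRate (p := p) hσh hσE hσZ hQ hP α
  have hrad : ∀ g : ℂ, ∃ r, 0 < r ∧ (confDist p α g r / resVar p α g -
      confPow p g r / varY p g < η) := fun g =>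
    exists_cell_radius (p := p) hσh hσE hσZ hQ hP g hη
  choose rad hrad0 hrad using hrad
  have hnhds : ∀ g : ℂ, {g' | ‖g' - g‖ ≤ rad g ∧ natRate p α g' < natRate p α g + η} ∈ nhds g := by
    intro g
    filter_upwards [Metric.closedBall_mem_nhds g (hrad0 g),
      hcont.continuousAt.eventually_lt_const (lt_add_of_pos_right (natRate p α g) hη)]
      with g' h1 h2
    exact ⟨by rwa [mem_closedBall_iff_norm] at h1, h2⟩
  obtain ⟨t, -, ht⟩ := (isCompact_closedBall (0 : ℂ) (dlt q * L)).elim_nhds_subcover _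
    (fun g _ => hnhds g)
  -- A discarded cell has rate below `4 * η` at its centre, hence below `5 * η` throughout, so the
  -- claimed lower bound is zero there.
  set t' := t.filter fun g => 4 * η ≤ natRate p α g with ht'
  set K := t'.card
  set h : Fin K → ℂ := fun k => t'.equivFin.symm k with hh
  have hmem : ∀ k, 4 * η ≤ natRate p α (h k) := fun k =>
    (Finset.mem_filter.1 (t'.equivFin.symm k).2).2
  set ρ : Fin K → ℝ := fun k => natRate p α (h k) - 4 * η with hρ
  have hblock := exists_block_code (p := p) hσh hσE hσZ hQ hP α hPq (h := h)
    (r := fun k => rad (h k)) (ρ := ρ) hη (fun k => hrad0 _) (fun k => hrad _)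
    (fun k => sub_nonneg.2 (hmem k)) (fun k => le_rfl) hε0 hε1
  set good : (n : ℕ) → (ℕ → (Fin n → ℂ) → (Fin n → ℂ)) → Prop := fun n enc =>
    ∀ k, ∃ dec : (Fin n → ℂ) → ℕ, Measurable dec ∧ ∀ m < ⌈Real.exp (n * ρ k)⌉₊,
        ∀ h', ‖h' - h k‖ ≤ rad (h k) → ∫⁻ s, (Measure.pi fun _ : Fin n => noiseLaw p)
          {ξ | dec (fun i => letterOut h' ((s i, enc m s i), ξ i)) ≠ m}
          ∂(Measure.pi fun _ : Fin n => cgauss 0 p.Q) ≤ ENNReal.ofReal ε with hgood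
  -- An encoder is required at every block length: a good one is taken whenever it exists, which is
  -- the case for all large `n`, and the zero encoder otherwise.
  have hex : ∀ n : ℕ, ∃ enc : ℕ → (Fin n → ℂ) → (Fin n → ℂ), (∀ m, Measurable (enc m)) ∧
      (∀ m s, ∑ i, ‖enc m s i‖ ^ 2 ≤ n * q.Pbar) ∧ ((∃ enc' : ℕ → (Fin n → ℂ) → (Fin n → ℂ),
      (∀ m, Measurable (enc' m)) ∧ (∀ m s, ∑ i, ‖enc' m s i‖ ^ 2 ≤ n * q.Pbar) ∧ good n enc') →
        good n enc) := by
    intro n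
    by_cases hn : ∃ enc' : ℕ → (Fin n → ℂ) → (Fin n → ℂ),
      (∀ m, Measurable (enc' m)) ∧ (∀ m s, ∑ i, ‖enc' m s i‖ ^ 2 ≤ n * q.Pbar) ∧ good n enc'
    · obtain ⟨enc, h1, h2, h3⟩ := hn
      exact ⟨enc, h1, h2, fun _ => h3⟩
    · refine ⟨fun _ _ => 0, fun m => measurable_const, fun m s => ?_, fun h => absurd h hn⟩
      simpa using mul_nonneg (Nat.cast_nonneg n) (hP.trans hPq).le
  choose enc henc hpow hgoodenc using hex
  set Φ : Encoders q :=
    { enc := enc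
      measurable_enc := henc
      power_le := fun n m => by
        refine (lintegral_mono (g := fun _ => (n : ℝ≥0∞) * ENNReal.ofReal q.Pbar)
          fun s => ?_).trans (by simp)
        have h1 : ∀ z : ℂ, ‖z‖ₑ ^ 2 = ENNReal.ofReal (‖z‖ ^ 2) := fun z => by
          rw [ENNReal.ofReal_pow (norm_nonneg _), ofReal_norm]
        simp only [h1]
        rw [← ENNReal.ofReal_sum_of_nonneg fun i _ => by positivity, ← ENNReal.ofReal_natCast,
          ← ENNReal.ofReal_mul (by positivity)]
        exact ENNReal.ofReal_le_ofReal (hpow n m s) } with hΦ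
  refine ⟨Φ, fun hhat hL hpost => ?_⟩
  set g : ℂ := (dlt q : ℝ) * hhat with hg
  have hd := dlt_pos hσh hσE
  have hgball : g ∈ Metric.closedBall (0 : ℂ) (dlt q * L) := by
    rw [mem_closedBall_zero_iff] at hL ⊢
    rw [hg, norm_mul, Complex.norm_real, Real.norm_of_nonneg hd.le]
    gcongr
  obtain ⟨g₀, hg₀t, hg₀⟩ := Set.mem_iUnion₂.1 (ht hgball)
  obtain ⟨hg₁, hg₂⟩ := hg₀
  by_cases hlow : 4 * η ≤ natRate p α g₀
  swap
  · rw [ENNReal.ofReal_of_nonpos]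
    · exact zero_le
    · exact div_nonpos_of_nonpos_of_nonneg (by linarith) hl2.le
  obtain ⟨k, hk⟩ : ∃ k, h k = g₀ :=
    ⟨t'.equivFin ⟨g₀, Finset.mem_filter.2 ⟨hg₀t, hlow⟩⟩, by simp [hh]⟩
  have hρ0 : 0 ≤ ρ k := sub_nonneg.2 (hmem k)
  have hR : EpsAchievable q Φ ε hhat (ρ k / Real.log 2).toNNReal := by
    intro η' hη'
    filter_upwards [hblock] with n hn
    obtain ⟨dec, hdec, herr⟩ := hgoodenc n hn k
    refine ⟨⌈Real.exp (n * ρ k)⌉₊, dec, ?_, hdec, fun m hm => ?_⟩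
    · refine le_trans ?_ (Nat.le_ceil _)
      rw [Real.coe_toNNReal _ (by positivity), Real.rpow_def_of_pos two_pos]
      refine Real.exp_le_exp.2 ?_
      have e : Real.log 2 * (n * (ρ k / Real.log 2 - η')) =
          n * ρ k - Real.log 2 * (n * η') := by field_simp
      rw [e]
      have : 0 ≤ Real.log 2 * (n * η') := by positivity
      linarith
    · rw [errorProb_eq q hdec m hpost]
      exact herr m hm _ (by rw [hk]; exact hg₁)
  refine le_trans ?_ (le_iSup₂_of_le _ hR le_rfl)
  change _ ≤ ENNReal.ofReal (ρ k / Real.log 2)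
  refine ENNReal.ofReal_le_ofReal (div_le_div_of_nonneg_right ?_ hl2.le)
  rw [hρ]
  simp only [hk]
  linarith

/-! ### Limit in power, tolerance and range of gains by Fatou's lemma. -/

section Capacity

variable {q : Params} (hσh : 0 < q.σh2) (hσE : 0 < q.σE2) (hσZ : 0 < q.σZ2) (hQ : 0 < q.Q)
  (hP : 0 < q.Pbar)
include hσh hσE hσZ hQ hP

lemma lintegral_rateIntegrand_le_meanCapacity (α : ℝ) :
    ∫⁻ hhat, ENNReal.ofReal (rateIntegrand q α hhat) ∂(estimateLaw q) ≤ meanCapacity q := by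
  refine le_iInf₂ fun ε hε => ?_
  set S := ⨆ Φ : Encoders q, ∫⁻ hhat, epsCapacity q Φ ε hhat ∂(estimateLaw q)
  -- The factor one half keeps the design power positive already at `j = 0`.
  set P : ℕ → ℝ := fun j => q.Pbar - q.Pbar * (1 / ((j : ℝ) + 1)) / 2 with hPdef
  have hinv : ∀ j : ℕ, 0 < 1 / ((j : ℝ) + 1) ∧ 1 / ((j : ℝ) + 1) ≤ 1 := fun j =>
    ⟨by positivity, by rw [div_le_one (by positivity)]; linarith [Nat.cast_nonneg (α := ℝ) j]⟩
  have hP0 : ∀ j, 0 < P j := fun j => by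
    have := hinv j
    simp only [hPdef]
    nlinarith
  have hPlt : ∀ j, P j < q.Pbar := fun j => by
    have := mul_pos hP (hinv j).1
    simp only [hPdef]
    linarith
  have htinv : Filter.Tendsto (fun j : ℕ => 1 / ((j : ℝ) + 1)) Filter.atTop (nhds 0) :=
    tendsto_one_div_add_atTop_nhds_zero_nat
  have hPt : Filter.Tendsto P Filter.atTop (nhds q.Pbar) := by
    have := ((htinv.const_mul q.Pbar).div_const 2).const_sub q.Pbar
    simpa [hPdef] using this
  set f : ℕ → ℂ → ℝ≥0∞ := fun j => (Metric.closedBall (0 : ℂ) j).indicator fun hhat =>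
    ENNReal.ofReal ((natRate { q with Pbar := P j } α ((dlt q : ℝ) * hhat) -
      5 * (1 / ((j : ℝ) + 1))) / Real.log 2) with hf
  have hfm : ∀ j, Measurable (f j) := fun j => by
    have := (continuous_natRate (p := { q with Pbar := P j }) hσh hσE hσZ hQ (hP0 j) α).measurable
    exact Measurable.indicator (by fun_prop) measurableSet_closedBall
  have hfS : ∀ j, ∫⁻ hhat, f j hhat ∂(estimateLaw q) ≤ S := fun j => by
    obtain ⟨Φ, hΦ⟩ := exists_encoders hσh hσE hσZ hQ α (hP0 j) (hPlt j) (hinv j).1 j hε.1 hε.2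
    refine le_trans (lintegral_mono_ae ?_) (le_iSup (fun Φ : Encoders q =>
      ∫⁻ hhat, epsCapacity q Φ ε hhat ∂(estimateLaw q)) Φ)
    filter_upwards [posterior_ae_eq hσh hσE] with hhat hpost
    simp only [hf]
    by_cases hL : hhat ∈ Metric.closedBall (0 : ℂ) j
    · rw [Set.indicator_of_mem hL]
      exact hΦ hhat hL hpost
    · rw [Set.indicator_of_notMem hL]
      exact zero_le
  -- Each estimate lies in all sufficiently large balls, so the bounds `f j` converge there to the
  -- positive part of the rate. Their integrals are all at most `S`, as Fatou's lemma needs,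
  -- although the encoders vary with `j`.
  have hlim : ∀ᵐ hhat ∂(estimateLaw q), ENNReal.ofReal (rateIntegrand q α hhat) =
      Filter.liminf (fun j => f j hhat) Filter.atTop := by
    filter_upwards [ae_gain_ne_zero hσh hσE] with hhat h0
    rw [rateIntegrand_eq_natRate hσh hσE hσZ hQ hP α h0]
    refine (Filter.Tendsto.liminf_eq ?_).symm
    have h1 := (tendsto_natRate_power hσh hσE hσZ hQ hP α ((dlt q : ℝ) * hhat)).comp hPt
    have h2 := ENNReal.tendsto_ofReal ((h1.sub (htinv.const_mul 5)).div_const (Real.log 2))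
    rw [mul_zero, sub_zero] at h2
    refine h2.congr' ?_
    filter_upwards [Filter.eventually_ge_atTop ⌈‖hhat‖⌉₊] with j hj
    rw [hf]
    simp only
    rw [Set.indicator_of_mem]
    · rfl
    · rw [mem_closedBall_zero_iff]
      exact (Nat.le_ceil _).trans (by exact_mod_cast hj)
  rw [lintegral_congr_ae hlim]
  refine (lintegral_liminf_le hfm).trans ?_
  exact (Filter.liminf_le_liminf (Filter.Eventually.of_forall hfS)).trans_eq
    (Filter.liminf_const S)

/-- The rate may be negative at some estimates, whereas capacities are not; the comparison passes
through its positive part. -/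
lemma integral_rateIntegrand_le_meanCapacity (α : ℝ) :
    ((∫ hhat, rateIntegrand q α hhat ∂(estimateLaw q) : ℝ) : EReal) ≤
      ((meanCapacity q : ℝ≥0∞) : EReal) := by
  have hI := integrable_rateIntegrand hσh hσE hσZ hQ hP α
  have h0 : 0 ≤ ∫ hhat, max (rateIntegrand q α hhat) 0 ∂(estimateLaw q) :=
    integral_nonneg fun _ => le_max_right _ _
  calc ((∫ hhat, rateIntegrand q α hhat ∂(estimateLaw q) : ℝ) : EReal)
      ≤ ((∫ hhat, max (rateIntegrand q α hhat) 0 ∂(estimateLaw q) : ℝ) : EReal) :=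
        EReal.coe_le_coe_iff.2 (integral_mono hI hI.pos_part fun _ => le_max_left _ _)
    _ = ((ENNReal.ofReal (∫ hhat, max (rateIntegrand q α hhat) 0 ∂(estimateLaw q)) : ℝ≥0∞) :
        EReal) := by rw [EReal.coe_ennreal_ofReal, max_eq_left h0]
    _ ≤ ((meanCapacity q : ℝ≥0∞) : EReal) := by
        rw [EReal.coe_ennreal_le_coe_ennreal_iff, ofReal_integral_eq_lintegral_ofReal hI.pos_part
          (Filter.Eventually.of_forall fun _ => le_max_right _ _)]
        refine le_trans (lintegral_mono fun hhat => ?_)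
          (lintegral_rateIntegrand_le_meanCapacity hσh hσE hσZ hQ hP α)
        simp

end Capacity

end FadingCosta

end

theorem mainTheorem3 (p : FadingCosta.Params) (hσh : 0 < p.σh2) (hσE : 0 < p.σE2)
    (hσZ : 0 < p.σZ2) (hQ : 0 < p.Q) (hP : 0 < p.Pbar) (α : ℝ) (hα0 : 0 ≤ α) (hα1 : α ≤ 1) :
    (∀ᵐ hhat ∂(FadingCosta.estimateLaw p),
      FadingCosta.infoUY p (FadingCosta.dpcInput p α) (FadingCosta.gaussComposite p hhat) =
          ENNReal.ofReal (Real.logb 2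
            ((FadingCosta.PP p hhat + FadingCosta.QQ p hhat + FadingCosta.NN p) *
                (FadingCosta.PP p hhat + α ^ 2 * FadingCosta.QQ p hhat) /
              (FadingCosta.PP p hhat * FadingCosta.QQ p hhat * (1 - α) ^ 2 +
                FadingCosta.NN p * (FadingCosta.PP p hhat + α ^ 2 * FadingCosta.QQ p hhat)))) ∧
      FadingCosta.infoUS p (FadingCosta.dpcInput p α) =
          ENNReal.ofReal (Real.logb 2
            ((FadingCosta.PP p hhat + α ^ 2 * FadingCosta.QQ p hhat) / FadingCosta.PP p hhat)) ∧
      FadingCosta.infoUY p (FadingCosta.dpcInput p α) (FadingCosta.gaussComposite p hhat) ≤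
        FadingCosta.infoUY p (FadingCosta.dpcInput p α) (FadingCosta.composite p hhat)) ∧
    MeasureTheory.Integrable (FadingCosta.rateIntegrand p α) (FadingCosta.estimateLaw p) ∧
    ∫ hhat, ((FadingCosta.infoUY p (FadingCosta.dpcInput p α)
            (FadingCosta.gaussComposite p hhat)).toReal -
          (FadingCosta.infoUS p (FadingCosta.dpcInput p α)).toReal)
        ∂(FadingCosta.estimateLaw p) =
      ∫ hhat, FadingCosta.rateIntegrand p α hhat ∂(FadingCosta.estimateLaw p) ∧
    FadingCosta.Admissible p (FadingCosta.dpcInput p α) ∧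
    ((∫ hhat, FadingCosta.rateIntegrand p α hhat ∂(FadingCosta.estimateLaw p) : ℝ) : EReal) ≤
      FadingCosta.meanRate p (FadingCosta.dpcInput p α) ∧
    ((∫ hhat, FadingCosta.rateIntegrand p α hhat ∂(FadingCosta.estimateLaw p) : ℝ) : EReal) ≤
      FadingCosta.singleLetterCapacity p ∧
    ((∫ hhat, FadingCosta.rateIntegrand p α hhat ∂(FadingCosta.estimateLaw p) : ℝ) : EReal) ≤
      ((FadingCosta.meanCapacity p : ENNReal) : EReal) := by
  refine ⟨?_, FadingCosta.integrable_rateIntegrand hσh hσE hσZ hQ hP α,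
    FadingCosta.integral_infoUY_sub_infoUS hσh hσE hσZ hQ hP α,
    FadingCosta.admissible_dpcInput hP α,
    FadingCosta.integral_rateIntegrand_le_meanRate hσh hσE hσZ hQ hP α,
    FadingCosta.integral_rateIntegrand_le_singleLetterCapacity hσh hσE hσZ hQ hP α,
    FadingCosta.integral_rateIntegrand_le_meanCapacity hσh hσE hσZ hQ hP α⟩
  filter_upwards [FadingCosta.posterior_ae_eq hσh hσE, FadingCosta.ae_gain_ne_zero hσh hσE]
    with hhat hpost h0
  refine ⟨?_, ?_, FadingCosta.infoUY_composite_ge hσh hσE hσZ hQ hP α hpost⟩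
  · rw [FadingCosta.infoUY_gaussComposite hσh hσE hσZ hQ hP,
      FadingCosta.infoUY_arg_eq hσh hσE hσZ hQ hP α h0]
  · rw [FadingCosta.infoUS_dpcInput hQ hP, FadingCosta.infoUS_arg_eq hQ hP α h0]
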